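/- Let $\theta>0$, $\eta=\sqrt\theta$, $\mathbb Z'=\mathbb Z+\frac12$. The poissonized Plancherel measure gives a Young diagram $\lambda$ the weight $$\Pr\{\lambda\}=e^{-\theta}\theta^{|\lambda|}\Big(\frac{\dim\lambda}{|\lambda|!}\Big)^2,$$ where $\dim\lambda$ is the number of standard Young tableaux of shape $\lambda$. If $\lambda=(p_1,\dots,p_d\,|\,q_1,\dots,q_d)$ in Frobenius coordinates ($p_i=\lambda_i-i$, $q_i=\lambda_i'-i$), put $\mathrm{Fr}(\lambda)=\{p_i+\frac12\}\cup\{-q_i-\frac12\}\subset\mathbb Z'$, and let $\mathcal P$ be the law of the random point configuration $\mathrm{Fr}(\lambda)$ on $\mathbb Z'$. For $x,y\in\mathbb Z'$ let $$L(x,y)=0\ \text{ if } xy>0,\qquad L(x,y)=\frac{\theta^{(|x|+|y|)/2}}{(|x|-\frac12)!\,(|y|-\frac12)!}\,\frac1{x-y}\ \text{ if } xy<0 .$$ Let $J_\nu(u)=\sum_{k\ge0}\frac{(-1)^k(u/2)^{\nu+2k}}{k!\,\Gamma(\nu+k+1)}$ be the Bessel function and, for $\zeta\in\mathbb C$, $$p(\zeta)=\sqrt\eta\begin{pmatrix}J_{\zeta-\frac12}(2\eta)&J_{-\zeta+\frac12}(2\eta)\\-J_{\zeta+\frac12}(2\eta)&J_{-\zeta-\frac12}(2\eta)\end{pmatrix}.$$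 For $x\in\mathbb Z'$ set $(F_1,F_2,G_1,G_2)(x)=(p_{11},p_{21},-p_{21},p_{11})(x)$ if $x>0$ and $(F_1,F_2,G_1,G_2)(x)=(p_{12},p_{22},p_{22},-p_{12})(x)$ if $x<0$. The discrete Bessel kernel is $$K(x,y)=\frac{F_1(x)G_1(y)+F_2(x)G_2(y)}{x-y}\quad(x\ne y),\qquad K(x,x)=F_1'(x)G_1(x)+F_2'(x)G_2(x),$$ where $F_i'(x)$ is the derivative at $\zeta=x$ of the entry of $p(\zeta)$ that defines $F_i(x)$ (L'Hospital's rule). Then: 1. The poissonized Plancherel measure is a probability measure, and $\mathcal P$ is given by the L-kernel: $\mathcal P\{Y\}=e^{-\theta}\det[L(y_i,y_j)]_{i,j=1}^n$ for every finite $Y=\{y_1,\dots,y_n\}\subset\mathbb Z'$. 2. $\sum_{x,y\in\mathbb Z'}|L(x,y)|<\infty$; $L$ is the matrix of a bounded operator on $\ell^2(\mathbb Z')$, $1+L$ is invertible, and the matrix of $L(1+L)^{-1}$ is $K$. 3. $\mathcal P$ is a determinantal point process with correlation kernel $K$: for all distinct $x_1,\dots,x_n\in\mathbb Z'$, $\mathcal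 P\{A: A\supset\{x_1,\dots,x_n\}\}=\det[K(x_i,x_j)]_{i,j=1}^n$. 4. The entries of $p(\zeta)$ are entire functions of $\zeta$, and $F_1(x)G_1(x)+F_2(x)G_2(x)=0$ for all $x\in\mathbb Z'$. 5. The matrix $$m(\zeta)=p(\zeta)\begin{pmatrix}\eta^{-\zeta}\,\Gamma(\zeta+\frac12)&0\\0&\eta^{\zeta}\,\Gamma(-\zeta+\frac12)\end{pmatrix}$$ is the unique $2\times2$ matrix function on $\mathbb C\setminus\mathbb Z'$ that is analytic there, has (at most) simple poles at the points of $\mathbb Z'$ with $\operatorname{Res}_{\zeta=x}m(\zeta)=\lim_{\zeta\to x}m(\zeta)w(x)$ for all $x\in\mathbb Z'$, and tends to the identity matrix as $\zeta\to\infty$ with the distance from $\zeta$ to $\mathbb Z'$ bounded away from zero. Here $$w(x)=\begin{pmatrix}0&-\frac{\theta^{x}}{(x-\frac12)!^2}\\0&0\end{pmatrix}\ (x>0),\qquad w(x)=\begin{pmatrix}0&0\\-\frac{\theta^{-x}}{(-x-\frac12)!^2}&0\end{pmatrix}\ (x<0).$$ -/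

import Mathlib

open MeasureTheory Filter Topology
open scoped Nat

noncomputable section

/-- The set `ℤ' = ℤ + 1/2` of half-integers, as a set of real numbers. -/
def HalfInts : Set ℝ := {x | ∃ n : ℤ, x = (n : ℝ) + 1 / 2}

/-- The positive half-integer `p + 1/2`. -/
def posHalf (p : ℕ) : HalfInts :=
  ⟨(p : ℝ) + 1 / 2, ⟨(p : ℤ), by push_cast; ring⟩⟩

/-- The negative half-integer `-q - 1/2`. -/
def negHalf (q : ℕ) : HalfInts :=
  ⟨-(q : ℝ) - 1 / 2, ⟨-(q : ℤ) - 1, by push_cast; ring⟩⟩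

/-! ## The poissonized Plancherel measure -/

/-- `dim μ`, the number of standard Young tableaux of shape `μ`: fillings of the cells by
`0, …, |μ| - 1`, each used once, increasing along rows and columns. -/
def dimYoung (μ : YoungDiagram) : ℕ :=
  Nat.card {T : {c : ℕ × ℕ // c ∈ μ.cells} ≃ Fin μ.card // StrictMono T}

/-- The weight `e^{-θ} θ^{|μ|} (dim μ / |μ|!)²`. -/
def plancherelWeight (θ : ℝ) (μ : YoungDiagram) : ℝ :=
  Real.exp (-θ) * θ ^ μ.card * ((dimYoung μ : ℝ) / (μ.card ! : ℝ)) ^ 2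

/-- All sets of Young diagrams are measurable. -/
instance youngDiagramMeasurableSpace : MeasurableSpace YoungDiagram := ⊤

/-- The poissonized Plancherel measure on the set of all Young diagrams. -/
def poissonizedPlancherel (θ : ℝ) : Measure YoungDiagram :=
  Measure.sum fun μ => ENNReal.ofReal (plancherelWeight θ μ) • Measure.dirac μ

/-- Row indices (counted from `0`) of the diagonal cells of `μ`. -/
def diagIndices (μ : YoungDiagram) : Finset ℕ :=
  (μ.cells.filter fun c => c.1 = c.2).image Prod.fst

/-- The configuration `{pᵢ + 1/2} ∪ {-qᵢ - 1/2}` attached to `μ = (p | q)`. With rows and columns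
counted from `0`, the Frobenius coordinates are `pᵢ = μᵢ - i - 1` and `qᵢ = μ'ᵢ - i - 1`, for `i`
running over the diagonal cells; no subtraction truncates there. -/
def frobeniusConfig (μ : YoungDiagram) : Finset HalfInts :=
  (diagIndices μ).image (fun i => posHalf (μ.rowLen i - (i + 1))) ∪
    (diagIndices μ).image (fun i => negHalf (μ.colLen i - (i + 1)))

/-- The random point configuration on `ℤ'` attached to the poissonized Plancherel measure. -/
def plancherelProcess (θ : ℝ) : Measure (Set HalfInts) :=
  (poissonizedPlancherel θ).map fun μ => (frobeniusConfig μ : Set HalfInts)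

/-- `P` is a probability measure on the subsets of `X` (with the product σ-algebra of `2^X`) which
is a determinantal point process with correlation kernel `K`. -/
def IsDeterminantal {X : Type*} (P : Measure (Set X)) (K : X → X → ℂ) : Prop :=
  IsProbabilityMeasure P ∧
    ∀ (n : ℕ) (x : Fin n → X), Function.Injective x →
      ((P.real {A | ∀ i, x i ∈ A} : ℝ) : ℂ) = Matrix.det (Matrix.of fun i j => K (x i) (x j))

/-! ## The L-kernel and operators on `ℓ²` -/

/-- The L-kernel of the poissonized Plancherel measure; for `x` in `ℤ'` the number `|x| - 1/2` is a
nonnegative integer. -/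
def kernelL (θ : ℝ) (x y : HalfInts) : ℝ :=
  if 0 < (x : ℝ) * (y : ℝ) then 0
  else θ ^ ((|(x : ℝ)| + |(y : ℝ)|) / 2) /
      ((⌊|(x : ℝ)| - 1 / 2⌋₊ ! : ℝ) * (⌊|(y : ℝ)| - 1 / 2⌋₊ ! : ℝ)) *
      (1 / ((x : ℝ) - (y : ℝ)))

/-- `K` is the matrix of the bounded operator `T` on `ℓ²(X)`; the matrix determines `T`. -/
def HasMatrix {X : Type*} [DecidableEq X]
    (T : lp (fun _ : X => ℂ) 2 →L[ℂ] lp (fun _ : X => ℂ) 2) (K : X → X → ℂ) : Prop :=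
  ∀ x y, (T (lp.single 2 y (1 : ℂ))) x = K x y

/-! ## Bessel functions and the discrete Bessel kernel -/

/-- The Bessel function of the first kind
`J_ν(u) = ∑ₖ (-1)^k (u/2)^{ν+2k} / (k! Γ(ν+k+1))`, with `1/Γ = 0` at the poles of `Γ`
(Mathlib's convention `Γ = 0` there gives this value). -/
def besselJ (ν u : ℂ) : ℂ :=
  ∑' k : ℕ, (-1 : ℂ) ^ k * (u / 2) ^ (ν + 2 * (k : ℂ)) /
    ((k ! : ℂ) * Complex.Gamma (ν + (k : ℂ) + 1))

/-- The matrix `p(ζ)` of Bessel functions. -/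
def besselP (η : ℝ) (ζ : ℂ) : Matrix (Fin 2) (Fin 2) ℂ :=
  ((Real.sqrt η : ℝ) : ℂ) •
    !![besselJ (ζ - 1 / 2) (2 * (η : ℂ)), besselJ (-ζ + 1 / 2) (2 * (η : ℂ));
      -besselJ (ζ + 1 / 2) (2 * (η : ℂ)), besselJ (-ζ - 1 / 2) (2 * (η : ℂ))]

/-- The column of `p` from which `F` is built: the first for `x > 0`, the second for `x < 0`. -/
def colIdx (x : HalfInts) : Fin 2 := if 0 < (x : ℝ) then 0 else 1

/-- `F₁(x)` is `p₁₁(x)` for `x > 0` and `p₁₂(x)` for `x < 0`. -/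
def kernelF1 (η : ℝ) (x : HalfInts) : ℂ := besselP η ((x : ℝ) : ℂ) 0 (colIdx x)

/-- `F₂(x)` is `p₂₁(x)` for `x > 0` and `p₂₂(x)` for `x < 0`. -/
def kernelF2 (η : ℝ) (x : HalfInts) : ℂ := besselP η ((x : ℝ) : ℂ) 1 (colIdx x)

/-- `F₁'(x)`, the derivative in the variable of `p₁₁` (for `x > 0`) or `p₁₂` (for `x < 0`). -/
def kernelF1' (η : ℝ) (x : HalfInts) : ℂ :=
  deriv (fun ζ : ℂ => besselP η ζ 0 (colIdx x)) ((x : ℝ) : ℂ)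

/-- `F₂'(x)`, the derivative in the variable of `p₂₁` (for `x > 0`) or `p₂₂` (for `x < 0`). -/
def kernelF2' (η : ℝ) (x : HalfInts) : ℂ :=
  deriv (fun ζ : ℂ => besselP η ζ 1 (colIdx x)) ((x : ℝ) : ℂ)

/-- `G₁(x)` is `-p₂₁(x)` for `x > 0` and `p₂₂(x)` for `x < 0`. -/
def kernelG1 (η : ℝ) (x : HalfInts) : ℂ :=
  if 0 < (x : ℝ) then -besselP η ((x : ℝ) : ℂ) 1 0 else besselP η ((x : ℝ) : ℂ) 1 1

/-- `G₂(x)` is `p₁₁(x)` for `x > 0` and `-p₁₂(x)` for `x < 0`. -/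
def kernelG2 (η : ℝ) (x : HalfInts) : ℂ :=
  if 0 < (x : ℝ) then besselP η ((x : ℝ) : ℂ) 0 0 else -besselP η ((x : ℝ) : ℂ) 0 1

/-- The discrete Bessel kernel, with the diagonal values given by L'Hospital's rule. -/
def discreteBesselKernel (η : ℝ) (x y : HalfInts) : ℂ :=
  if x = y then kernelF1' η x * kernelG1 η x + kernelF2' η x * kernelG2 η x
  else (kernelF1 η x * kernelG1 η y + kernelF2 η x * kernelG2 η y) /
    (((x : ℝ) : ℂ) - ((y : ℝ) : ℂ))

/-! ## Discrete Riemann–Hilbert problems -/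

/-- `m` solves the discrete Riemann–Hilbert problem `(X, w)`: it is analytic off `X` and at each
`x ∈ X` has (at most) a simple pole with residue `lim_{ζ → x} m(ζ) w(x)`. The values of `m` on `X`
and of `w` off `X` play no role. -/
def SolvesDRHP (X : Set ℂ) (w m : ℂ → Matrix (Fin 2) (Fin 2) ℂ) : Prop :=
  (∀ i j, DifferentiableOn ℂ (fun ζ => m ζ i j) Xᶜ) ∧
    ∀ x ∈ X, ∃ R : Matrix (Fin 2) (Fin 2) ℂ,
      Tendsto (fun ζ => (ζ - x) • m ζ) (𝓝[≠] x) (𝓝 R) ∧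
        Tendsto (fun ζ => m ζ * w x) (𝓝[≠] x) (𝓝 R)

/-- The normalized problem: in addition `m(ζ) → I` as `ζ → ∞` with the distance from `ζ` to `X`
bounded away from zero. -/
def SolvesNormalizedDRHP (X : Set ℂ) (w m : ℂ → Matrix (Fin 2) (Fin 2) ℂ) : Prop :=
  SolvesDRHP X w m ∧
    ∀ ε : ℝ, 0 < ε →
      Tendsto m (Bornology.cobounded ℂ ⊓ 𝓟 {ζ | ∀ x ∈ X, ε ≤ dist ζ x}) (𝓝 1)

/-- The half-integers as a subset of the complex plane. -/
def halfIntsC : Set ℂ := (fun x : ℝ => (x : ℂ)) '' HalfInts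

/-- The matrix `w(x)` of the problem on `ℤ'` attached to the L-kernel; it is used at half-integers
`x` only. -/
def jumpW (θ : ℝ) (x : ℂ) : Matrix (Fin 2) (Fin 2) ℂ :=
  if 0 < x.re then !![0, -((θ ^ x.re / (⌊x.re - 1 / 2⌋₊ ! : ℝ) ^ 2 : ℝ) : ℂ); 0, 0]
  else !![0, 0; -((θ ^ (-x.re) / (⌊-x.re - 1 / 2⌋₊ ! : ℝ) ^ 2 : ℝ) : ℂ), 0]

/-- `m(ζ) = p(ζ) diag(η^{-ζ} Γ(ζ + 1/2), η^ζ Γ(-ζ + 1/2))`. -/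
def besselM (η : ℝ) (ζ : ℂ) : Matrix (Fin 2) (Fin 2) ℂ :=
  besselP η ζ *
    !![(η : ℂ) ^ (-ζ) * Complex.Gamma (ζ + 1 / 2), 0;
      0, (η : ℂ) ^ ζ * Complex.Gamma (-ζ + 1 / 2)]

end

/-! The combinatorial input is the Frobenius-type formula dim λ / |λ|! = det[1/(p_i! q_j!
(p_i+q_j+1))]. Lowering one coordinate at a time turns this determinant into |λ| times itself
(`frobDet_down`), which is the branching recursion of dim λ once the terms that are not diagrams
drop out as determinants with two equal rows or columns (`dimYoung_div_factorial`). Raising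
coordinates gives a dual recursion (`frobDet_up`), and counting pairs (diagram, removable cell) in
two ways yields ∑ (dim λ / n!)² = 1/n!, hence total mass one. A minor of L on Fr(λ) is, after
ordering points by sign, the determinant of an off-diagonal block matrix with blocks C and -Cᵀ, that
is (det C)² = θ^{|λ|} (dim λ / |λ|!)²; unbalanced configurations have zero minor.

For the correlations, restrict to a finite window Λ. Summing principal minors gives P{x ⊂ A ⊂ Λ} =
e^{-θ} det(1+L_Λ) det K_Λ(x_i,x_j) with K_Λ = L_Λ(1+L_Λ)⁻¹. Because L is real antisymmetric, 1+L_Λ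
never shrinks a vector, so K_Λ converges to any solution of K + LK = L with summable columns
(`finiteKernel_tendsto`). The prefactor tends to 1 by the case of no points. The same equation
identifies the matrix of L(1+L)⁻¹ on ℓ², since antisymmetry also makes 1+L invertible there.

It remains to solve K + LK = L by the Bessel kernel (`kernel_equation`). For fixed y the kernel is
an entire function of ζ on each column of p. Multiplied by the matching diagonal factor of m it
acquires simple poles on one half of ℤ' and vanishes at infinity because m → 1, so it is the sum of
its principal parts. The residues are values on the wrong column of p. There J_{-n} = (-1)^n J_n
makes the columns proportional, which gives back K off the diagonal; on the diagonal the derivative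
of det p = sin(π(ζ+1/2))/π produces an extra -1. The resulting identity is K = -L(K-1).

The Riemann–Hilbert part rests on Liouville's theorem. For two solutions m, n the entries of n J mᵀ,
with J the standard symplectic matrix, have no residues by the jump condition, so n J mᵀ = J. This
yields both det m = 1, hence det p, and uniqueness. -/

noncomputable section

/-! ### Linear extensions and their branching recursion -/

section LinearExtensions

variable {α : Type*} [PartialOrder α]

/-- Linear extensions of a finite subset of a partial order, as labellings by `0, …, |s| - 1`. -/
def linExt (s : Finset α) : Set (s → ℕ) :=
  {f | StrictMono f ∧ Function.Injective f ∧ ∀ x, f x < s.card}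

theorem finite_linExt (s : Finset α) : (linExt s).Finite := by
  refine (Set.Finite.pi' (fun _ : s => Set.finite_Iio s.card)).subset ?_
  rintro f ⟨-, -, h⟩ x
  exact h x

open Classical in
/-- The maximal elements of a finite set. -/
def maxElems (s : Finset α) : Finset α := s.filter fun c => ∀ x ∈ s, ¬ c < x

theorem mem_maxElems {s : Finset α} {c : α} :
    c ∈ maxElems s ↔ c ∈ s ∧ ∀ x ∈ s, ¬ c < x := by
  classical
  simp [maxElems]

theorem mem_of_mem_maxElems {s : Finset α} {c : α} (h : c ∈ maxElems s) : c ∈ s :=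
  (mem_maxElems.1 h).1

theorem exists_linExt_eq {s : Finset α} {f : s → ℕ} (hf : f ∈ linExt s) {k : ℕ}
    (hk : k < s.card) : ∃ x, f x = k := by
  obtain ⟨-, h2, h3⟩ := hf
  have : Function.Bijective (fun x : s => (⟨f x, h3 x⟩ : Fin s.card)) := by
    rw [Fintype.bijective_iff_injective_and_card]
    refine ⟨fun x y h => h2 (by simpa using h), by simp⟩
  obtain ⟨x, hx⟩ := this.2 ⟨k, hk⟩
  exact ⟨x, by simpa using hx⟩

variable [DecidableEq α]

/-- Extend a linear extension of `s \ {c}` by giving `c` the largest label. -/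
def linExtInsert (s : Finset α) (c : α) (g : ↥(s.erase c) → ℕ) : s → ℕ := fun x =>
  if h : (x : α) = c then s.card - 1 else g ⟨x, Finset.mem_erase.2 ⟨h, x.2⟩⟩

theorem linExtInsert_mem {s : Finset α} {c : α} (hc : c ∈ maxElems s)
    {g : ↥(s.erase c) → ℕ} (hg : g ∈ linExt (s.erase c)) : linExtInsert s c g ∈ linExt s := by
  obtain ⟨hcs, hmax⟩ := mem_maxElems.1 hc
  obtain ⟨h1, h2, h3⟩ := hg
  have hcard := Finset.card_erase_of_mem hcs
  have hpos : 0 < s.card := Finset.card_pos.2 ⟨c, hcs⟩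
  refine ⟨?_, ?_, ?_⟩
  · rintro ⟨x, hx⟩ ⟨y, hy⟩ hxy
    have hxy' : x < y := hxy
    unfold linExtInsert
    by_cases hxc : x = c
    · exact absurd (hxc ▸ hxy') (hmax y hy)
    · by_cases hyc : y = c
      · simp only [hxc, hyc, dite_true, dite_false]
        have := h3 ⟨x, Finset.mem_erase.2 ⟨hxc, hx⟩⟩
        omega
      · simp only [hxc, hyc, dite_false]
        exact h1 (by exact hxy')
  · rintro ⟨x, hx⟩ ⟨y, hy⟩ hxy
    unfold linExtInsert at hxy
    by_cases hxc : x = c <;> by_cases hyc : y = c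
    · simp [hxc, hyc]
    · simp only [hxc, hyc, dite_true, dite_false] at hxy
      have := h3 ⟨y, Finset.mem_erase.2 ⟨hyc, hy⟩⟩
      omega
    · simp only [hxc, hyc, dite_true, dite_false] at hxy
      have := h3 ⟨x, Finset.mem_erase.2 ⟨hxc, hx⟩⟩
      omega
    · simp only [hxc, hyc, dite_false] at hxy
      have := h2 hxy
      simpa using this
  · rintro ⟨x, hx⟩
    unfold linExtInsert
    by_cases hxc : x = c
    · simp only [hxc, dite_true]; omega
    · simp only [hxc, dite_false]
      have := h3 ⟨x, Finset.mem_erase.2 ⟨hxc, hx⟩⟩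
      omega

/-- The number of linear extensions satisfies the branching recursion. -/
theorem card_linExt {s : Finset α} (hs : s.Nonempty) :
    Nat.card (linExt s) = ∑ c ∈ maxElems s, Nat.card (linExt (s.erase c)) := by
  classical
  have hfin : ∀ t : Finset α, Finite (linExt t) := fun t => (finite_linExt t).to_subtype
  have hpos : 0 < s.card := Finset.card_pos.2 hs
  -- The largest label always sits on a maximal element, and deleting that element inverts Φ.
  let Φ : (Σ c : maxElems s, linExt (s.erase (c : α))) → linExt s := fun q =>
    ⟨linExtInsert s q.1 q.2.1, linExtInsert_mem q.1.2 q.2.2⟩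
  have hΦ : Function.Bijective Φ := by
    constructor
    · rintro ⟨⟨c, hc⟩, ⟨g, hg⟩⟩ ⟨⟨c', hc'⟩, ⟨g', hg'⟩⟩ h
      have h0 : linExtInsert s c g = linExtInsert s c' g' := congrArg Subtype.val h
      have hcc : c = c' := by
        by_contra hne
        have h1 := congrFun h0 ⟨c, mem_of_mem_maxElems hc⟩
        simp only [linExtInsert, dite_true, hne, dite_false] at h1
        have h2 := hg'.2.2 ⟨c, Finset.mem_erase.2 ⟨hne, mem_of_mem_maxElems hc⟩⟩
        rw [Finset.card_erase_of_mem (mem_of_mem_maxElems hc')] at h2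
        omega
      subst hcc
      have : g = g' := by
        funext x
        have h1 := congrFun h0 ⟨x, Finset.mem_of_mem_erase x.2⟩
        simpa [linExtInsert, Finset.ne_of_mem_erase x.2] using h1
      subst this
      rfl
    · rintro ⟨f, hf⟩
      obtain ⟨⟨c, hcs⟩, hc⟩ := exists_linExt_eq hf (Nat.sub_lt hpos one_pos)
      have hcm : c ∈ maxElems s := by
        refine mem_maxElems.2 ⟨hcs, fun x hx hlt => ?_⟩
        have h1 : f ⟨c, hcs⟩ < f ⟨x, hx⟩ := hf.1 hlt
        have h2 := hf.2.2 ⟨x, hx⟩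
        omega
      refine ⟨⟨⟨c, hcm⟩, ⟨fun x => f ⟨x, Finset.mem_of_mem_erase x.2⟩, ?_, ?_, ?_⟩⟩, ?_⟩
      · intro x y hxy
        exact hf.1 hxy
      · intro x y hxy
        exact Subtype.ext (congrArg (fun z : s => (z : α)) (hf.2.1 hxy))
      · rintro ⟨x, hx⟩
        rw [Finset.card_erase_of_mem hcs]
        have h1 := hf.2.2 ⟨x, Finset.mem_of_mem_erase hx⟩
        have h2 : f ⟨x, Finset.mem_of_mem_erase hx⟩ ≠ s.card - 1 := by
          rw [← hc]
          intro h
          have := hf.2.1 h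
          exact Finset.ne_of_mem_erase hx (by simpa using this)
        simp only
        omega
      · apply Subtype.ext
        funext x
        change linExtInsert s c _ x = f x
        unfold linExtInsert
        by_cases hxc : (x : α) = c
        · rw [dif_pos hxc, ← hc]
          congr 1
          exact Subtype.ext hxc.symm
        · rw [dif_neg hxc]
  rw [← Nat.card_congr (Equiv.ofBijective Φ hΦ), Nat.card_sigma,
    ← Finset.sum_coe_sort (maxElems s)]

omit [DecidableEq α] in
theorem card_linExt_empty : Nat.card (linExt (∅ : Finset α)) = 1 := by
  rw [Nat.card_eq_one_iff_unique]
  refine ⟨⟨fun a b => Subtype.ext (funext fun x => absurd x.2 (Finset.notMem_empty _))⟩, ⟨⟨fun _ => 0, ?_⟩⟩⟩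
  refine ⟨fun x => absurd x.2 (Finset.notMem_empty _), fun x => absurd x.2 (Finset.notMem_empty _),
    fun x => absurd x.2 (Finset.notMem_empty _)⟩

end LinearExtensions

/-- An injection into a set of the same finite size is a bijection, so the two kinds of labelling
agree. Labels in `ℕ` keep their codomain when a cell is removed. -/
theorem dimYoung_eq_card_linExt (μ : YoungDiagram) : dimYoung μ = Nat.card (linExt μ.cells) := by
  refine Nat.card_congr (Equiv.ofBijective
    (fun T => ⟨fun x => (T.1 x : ℕ), fun x y h => T.2 h,
      fun x y h => T.1.injective (Fin.ext h), fun x => (T.1 x).2⟩) ⟨?_, ?_⟩)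
  · rintro ⟨T, hT⟩ ⟨T', hT'⟩ h
    apply Subtype.ext
    apply Equiv.ext
    intro x
    have := congrFun (congrArg Subtype.val h) x
    exact Fin.ext this
  · rintro ⟨f, h1, h2, h3⟩
    have hb : Function.Bijective (fun x : μ.cells => (⟨f x, h3 x⟩ : Fin μ.card)) := by
      rw [Fintype.bijective_iff_injective_and_card]
      exact ⟨fun x y h => h2 (by simpa using h), by simp⟩
    exact ⟨⟨Equiv.ofBijective _ hb, fun x y h => h1 h⟩, rfl⟩

/-! ### Determinants under replacement of rows or columns and rank-one updates -/

section DeterminantIdentities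

open Matrix

variable {n : Type*} [Fintype n] [DecidableEq n] {R : Type*} [CommRing R]

/-- Cramer's rule, summed over the columns: the derivative of the determinant at M in the direction
A. It converts "change one coordinate, sum over all choices" into a single trace. -/
theorem sum_det_updateCol (M A : Matrix n n R) :
    ∑ j, (M.updateCol j fun i => A i j).det = (M.adjugate * A).trace := by
  refine Finset.sum_congr rfl fun j _ => ?_
  rw [← cramer_apply, cramer_eq_adjugate_mulVec]
  rfl

theorem sum_det_updateRow (M A : Matrix n n R) :
    ∑ i, (M.updateRow i (A i)).det = (M.adjugate * A).trace := by
  have h := sum_det_updateCol Mᵀ Aᵀ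
  rw [← adjugate_transpose, ← transpose_mul, trace_transpose, trace_mul_comm] at h
  rw [← h]
  refine Finset.sum_congr rfl fun i _ => ?_
  rw [← det_transpose, ← updateCol_transpose]
  rfl

/-- The matrix determinant lemma in adjugate form, so that no invertibility is assumed. Both sides
are continuous in M, and invertible matrices are dense. -/
theorem det_sub_vecMulVec (M : Matrix n n ℝ) (u v : n → ℝ) :
    (M - vecMulVec u v).det = M.det - (M.adjugate * vecMulVec u v).trace := by
  have key : ∀ A : Matrix n n ℝ, A.det ≠ 0 →
      (A - vecMulVec u v).det = A.det - (A.adjugate * vecMulVec u v).trace := by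
    intro A hA
    have h := det_add_replicateCol_mul_replicateRow (ι := Unit) (A := A) hA.isUnit (-u) v
    have h1 : A + replicateCol Unit (-u) * replicateRow Unit v = A - vecMulVec u v := by
      rw [sub_eq_add_neg, vecMulVec_eq Unit]
      congr 1
      ext i j
      simp [Matrix.mul_apply]
    have h2 : (replicateRow Unit v * A⁻¹ * replicateCol Unit (-u)).trace =
        - (A⁻¹ * vecMulVec u v).trace := by
      rw [Matrix.mul_assoc, trace_mul_comm, Matrix.mul_assoc, vecMulVec_eq Unit, ← trace_neg]
      congr 1
      rw [← Matrix.mul_neg]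
      congr 1
      ext i j
      simp [Matrix.mul_apply]
    rw [h1, det_unique (n := Unit)] at h
    rw [h, Matrix.add_apply, Matrix.one_apply_eq]
    have h3 : (replicateRow Unit v * A⁻¹ * replicateCol Unit (-u)) default default =
        (replicateRow Unit v * A⁻¹ * replicateCol Unit (-u)).trace := by simp [trace]
    rw [h3, h2, inv_def, Ring.inverse_eq_inv', smul_mul_assoc, trace_smul, smul_eq_mul]
    field_simp
    ring
  let f : ℝ → Matrix n n ℝ := fun t => Matrix.scalar n t + M
  have hf : Continuous f := by
    refine Continuous.add ?_ continuous_const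
    refine continuous_matrix fun i j => ?_
    by_cases h : i = j <;> simp [h, Matrix.scalar_apply] <;> fun_prop
  -- The exceptional t are roots of the characteristic polynomial of -M, hence finite in number.
  have hne : ∀ᶠ t in 𝓝[≠] (0 : ℝ), (f t).det ≠ 0 := by
    have h1 : {t : ℝ | (f t).det = 0}.Finite := by
      refine ((-M).charpoly.roots.toFinset.finite_toSet).subset fun t ht => ?_
      have h2 : (-M).charpoly.eval t = 0 := by
        rw [eval_charpoly, sub_neg_eq_add]
        exact ht
      have h3 := (-M).charpoly_monic.ne_zero
      simp [h3, h2]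
    have h5 := (h1.subset (Set.sdiff_subset (t := {0}))).isClosed.isOpen_compl.mem_nhds
      (show (0 : ℝ) ∈ ({t : ℝ | (f t).det = 0} \ {0})ᶜ by simp)
    filter_upwards [mem_nhdsWithin_of_mem_nhds h5, self_mem_nhdsWithin] with t ht ht0 h
    exact ht ⟨h, ht0⟩
  have hL : Tendsto (fun t => (f t - vecMulVec u v).det) (𝓝[≠] 0) (𝓝 (M - vecMulVec u v).det) := by
    have : Continuous fun t => (f t - vecMulVec u v).det :=
      (hf.sub continuous_const).matrix_det
    have h := (this.tendsto 0).mono_left (nhdsWithin_le_nhds (s := {0}ᶜ))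
    simpa [f] using h
  have hR : Tendsto (fun t => (f t).det - ((f t).adjugate * vecMulVec u v).trace) (𝓝[≠] 0)
      (𝓝 (M.det - (M.adjugate * vecMulVec u v).trace)) := by
    have : Continuous fun t => (f t).det - ((f t).adjugate * vecMulVec u v).trace :=
      hf.matrix_det.sub ((hf.matrix_adjugate.matrix_mul continuous_const).matrix_trace)
    have h := (this.tendsto 0).mono_left (nhdsWithin_le_nhds (s := {0}ᶜ))
    simpa [f] using h
  refine tendsto_nhds_unique hL (hR.congr' ?_)
  filter_upwards [hne] with t ht
  exact (key _ ht).symm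

end DeterminantIdentities

/-! ### Raising and lowering recursions of the Frobenius determinant -/

section FrobeniusDeterminant

open Matrix

/-- `1 / (a! b! (a + b + 1))`. -/
def frobEntry (a b : ℕ) : ℝ := 1 / ((a ! : ℝ) * (b ! : ℝ) * ((a : ℝ) + b + 1))

theorem frobEntry_comm (a b : ℕ) : frobEntry a b = frobEntry b a := by
  unfold frobEntry; congr 1; ring

/-- The matrix `1 / (pᵢ! qⱼ! (pᵢ + qⱼ + 1))`. -/
def frobMat (d : ℕ) (p q : ℕ → ℕ) : Matrix (Fin d) (Fin d) ℝ :=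
  Matrix.of fun i j => frobEntry (p i) (q j)

/-- The determinant `det [1 / (pᵢ! qⱼ! (pᵢ + qⱼ + 1))]`. -/
def frobDet (d : ℕ) (p q : ℕ → ℕ) : ℝ := (frobMat d p q).det

theorem frobMat_transpose (d : ℕ) (p q : ℕ → ℕ) : (frobMat d p q)ᵀ = frobMat d q p := by
  ext i j
  simp [frobMat, frobEntry_comm]

theorem frobDet_comm (d : ℕ) (p q : ℕ → ℕ) : frobDet d p q = frobDet d q p := by
  rw [frobDet, ← det_transpose, frobMat_transpose, frobDet]

/-- Changing a coordinate by one may make it collide with its neighbour; such terms correspond to no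
diagram, and this removes them from the recursions. -/
theorem frobDet_eq_zero {d : ℕ} {p q : ℕ → ℕ} {i k : ℕ} (hi : i < d) (hk : k < d) (hik : i ≠ k)
    (h : p i = p k) : frobDet d p q = 0 := by
  refine det_zero_of_row_eq (i := ⟨i, hi⟩) (j := ⟨k, hk⟩) (by simpa using hik) ?_
  funext j
  simp [frobMat, h]

theorem det_updateRow_frobMat {d : ℕ} (p q : ℕ → ℕ) (i : Fin d) (a : ℕ) :
    ((frobMat d p q).updateRow i fun j => frobEntry a (q j)).det =
      frobDet d (Function.update p i a) q := by
  unfold frobDet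
  congr 1
  ext k j
  rw [updateRow_apply]
  by_cases h : k = i
  · subst h; simp [frobMat]
  · have : (k : ℕ) ≠ i := fun h' => h (Fin.ext h')
    simp [frobMat, h, this]

theorem det_updateCol_frobMat {d : ℕ} (p q : ℕ → ℕ) (j : Fin d) (b : ℕ) :
    ((frobMat d p q).updateCol j fun i => frobEntry (p i) b).det =
      frobDet d p (Function.update q j b) := by
  rw [frobDet_comm, ← det_updateRow_frobMat, ← det_transpose, ← updateRow_transpose,
    frobMat_transpose]
  simp only [frobEntry_comm b]

/-- Over the common denominator (a+1)! (b+1)! (a+b+2) the numerators add up to (b+1)+(a+1), which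
cancels the last factor. The point is that the result has rank one. -/
theorem frobEntry_raise (a b : ℕ) : frobEntry (a + 1) b + frobEntry a (b + 1) =
    1 / ((a + 1)! : ℝ) * (1 / ((b + 1)! : ℝ)) := by
  unfold frobEntry
  rw [Nat.factorial_succ, Nat.factorial_succ]
  push_cast
  have h1 : (a ! : ℝ) ≠ 0 := by positivity
  have h2 : (b ! : ℝ) ≠ 0 := by positivity
  have h3 : (a : ℝ) + 1 ≠ 0 := by positivity
  have h4 : (b : ℝ) + 1 ≠ 0 := by positivity
  have h5 : (a : ℝ) + b + 2 ≠ 0 := by positivity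
  have e1 : (a : ℝ) + 1 + b + 1 = a + b + 2 := by ring
  have e2 : (a : ℝ) + (b + 1) + 1 = a + b + 2 := by ring
  rw [e1, e2]
  field_simp
  ring

/-- Both lowered entries have last factor a+b, and their numerators add up to a+b, leaving 1/(a!
b!). For a = b = 0 nothing can be lowered and the third summand supplies the missing 1, which stands
for removing a one-cell hook. -/
theorem frobEntry_lower (a b : ℕ) : (if a = 0 then 0 else frobEntry (a - 1) b) +
    (if b = 0 then 0 else frobEntry a (b - 1)) + (if a = 0 ∧ b = 0 then 1 else 0) =
    ((a : ℝ) + b + 1) * frobEntry a b := by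
  have hp : ∀ m : ℕ, (m ! : ℝ) ≠ 0 := fun m => by positivity
  rcases a with _ | a <;> rcases b with _ | b
  · simp [frobEntry]
  · have h4 : (b : ℝ) + 1 ≠ 0 := by positivity
    have h5 : (b : ℝ) + 1 + 1 ≠ 0 := by positivity
    simp [frobEntry, Nat.factorial_succ]
    field_simp [hp b]
  · have h4 : (a : ℝ) + 1 ≠ 0 := by positivity
    have h5 : (a : ℝ) + 1 + 1 ≠ 0 := by positivity
    simp [frobEntry, Nat.factorial_succ]
    field_simp [hp a]
  · have h3 : (a : ℝ) + 1 ≠ 0 := by positivity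
    have h4 : (b : ℝ) + 1 ≠ 0 := by positivity
    have h5 : (a : ℝ) + b + 2 ≠ 0 := by positivity
    have h6 : (a : ℝ) + b + 3 ≠ 0 := by positivity
    have e1 : (a : ℝ) + (b + 1) + 1 = a + b + 2 := by ring
    have e2 : (a : ℝ) + 1 + b + 1 = a + b + 2 := by ring
    have e3 : (a : ℝ) + 1 + (b + 1) + 1 = a + b + 3 := by ring
    simp [frobEntry, Nat.factorial_succ]
    rw [e1, e2, e3]
    field_simp [hp a, hp b]
    ring

/-- The sum over all ways to raise one coordinate or to append a pair of zero coordinates. -/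
theorem frobDet_up (d : ℕ) (p q : ℕ → ℕ) (hp : p d = 0) (hq : q d = 0) :
    ∑ i ∈ Finset.range d, frobDet d (Function.update p i (p i + 1)) q +
      ∑ j ∈ Finset.range d, frobDet d p (Function.update q j (q j + 1)) + frobDet (d + 1) p q =
    frobDet d p q := by
  let u : Fin d → ℝ := fun i => 1 / ((p i + 1)! : ℝ)
  let v : Fin d → ℝ := fun j => 1 / ((q j + 1)! : ℝ)
  let A : Matrix (Fin d) (Fin d) ℝ := Matrix.of fun i j => frobEntry (p i + 1) (q j)
  let B : Matrix (Fin d) (Fin d) ℝ := Matrix.of fun i j => frobEntry (p i) (q j + 1)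
  have hA : ∑ i ∈ Finset.range d, frobDet d (Function.update p i (p i + 1)) q =
      ((frobMat d p q).adjugate * A).trace := by
    rw [← sum_det_updateRow, Finset.sum_range]
    exact Finset.sum_congr rfl fun i _ => (det_updateRow_frobMat p q i _).symm
  have hB : ∑ j ∈ Finset.range d, frobDet d p (Function.update q j (q j + 1)) =
      ((frobMat d p q).adjugate * B).trace := by
    rw [← sum_det_updateCol, Finset.sum_range]
    exact Finset.sum_congr rfl fun i _ => (det_updateCol_frobMat p q i _).symm
  have hAB : A + B = vecMulVec u v := by
    ext i j
    simp only [A, B, Matrix.add_apply, Matrix.of_apply, vecMulVec_apply, u, v]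
    exact frobEntry_raise _ _
  -- A zero coordinate gives the entry 1/(a! (a+1)) = 1/(a+1)!, so appending a zero pair borders the
  -- matrix by u, v and a corner 1; the Schur complement is the rank-one update.
  have hD : frobDet (d + 1) p q = (frobMat d p q - vecMulVec u v).det := by
    have h1 : frobDet (d + 1) p q = (fromBlocks (frobMat d p q) (replicateCol Unit u)
        (replicateRow Unit v) 1).det := by
      let e : Fin d ⊕ Unit ≃ Fin (d + 1) :=
        ((Equiv.refl (Fin d)).sumCongr (Equiv.ofUnique Unit (Fin 1))).trans finSumFinEquiv
      unfold frobDet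
      rw [← det_submatrix_equiv_self e]
      congr 1
      ext (i | i) (j | j)
      · simp [e, frobMat]
      · simp [e, frobMat, hq, u, frobEntry, Nat.factorial_succ]
        ring
      · simp [e, frobMat, hp, v, frobEntry, Nat.factorial_succ, mul_comm]
      · simp [e, frobMat, hp, hq, frobEntry]
    rw [h1, det_fromBlocks_one₂₂, ← vecMulVec_eq]
  -- The trace from raising cancels the rank-one correction from appending a pair.
  rw [hA, hB, hD, ← trace_add, ← Matrix.mul_add, hAB, det_sub_vecMulVec, frobDet]
  ring

/-- The sum over all ways to lower one coordinate or to remove a pair of zero coordinates. -/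
theorem frobDet_down (d : ℕ) (p q : ℕ → ℕ) (hp : ∀ i j, i < j → j < d → p j < p i)
    (hq : ∀ i j, i < j → j < d → q j < q i) :
    ∑ i ∈ Finset.range d, (if p i = 0 then 0 else frobDet d (Function.update p i (p i - 1)) q) +
      ∑ j ∈ Finset.range d, (if q j = 0 then 0 else frobDet d p (Function.update q j (q j - 1))) +
      (if 0 < d ∧ p (d - 1) = 0 ∧ q (d - 1) = 0 then frobDet (d - 1) p q else 0) =
    (∑ i ∈ Finset.range d, ((p i : ℝ) + q i + 1)) * frobDet d p q := by
  let A : Matrix (Fin d) (Fin d) ℝ :=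
    Matrix.of fun i j => if p i = 0 then 0 else frobEntry (p i - 1) (q j)
  let B : Matrix (Fin d) (Fin d) ℝ :=
    Matrix.of fun i j => if q j = 0 then 0 else frobEntry (p i) (q j - 1)
  let E : Matrix (Fin d) (Fin d) ℝ := Matrix.of fun i j => if p i = 0 ∧ q j = 0 then 1 else 0
  have hA : ∑ i ∈ Finset.range d,
      (if p i = 0 then 0 else frobDet d (Function.update p i (p i - 1)) q) =
      ((frobMat d p q).adjugate * A).trace := by
    rw [← sum_det_updateRow, Finset.sum_range]
    refine Finset.sum_congr rfl fun i _ => ?_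
    split_ifs with h
    · refine (det_eq_zero_of_row_eq_zero i fun j => ?_).symm
      simp [A, h]
    · rw [← det_updateRow_frobMat]
      congr 2
      funext j
      simp [A, h]
  have hB : ∑ j ∈ Finset.range d,
      (if q j = 0 then 0 else frobDet d p (Function.update q j (q j - 1))) =
      ((frobMat d p q).adjugate * B).trace := by
    rw [← sum_det_updateCol, Finset.sum_range]
    refine Finset.sum_congr rfl fun j _ => ?_
    split_ifs with h
    · refine (det_eq_zero_of_column_eq_zero j fun i => ?_).symm
      simp [B, h]
    · rw [← det_updateCol_frobMat]
      congr 2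
      funext j
      simp [B, h]
  -- Strict decrease allows only the last coordinates to be zero. Thus E is zero or the last
  -- diagonal matrix unit, whose trace against the adjugate is the corner cofactor.
  have hE : (if 0 < d ∧ p (d - 1) = 0 ∧ q (d - 1) = 0 then frobDet (d - 1) p q else 0) =
      ((frobMat d p q).adjugate * E).trace := by
    rcases d with _ | d
    · simp [Matrix.trace]
    have hpi : ∀ i : Fin (d + 1), p i = 0 → i = Fin.last d := fun i hi => by
      by_contra hne
      have := hp i d (Fin.lt_last_iff_ne_last.2 hne) (by omega)
      omega
    have hqi : ∀ i : Fin (d + 1), q i = 0 → i = Fin.last d := fun i hi => by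
      by_contra hne
      have := hq i d (Fin.lt_last_iff_ne_last.2 hne) (by omega)
      omega
    by_cases h : p d = 0 ∧ q d = 0
    · have hEs : E = Matrix.single (Fin.last d) (Fin.last d) 1 := by
        ext i j
        simp only [E, Matrix.of_apply, Matrix.single_apply]
        refine if_congr ⟨fun h' => ⟨(hpi i h'.1).symm, (hqi j h'.2).symm⟩, ?_⟩ rfl rfl
        rintro ⟨rfl, rfl⟩
        exact h
      rw [hEs, Matrix.trace_mul_single]
      simp only [h, Nat.add_sub_cancel, Nat.succ_pos, and_true, if_true]
      rw [adjugate_fin_succ_eq_det_submatrix]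
      simp only [Fin.val_last, ← two_mul, pow_mul, neg_one_sq, one_pow, one_mul,
        MulOpposite.op_one, one_smul]
      unfold frobDet
      congr 1
      ext i j
      simp [frobMat]
    · have hEs : E = 0 := by
        ext i j
        simp only [E, Matrix.of_apply, Matrix.zero_apply, ite_eq_right_iff, one_ne_zero, imp_false]
        rintro ⟨h1, h2⟩
        rw [hpi i h1] at h1
        rw [hqi j h2] at h2
        exact h ⟨h1, h2⟩
      rw [hEs, Matrix.mul_zero, Matrix.trace_zero]
      simp only [Nat.add_sub_cancel, Nat.succ_pos, true_and, if_neg h]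
  -- Splitting the factor p_i + q_j + 1 makes each summand M multiplied by a diagonal matrix on one
  -- side, and adj(M) M is the scalar det M.
  have hsum : A + B + E = Matrix.diagonal (fun i : Fin d => (p i : ℝ)) * frobMat d p q +
      frobMat d p q * Matrix.diagonal (fun i : Fin d => (q i : ℝ)) + frobMat d p q := by
    ext i j
    simp only [A, B, E, Matrix.add_apply, Matrix.of_apply, Matrix.diagonal_mul,
      Matrix.mul_diagonal]
    rw [frobEntry_lower]
    simp only [frobMat, Matrix.of_apply]
    ring
  rw [hA, hB, hE, ← trace_add, ← trace_add, ← Matrix.mul_add, ← Matrix.mul_add, hsum,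
    Matrix.mul_add, Matrix.mul_add, trace_add, trace_add, trace_mul_comm, Matrix.mul_assoc,
    mul_adjugate, ← Matrix.mul_assoc, adjugate_mul]
  simp only [Matrix.mul_smul, Matrix.smul_mul, Matrix.mul_one, Matrix.one_mul, trace_smul,
    Matrix.trace_diagonal, Matrix.trace_one, Finset.sum_add_distrib, Finset.sum_range,
    smul_eq_mul, frobDet]
  simp
  ring

end FrobeniusDeterminant

/-! ### Frobenius coordinates of Young diagrams -/

section FrobeniusCoordinates

theorem YoungDiagram.rowLen_eq_of_forall {μ : YoungDiagram} {i a : ℕ}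
    (h : ∀ j, (i, j) ∈ μ ↔ j < a) : μ.rowLen i = a := by
  have h1 := h (μ.rowLen i)
  have h2 := h a
  rw [YoungDiagram.mem_iff_lt_rowLen] at h1 h2
  omega

theorem exists_diag_notMem (μ : YoungDiagram) : ∃ i, (i, i) ∉ μ := by
  obtain ⟨j, hj⟩ := μ.exists_notMem_row 0
  exact ⟨j, fun h => hj (μ.up_left_mem (Nat.zero_le _) le_rfl h)⟩

/-- The number of diagonal cells. -/
def diagLen (μ : YoungDiagram) : ℕ := by
  classical exact Nat.find (exists_diag_notMem μ)

theorem lt_diagLen {μ : YoungDiagram} {i : ℕ} : i < diagLen μ ↔ (i, i) ∈ μ := by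
  classical
  unfold diagLen
  rw [Nat.lt_find_iff]
  refine ⟨fun h => not_not.1 (h i le_rfl), fun h m hm => not_not.2 (μ.up_left_mem hm hm h)⟩

theorem diagLen_eq_of_forall {μ : YoungDiagram} {d : ℕ} (h : ∀ i, (i, i) ∈ μ ↔ i < d) :
    diagLen μ = d := by
  have h1 := h (diagLen μ)
  have h2 := h d
  rw [← lt_diagLen] at h1 h2
  omega

theorem diagIndices_eq (μ : YoungDiagram) : diagIndices μ = Finset.range (diagLen μ) := by
  ext i
  simp only [diagIndices, Finset.mem_image, Finset.mem_filter, YoungDiagram.mem_cells,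
    Finset.mem_range, lt_diagLen, Prod.exists]
  constructor
  · rintro ⟨a, b, ⟨h, rfl⟩, rfl⟩
    exact h
  · exact fun h => ⟨i, i, ⟨h, rfl⟩, rfl⟩

/-- The Frobenius coordinate `pᵢ`. -/
def arm (μ : YoungDiagram) (i : ℕ) : ℕ := μ.rowLen i - (i + 1)

/-- The Frobenius coordinate `qᵢ`. -/
def leg (μ : YoungDiagram) (i : ℕ) : ℕ := μ.colLen i - (i + 1)

theorem arm_transpose (μ : YoungDiagram) : arm μ.transpose = leg μ := by
  funext i
  simp [arm, leg]

theorem leg_transpose (μ : YoungDiagram) : leg μ.transpose = arm μ := by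
  funext i
  simp [arm, leg]

theorem diagLen_transpose (μ : YoungDiagram) : diagLen μ.transpose = diagLen μ :=
  diagLen_eq_of_forall fun i => by rw [lt_diagLen, YoungDiagram.mem_transpose]; rfl

theorem rowLen_eq_arm {μ : YoungDiagram} {i : ℕ} (h : i < diagLen μ) :
    μ.rowLen i = arm μ i + i + 1 := by
  have := YoungDiagram.mem_iff_lt_rowLen.1 (lt_diagLen.1 h)
  unfold arm
  omega

theorem colLen_eq_leg {μ : YoungDiagram} {i : ℕ} (h : i < diagLen μ) :
    μ.colLen i = leg μ i + i + 1 := by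
  have := YoungDiagram.mem_iff_lt_colLen.1 (lt_diagLen.1 h)
  unfold leg
  omega

theorem rowLen_le_of_diagLen_le {μ : YoungDiagram} {i : ℕ} (h : diagLen μ ≤ i) :
    μ.rowLen i ≤ i := by
  by_contra h'
  exact absurd (lt_diagLen.2 (YoungDiagram.mem_iff_lt_rowLen.2 (not_le.1 h'))) (not_lt.2 h)

/-- Past the diagonal the truncated subtraction returns 0, exactly the value that `frobDet_up` wants
for an appended pair. -/
theorem arm_eq_zero {μ : YoungDiagram} {i : ℕ} (h : diagLen μ ≤ i) : arm μ i = 0 := by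
  have := rowLen_le_of_diagLen_le h
  unfold arm
  omega

theorem leg_eq_zero {μ : YoungDiagram} {i : ℕ} (h : diagLen μ ≤ i) : leg μ i = 0 := by
  rw [← arm_transpose]
  exact arm_eq_zero (by rwa [diagLen_transpose])

theorem arm_strictAnti {μ : YoungDiagram} {i j : ℕ} (hij : i < j) (hj : j < diagLen μ) :
    arm μ j < arm μ i := by
  have h1 := rowLen_eq_arm hj
  have h2 := rowLen_eq_arm (hij.trans hj)
  have h3 := μ.rowLen_anti i j hij.le
  omega

theorem leg_strictAnti {μ : YoungDiagram} {i j : ℕ} (hij : i < j) (hj : j < diagLen μ) :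
    leg μ j < leg μ i := by
  rw [← arm_transpose]
  exact arm_strictAnti hij (by rwa [diagLen_transpose])

/-- A cell on or above the diagonal lies in the arm of the diagonal cell of its row. The other side
follows by transposition, so the hooks determine the diagram. -/
theorem mem_iff_arm {μ : YoungDiagram} {i j : ℕ} (hij : i ≤ j) :
    (i, j) ∈ μ ↔ i < diagLen μ ∧ j ≤ i + arm μ i := by
  rw [YoungDiagram.mem_iff_lt_rowLen]
  by_cases h : i < diagLen μ
  · rw [rowLen_eq_arm h]
    simp only [h, true_and]
    omega
  · have := rowLen_le_of_diagLen_le (not_lt.1 h)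
    simp only [h, false_and, iff_false]
    omega

theorem mem_iff_leg {μ : YoungDiagram} {i j : ℕ} (hij : j ≤ i) :
    (i, j) ∈ μ ↔ j < diagLen μ ∧ i ≤ j + leg μ j := by
  have := mem_iff_arm (μ := μ.transpose) hij
  rwa [diagLen_transpose, arm_transpose, YoungDiagram.mem_transpose] at this

/-- A Young diagram is determined by its Frobenius coordinates. -/
theorem youngDiagram_ext_frobenius {μ ν : YoungDiagram} (hd : diagLen μ = diagLen ν)
    (hp : ∀ i < diagLen μ, arm μ i = arm ν i) (hq : ∀ i < diagLen μ, leg μ i = leg ν i) :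
    μ = ν := by
  ext ⟨i, j⟩
  rw [YoungDiagram.mem_cells, YoungDiagram.mem_cells]
  rcases le_total i j with h | h
  · rw [mem_iff_arm h, mem_iff_arm h, ← hd]
    exact and_congr_right fun hi => by rw [hp i hi]
  · rw [mem_iff_leg h, mem_iff_leg h, ← hd]
    exact and_congr_right fun hi => by rw [hq j hi]

/-- Every pair of strictly decreasing sequences gives the Frobenius coordinates of a diagram. -/
theorem exists_youngDiagram_of_frobenius {d : ℕ} {p q : ℕ → ℕ}
    (hp : ∀ i j, i < j → j < d → p j < p i) (hq : ∀ i j, i < j → j < d → q j < q i) :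
    ∃ μ : YoungDiagram, diagLen μ = d ∧ (∀ i < d, arm μ i = p i) ∧ ∀ i < d, leg μ i = q i := by
  -- Strictly decreasing integers drop by at least one per step. This is what makes the union of the
  -- hooks a lower set.
  have slope : ∀ r : ℕ → ℕ, (∀ i j, i < j → j < d → r j < r i) →
      ∀ i k, i + k < d → r (i + k) + k ≤ r i := by
    intro r hr i k
    induction k with
    | zero => simp
    | succ k ih =>
      intro h
      have h1 := ih (by omega)
      have h2 := hr (i + k) (i + (k + 1)) (by omega) h
      omega
  let s : Finset (ℕ × ℕ) :=
    ((Finset.range d).biUnion fun i => (Finset.range (p i + 1)).image fun k => (i, i + k)) ∪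
      ((Finset.range d).biUnion fun i => (Finset.range (q i + 1)).image fun k => (i + k, i))
  have hs : ∀ i j, (i, j) ∈ s ↔
      (i ≤ j ∧ i < d ∧ j ≤ i + p i) ∨ (j ≤ i ∧ j < d ∧ i ≤ j + q j) := by
    intro i j
    simp only [s, Finset.mem_union, Finset.mem_biUnion, Finset.mem_range, Finset.mem_image,
      Prod.mk.injEq]
    refine or_congr ⟨?_, ?_⟩ ⟨?_, ?_⟩
    · rintro ⟨a, ha, k, hk, rfl, rfl⟩
      omega
    · rintro ⟨h1, h2, h3⟩
      exact ⟨i, h2, j - i, by omega, rfl, by omega⟩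
    · rintro ⟨a, ha, k, hk, rfl, rfl⟩
      omega
    · rintro ⟨h1, h2, h3⟩
      exact ⟨j, h2, i - j, by omega, by omega, rfl⟩
  have hlow : IsLowerSet (s : Set (ℕ × ℕ)) := by
    rintro ⟨i, j⟩ ⟨i', j'⟩ hle h
    obtain ⟨hi, hj⟩ : i' ≤ i ∧ j' ≤ j := hle
    rw [Finset.mem_coe, hs] at h ⊢
    rcases le_total i' j' with h' | h'
    · left
      rcases h with ⟨h1, h2, h3⟩ | ⟨h1, h2, h3⟩
      · have := slope p hp i' (i - i') (by omega)
        rw [show i' + (i - i') = i by omega] at this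
        omega
      · have := slope p hp i' (j - i') (by omega)
        omega
    · right
      rcases h with ⟨h1, h2, h3⟩ | ⟨h1, h2, h3⟩
      · have := slope q hq j' (i - j') (by omega)
        omega
      · have := slope q hq j' (j - j') (by omega)
        rw [show j' + (j - j') = j by omega] at this
        omega
  let μ : YoungDiagram := ⟨s, hlow⟩
  have hμ : ∀ i j, (i, j) ∈ μ ↔
      (i ≤ j ∧ i < d ∧ j ≤ i + p i) ∨ (j ≤ i ∧ j < d ∧ i ≤ j + q j) := hs
  have hd : diagLen μ = d := diagLen_eq_of_forall fun i => by rw [hμ]; omega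
  refine ⟨μ, hd, fun i hi => ?_, fun i hi => ?_⟩
  · have h1 := mem_iff_arm (μ := μ) (i := i) (j := i + p i) (by omega)
    have h2 := mem_iff_arm (μ := μ) (i := i) (j := i + arm μ i) (by omega)
    rw [hμ] at h1 h2
    have h1' := h1.1 (Or.inl ⟨by omega, hi, le_rfl⟩)
    have h2' := h2.2 ⟨by omega, le_rfl⟩
    omega
  · have h1 := mem_iff_leg (μ := μ) (i := i + q i) (j := i) (by omega)
    have h2 := mem_iff_leg (μ := μ) (i := i + leg μ i) (j := i) (by omega)
    rw [hμ] at h1 h2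
    have h1' := h1.1 (Or.inr ⟨by omega, hi, le_rfl⟩)
    have h2' := h2.2 ⟨by omega, le_rfl⟩
    omega

end FrobeniusCoordinates

/-! ### Adding and removing one cell -/

section AddingCells

/-- `μ` is `ν` with the cell `c` added. -/
def AddsCell (ν : YoungDiagram) (c : ℕ × ℕ) (μ : YoungDiagram) : Prop :=
  c ∉ ν ∧ ∀ x, x ∈ μ ↔ x = c ∨ x ∈ ν

theorem AddsCell.left_unique {ν ν' μ : YoungDiagram} {c : ℕ × ℕ} (h : AddsCell ν c μ)
    (h' : AddsCell ν' c μ) : ν = ν' := by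
  ext x
  rw [YoungDiagram.mem_cells, YoungDiagram.mem_cells]
  have h1 := h.2 x
  have h2 := h'.2 x
  by_cases hx : x = c
  · subst hx
    exact iff_of_false h.1 h'.1
  · simp only [hx, false_or] at h1 h2
    rw [← h1, h2]

theorem AddsCell.right_unique {ν μ μ' : YoungDiagram} {c : ℕ × ℕ} (h : AddsCell ν c μ)
    (h' : AddsCell ν c μ') : μ = μ' := by
  ext x
  rw [YoungDiagram.mem_cells, YoungDiagram.mem_cells, h.2, h'.2]

namespace AddsCell

variable {ν μ : YoungDiagram} {i j : ℕ}

theorem transpose (h : AddsCell ν (i, j) μ) : AddsCell ν.transpose (j, i) μ.transpose := by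
  refine ⟨by simpa using h.1, fun x => ?_⟩
  rw [YoungDiagram.mem_transpose, YoungDiagram.mem_transpose, h.2]
  refine or_congr_left ⟨fun hx => ?_, fun hx => by rw [hx]; rfl⟩
  rw [← Prod.swap_swap x, hx]
  rfl

theorem rowLen_self (h : AddsCell ν (i, j) μ) : ν.rowLen i = j ∧ μ.rowLen i = j + 1 := by
  have h1 : μ.rowLen i = j + 1 := by
    have h2 : j < μ.rowLen i := YoungDiagram.mem_iff_lt_rowLen.1 ((h.2 _).2 (Or.inl rfl))
    by_contra hne
    have h3 : (i, j + 1) ∈ μ := YoungDiagram.mem_iff_lt_rowLen.2 (by omega)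
    rcases (h.2 _).1 h3 with h4 | h4
    · simp at h4
    · exact h.1 (ν.up_left_mem le_rfl (Nat.le_succ j) h4)
  refine ⟨YoungDiagram.rowLen_eq_of_forall fun k => ?_, h1⟩
  have h2 := h.2 (i, k)
  rw [YoungDiagram.mem_iff_lt_rowLen (μ := μ), h1] at h2
  constructor
  · intro h3
    have h4 := h2.2 (Or.inr h3)
    have h5 : k ≠ j := by rintro rfl; exact h.1 h3
    omega
  · intro h3
    rcases h2.1 (by omega) with h4 | h4
    · simp only [Prod.mk.injEq, true_and] at h4; omega
    · exact h4

theorem rowLen_of_ne (h : AddsCell ν (i, j) μ) {k : ℕ} (hk : k ≠ i) :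
    μ.rowLen k = ν.rowLen k :=
  YoungDiagram.rowLen_eq_of_forall fun l => by
    rw [h.2, ← YoungDiagram.mem_iff_lt_rowLen]
    simp [hk]

theorem diagLen_eq (h : AddsCell ν (i, j) μ) (hij : i ≠ j) : diagLen μ = diagLen ν :=
  diagLen_eq_of_forall fun k => by
    rw [h.2, lt_diagLen]
    simp only [Prod.mk.injEq, or_iff_right_iff_imp, and_imp]
    rintro rfl rfl
    exact absurd rfl hij

theorem arm_eq_update (h : AddsCell ν (i, j) μ) (hij : i < j) :
    i < diagLen ν ∧ arm ν i + i + 1 = j ∧ arm μ = Function.update (arm ν) i (arm ν i + 1) := by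
  obtain ⟨h1, h2⟩ := h.rowLen_self
  have h3 : i < diagLen ν := by
    rw [lt_diagLen, YoungDiagram.mem_iff_lt_rowLen, h1]
    exact hij
  have h4 := rowLen_eq_arm h3
  refine ⟨h3, by omega, funext fun k => ?_⟩
  by_cases hk : k = i
  · subst hk
    rw [Function.update_self]
    unfold arm at h4 ⊢
    omega
  · rw [Function.update_of_ne hk]
    unfold arm
    rw [h.rowLen_of_ne hk]

/-- Only column j changes, from length i to i + 1 ≤ j + 1, so its truncated leg is 0 before and
after. The diagonal case i = j is included. -/
theorem leg_eq (h : AddsCell ν (i, j) μ) (hij : i ≤ j) : leg μ = leg ν := by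
  rw [← arm_transpose, ← arm_transpose]
  obtain ⟨h1, h2⟩ := h.transpose.rowLen_self
  funext k
  unfold arm
  by_cases hk : k = j
  · subst hk
    omega
  · rw [h.transpose.rowLen_of_ne hk]

theorem arm_eq (h : AddsCell ν (i, j) μ) (hij : j ≤ i) : arm μ = arm ν := by
  rw [← leg_transpose, ← leg_transpose]
  exact h.transpose.leg_eq hij

theorem diagLen_diag (h : AddsCell ν (i, i) μ) : diagLen ν = i ∧ diagLen μ = i + 1 := by
  have h1 : i < diagLen μ := lt_diagLen.2 ((h.2 _).2 (Or.inl rfl))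
  have h2 : ¬ i < diagLen ν := fun h' => h.1 (lt_diagLen.1 h')
  have h3 : ∀ k, k ≠ i → (k < diagLen μ ↔ k < diagLen ν) := fun k hk => by
    rw [lt_diagLen, lt_diagLen, h.2]
    simp [hk]
  have h4 := h3 (i + 1) (by omega)
  by_cases h5 : i = 0
  · omega
  · have h6 := h3 (i - 1) (by omega)
    omega

theorem cells_eq (h : AddsCell ν (i, j) μ) : μ.cells = insert (i, j) ν.cells := by
  ext x
  rw [YoungDiagram.mem_cells, h.2, Finset.mem_insert, YoungDiagram.mem_cells]

theorem card_eq (h : AddsCell ν (i, j) μ) : μ.card = ν.card + 1 := by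
  change μ.cells.card = _
  rw [h.cells_eq, Finset.card_insert_of_notMem (by simpa using h.1)]

end AddsCell

theorem mem_maxElems_cells {μ : YoungDiagram} {i j : ℕ} :
    (i, j) ∈ maxElems μ.cells ↔ (i, j) ∈ μ ∧ (i + 1, j) ∉ μ ∧ (i, j + 1) ∉ μ := by
  rw [mem_maxElems, YoungDiagram.mem_cells]
  refine and_congr_right fun _ => ⟨fun h => ⟨fun h' => ?_, fun h' => ?_⟩, ?_⟩
  · exact h _ ((YoungDiagram.mem_cells _).2 h') (Prod.mk_lt_mk.2 (Or.inl ⟨Nat.lt_succ_self i, le_rfl⟩))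
  · exact h _ ((YoungDiagram.mem_cells _).2 h') (Prod.mk_lt_mk.2 (Or.inr ⟨le_rfl, Nat.lt_succ_self j⟩))
  · rintro ⟨h1, h2⟩ ⟨a, b⟩ hx hlt
    rw [YoungDiagram.mem_cells] at hx
    rcases Prod.mk_lt_mk.1 hlt with ⟨h3, h4⟩ | ⟨h3, h4⟩
    · exact h1 (μ.up_left_mem h3 h4 hx)
    · exact h2 (μ.up_left_mem h3 h4 hx)

theorem isLowerSet_erase {μ : YoungDiagram} {c : ℕ × ℕ} (hc : c ∈ maxElems μ.cells) :
    IsLowerSet ((μ.cells.erase c : Finset (ℕ × ℕ)) : Set (ℕ × ℕ)) := by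
  intro x y hyx hx
  rw [Finset.mem_coe, Finset.mem_erase] at hx ⊢
  refine ⟨?_, μ.isLowerSet hyx hx.2⟩
  rintro rfl
  exact (mem_maxElems.1 hc).2 x hx.2 (lt_of_le_of_ne hyx (Ne.symm hx.1))

open Classical in
/-- Remove a corner (and do nothing if the cell is not a corner). -/
def eraseCell (μ : YoungDiagram) (c : ℕ × ℕ) : YoungDiagram :=
  if hc : c ∈ maxElems μ.cells then ⟨μ.cells.erase c, isLowerSet_erase hc⟩ else μ

theorem cells_eraseCell {μ : YoungDiagram} {c : ℕ × ℕ} (hc : c ∈ maxElems μ.cells) :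
    (eraseCell μ c).cells = μ.cells.erase c := by
  simp [eraseCell, hc]

theorem addsCell_eraseCell {μ : YoungDiagram} {c : ℕ × ℕ} (hc : c ∈ maxElems μ.cells) :
    AddsCell (eraseCell μ c) c μ := by
  have h : ∀ x, x ∈ eraseCell μ c ↔ x ≠ c ∧ x ∈ μ := fun x => by
    rw [← YoungDiagram.mem_cells, cells_eraseCell hc, Finset.mem_erase, YoungDiagram.mem_cells]
  refine ⟨fun h' => ((h c).1 h').1 rfl, fun x => ?_⟩
  rw [h]
  by_cases hx : x = c
  · subst hx
    simpa using mem_of_mem_maxElems hc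
  · simp [hx]

/-- The cells that can be added to a diagram. -/
def addableCells (ν : YoungDiagram) : Finset (ℕ × ℕ) := by
  classical
  -- An addable cell exceeds the first row or column by at most one, so the box misses none.
  exact (Finset.range (ν.colLen 0 + 1) ×ˢ Finset.range (ν.rowLen 0 + 1)).filter fun c =>
    c ∉ ν ∧ IsLowerSet ((insert c ν.cells : Finset (ℕ × ℕ)) : Set (ℕ × ℕ))

theorem AddsCell.mem_addableCells {ν μ : YoungDiagram} {c : ℕ × ℕ} (h : AddsCell ν c μ) :
    c ∈ addableCells ν := by
  classical
  obtain ⟨i, j⟩ := c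
  have h1 := h.rowLen_self
  have h2 := h.transpose.rowLen_self
  rw [YoungDiagram.rowLen_transpose, YoungDiagram.rowLen_transpose] at h2
  have h3 := ν.rowLen_anti 0 i (Nat.zero_le _)
  have h4 := ν.colLen_anti 0 j (Nat.zero_le _)
  simp only [addableCells, Finset.mem_filter, Finset.mem_product, Finset.mem_range]
  refine ⟨⟨by omega, by omega⟩, h.1, ?_⟩
  rw [← h.cells_eq]
  exact μ.isLowerSet

open Classical in
/-- Add a cell (and do nothing if the cell is not addable). -/
def insertCell (ν : YoungDiagram) (c : ℕ × ℕ) : YoungDiagram :=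
  if hc : IsLowerSet ((insert c ν.cells : Finset (ℕ × ℕ)) : Set (ℕ × ℕ)) then
    ⟨insert c ν.cells, hc⟩ else ν

theorem addsCell_insertCell {ν : YoungDiagram} {c : ℕ × ℕ} (hc : c ∈ addableCells ν) :
    AddsCell ν c (insertCell ν c) := by
  classical
  simp only [addableCells, Finset.mem_filter] at hc
  refine ⟨hc.2.1, fun x => ?_⟩
  rw [← YoungDiagram.mem_cells, insertCell, dif_pos hc.2.2]
  simp

theorem mem_addableCells_of {ν : YoungDiagram} {i j : ℕ} (h1 : (i, j) ∉ ν)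
    (h2 : i = 0 ∨ (i - 1, j) ∈ ν) (h3 : j = 0 ∨ (i, j - 1) ∈ ν) : (i, j) ∈ addableCells ν := by
  have hlow : IsLowerSet ((insert (i, j) ν.cells : Finset (ℕ × ℕ)) : Set (ℕ × ℕ)) := by
    rintro ⟨a, b⟩ ⟨a', b'⟩ hle h
    obtain ⟨ha, hb⟩ : a' ≤ a ∧ b' ≤ b := hle
    simp only [Finset.coe_insert, Set.mem_insert_iff, Finset.mem_coe, YoungDiagram.mem_cells,
      Prod.mk.injEq] at h ⊢
    rcases h with ⟨rfl, rfl⟩ | h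
    · by_cases ha' : a' = a
      · by_cases hb' : b' = b
        · exact Or.inl ⟨ha', hb'⟩
        · exact Or.inr (ν.up_left_mem ha (by omega) (h3.resolve_left (by omega)))
      · exact Or.inr (ν.up_left_mem (by omega) hb (h2.resolve_left (by omega)))
    · exact Or.inr (ν.up_left_mem ha hb h)
  refine AddsCell.mem_addableCells (μ := ⟨insert (i, j) ν.cells, hlow⟩) ⟨h1, fun x => ?_⟩
  rw [← YoungDiagram.mem_cells]
  simp

theorem youngDiagram_induction {P : YoungDiagram → Prop} (h0 : P ⊥)
    (h : ∀ ν c μ, AddsCell ν c μ → P ν → P μ) (μ : YoungDiagram) : P μ := by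
  obtain ⟨n, hn⟩ : ∃ n, μ.card = n := ⟨_, rfl⟩
  induction n generalizing μ with
  | zero =>
    have : μ = ⊥ := by
      ext x
      rw [Finset.card_eq_zero.1 hn]
      simp
    exact this ▸ h0
  | succ n ih =>
    have hne : μ.cells.Nonempty := Finset.card_pos.1 (by change 0 < μ.card; omega)
    obtain ⟨c, hc⟩ := μ.cells.exists_maximal hne
    have hc' : c ∈ maxElems μ.cells :=
      mem_maxElems.2 ⟨hc.1, fun x hx hlt => hc.not_gt hx hlt⟩
    have hA := addsCell_eraseCell hc'
    refine h _ _ _ hA (ih _ ?_)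
    have := hA.card_eq (i := c.1) (j := c.2)
    omega

end AddingCells

/-! ### The determinantal formula for the number of standard tableaux -/

section DimensionFormula

/-- The Frobenius determinant of a Young diagram. -/
def diagramDet (μ : YoungDiagram) : ℝ := frobDet (diagLen μ) (arm μ) (leg μ)

theorem diagramDet_transpose (μ : YoungDiagram) : diagramDet μ.transpose = diagramDet μ := by
  rw [diagramDet, diagLen_transpose, arm_transpose, leg_transpose, frobDet_comm, diagramDet]

theorem diagLen_bot : diagLen (⊥ : YoungDiagram) = 0 :=
  diagLen_eq_of_forall fun i => by simp [YoungDiagram.notMem_bot]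

theorem diagramDet_bot : diagramDet ⊥ = 1 := by
  rw [diagramDet, diagLen_bot]
  simp [frobDet]

/-- The Frobenius formula for the number of cells. -/
theorem card_eq_sum_frobenius (μ : YoungDiagram) :
    μ.card = ∑ i ∈ Finset.range (diagLen μ), (arm μ i + leg μ i + 1) := by
  have key : ∀ (ν μ : YoungDiagram) (i j : ℕ), i < j → AddsCell ν (i, j) μ →
      ν.card = ∑ i ∈ Finset.range (diagLen ν), (arm ν i + leg ν i + 1) →
      μ.card = ∑ i ∈ Finset.range (diagLen μ), (arm μ i + leg μ i + 1) := by
    intro ν μ i j hij h ih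
    obtain ⟨h1, -, h2⟩ := h.arm_eq_update hij
    rw [h.card_eq, ih, h.diagLen_eq hij.ne, h.leg_eq hij.le,
      ← Finset.add_sum_erase _ _ (Finset.mem_range.2 h1),
      ← Finset.add_sum_erase _ _ (Finset.mem_range.2 h1), h2, Function.update_self]
    have : ∀ k ∈ (Finset.range (diagLen ν)).erase i,
        Function.update (arm ν) i (arm ν i + 1) k + leg ν k + 1 = arm ν k + leg ν k + 1 := by
      intro k hk
      rw [Function.update_of_ne (Finset.ne_of_mem_erase hk)]
    rw [Finset.sum_congr rfl this]
    omega
  induction μ using youngDiagram_induction with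
  | h0 =>
    rw [diagLen_bot]
    rfl
  | h ν c μ h ih =>
    obtain ⟨i, j⟩ := c
    rcases lt_trichotomy i j with hij | rfl | hij
    · exact key ν μ i j hij h ih
    · obtain ⟨h1, h2⟩ := h.diagLen_diag
      rw [h.card_eq, ih, h2, Finset.sum_range_succ, h1, h.arm_eq le_rfl, h.leg_eq le_rfl,
        arm_eq_zero h1.le, leg_eq_zero h1.le]
    · have hcard : ∀ ν : YoungDiagram, ν.transpose.card = ν.card := fun ν => by
        change (ν.transpose.cells).card = ν.cells.card
        refine Finset.card_bij' (fun c _ => c.swap) (fun c _ => c.swap) ?_ ?_ ?_ ?_ <;>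
          simp
      have := key ν.transpose μ.transpose j i hij h.transpose (by
        rw [hcard, ih, diagLen_transpose, arm_transpose, leg_transpose]
        exact Finset.sum_congr rfl fun k _ => by omega)
      rw [hcard, diagLen_transpose, arm_transpose, leg_transpose] at this
      rw [this]
      exact Finset.sum_congr rfl fun k _ => by omega

/-- Lowering a positive arm removes the last cell of its row. If that cell is not a corner, the cell
below it is in μ, which forces the next arm to be exactly one shorter; then the lowered sequence
repeats a value and the determinant vanishes. -/
theorem sum_corners_above (μ : YoungDiagram) :
    ∑ c ∈ (maxElems μ.cells).filter (fun c => c.1 < c.2), diagramDet (eraseCell μ c) =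
      ∑ i ∈ Finset.range (diagLen μ), (if arm μ i = 0 then 0 else
        frobDet (diagLen μ) (Function.update (arm μ) i (arm μ i - 1)) (leg μ)) := by
  refine Finset.sum_of_injOn Prod.fst ?_ ?_ ?_ ?_
  · rintro ⟨i, j⟩ h ⟨i', j'⟩ h' (rfl : i = i')
    rw [Finset.mem_coe, Finset.mem_filter] at h h'
    have h1 := (addsCell_eraseCell h.1).rowLen_self
    have h2 := (addsCell_eraseCell h'.1).rowLen_self
    rw [Prod.mk.injEq]
    omega
  · rintro ⟨i, j⟩ h
    rw [Finset.mem_coe, Finset.mem_filter] at h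
    obtain ⟨h1, h2⟩ := h
    have hA := addsCell_eraseCell h1
    have := (hA.arm_eq_update h2).1
    rw [← hA.diagLen_eq h2.ne] at this
    simpa using this
  · intro i hi hne
    rw [Finset.mem_range] at hi
    split_ifs with h0
    · rfl
    · have hr := rowLen_eq_arm hi
      have hmem : (i + 1, i + arm μ i) ∈ μ := by
        by_contra hn
        refine hne ⟨(i, i + arm μ i), ?_, rfl⟩
        rw [Finset.mem_coe, Finset.mem_filter, mem_maxElems_cells]
        refine ⟨⟨?_, hn, ?_⟩, by simp only; omega⟩ <;> rw [YoungDiagram.mem_iff_lt_rowLen] <;> omega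
      rw [mem_iff_arm (by omega)] at hmem
      have hlt := arm_strictAnti (Nat.lt_succ_self i) hmem.1
      refine frobDet_eq_zero hi hmem.1 (Nat.succ_ne_self i).symm ?_
      rw [Function.update_self, Function.update_of_ne (Nat.succ_ne_self i)]
      simp only [Nat.succ_eq_add_one] at *
      omega
  · rintro ⟨i, j⟩ h
    rw [Finset.mem_filter] at h
    obtain ⟨h1, h2⟩ := h
    have hA := addsCell_eraseCell h1
    obtain ⟨h3, h4, h5⟩ := hA.arm_eq_update h2
    have h6 := congrFun h5 i
    rw [Function.update_self] at h6
    have h7 : arm μ i ≠ 0 := by omega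
    rw [if_neg h7, diagramDet, hA.diagLen_eq h2.ne, hA.leg_eq h2.le]
    simp only [h5, Function.update_self, Function.update_idem, Nat.add_sub_cancel,
      Function.update_eq_self]

theorem AddsCell.mem_maxElems {ν μ : YoungDiagram} {c : ℕ × ℕ} (h : AddsCell ν c μ) :
    c ∈ maxElems μ.cells := by
  obtain ⟨i, j⟩ := c
  have h' := h.rowLen_self
  have h'' := h.transpose.rowLen_self
  rw [YoungDiagram.rowLen_transpose, YoungDiagram.rowLen_transpose] at h''
  rw [mem_maxElems_cells]
  refine ⟨(h.2 _).2 (Or.inl rfl), ?_, ?_⟩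
  · rw [YoungDiagram.mem_iff_lt_colLen]; omega
  · rw [YoungDiagram.mem_iff_lt_rowLen]; omega

theorem sum_corners_below (μ : YoungDiagram) :
    ∑ c ∈ (maxElems μ.cells).filter (fun c => c.2 < c.1), diagramDet (eraseCell μ c) =
      ∑ i ∈ Finset.range (diagLen μ), (if leg μ i = 0 then 0 else
        frobDet (diagLen μ) (arm μ) (Function.update (leg μ) i (leg μ i - 1))) := by
  have h := sum_corners_above μ.transpose
  rw [arm_transpose, leg_transpose, diagLen_transpose] at h
  simp only [frobDet_comm _ _ (arm μ)] at h
  rw [← h]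
  have hmem : ∀ (ν : YoungDiagram) (c : ℕ × ℕ), c ∈ maxElems ν.cells →
      c.swap ∈ maxElems ν.transpose.cells := by
    rintro ν ⟨i, j⟩ hc
    exact (addsCell_eraseCell hc).transpose.mem_maxElems
  refine Finset.sum_bij' (fun c _ => c.swap) (fun c _ => c.swap) ?_ ?_ ?_ ?_ ?_
  · intro c hc
    rw [Finset.mem_filter] at hc ⊢
    exact ⟨hmem _ _ hc.1, hc.2⟩
  · intro c hc
    rw [Finset.mem_filter] at hc ⊢
    have := hmem _ _ hc.1
    rw [YoungDiagram.transpose_transpose] at this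
    exact ⟨this, hc.2⟩
  · simp
  · simp
  · rintro ⟨i, j⟩ hc
    rw [Finset.mem_filter] at hc
    rw [← diagramDet_transpose]
    congr 1
    exact (addsCell_eraseCell hc.1).transpose.left_unique (addsCell_eraseCell (hmem _ _ hc.1))

/-- A diagonal cell is a corner precisely when it is the last one and its hook has no arm and no
leg. -/
theorem sum_corners_diag (μ : YoungDiagram) :
    ∑ c ∈ (maxElems μ.cells).filter (fun c => c.1 = c.2), diagramDet (eraseCell μ c) =
      if 0 < diagLen μ ∧ arm μ (diagLen μ - 1) = 0 ∧ leg μ (diagLen μ - 1) = 0 then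
        frobDet (diagLen μ - 1) (arm μ) (leg μ) else 0 := by
  have hdiag : ∀ c ∈ (maxElems μ.cells).filter (fun c => c.1 = c.2),
      AddsCell (eraseCell μ c) c μ ∧ c = (diagLen μ - 1, diagLen μ - 1) ∧ 0 < diagLen μ := by
    rintro ⟨i, j⟩ hc
    rw [Finset.mem_filter] at hc
    obtain ⟨h1, rfl : i = j⟩ := hc
    have hA := addsCell_eraseCell h1
    have := hA.diagLen_diag
    refine ⟨hA, by rw [this.2]; rfl, by omega⟩
  split_ifs with h
  · obtain ⟨h1, h2, h3⟩ := h
    set d := diagLen μ - 1 with hd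
    have hdlt : d < diagLen μ := by omega
    have hr := rowLen_eq_arm hdlt
    have hc := colLen_eq_leg hdlt
    have hm : (d, d) ∈ maxElems μ.cells := by
      rw [mem_maxElems_cells]
      refine ⟨lt_diagLen.1 hdlt, ?_, ?_⟩
      · rw [YoungDiagram.mem_iff_lt_colLen]; omega
      · rw [YoungDiagram.mem_iff_lt_rowLen]; omega
    have hA := addsCell_eraseCell hm
    have hs : (maxElems μ.cells).filter (fun c => c.1 = c.2) = {(d, d)} := by
      ext c
      rw [Finset.mem_singleton]
      refine ⟨fun hc => (hdiag c hc).2.1, ?_⟩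
      rintro rfl
      exact Finset.mem_filter.2 ⟨hm, rfl⟩
    rw [hs, Finset.sum_singleton, diagramDet, hA.diagLen_diag.1, hA.arm_eq le_rfl, hA.leg_eq le_rfl]
  · refine Finset.sum_eq_zero fun c hc => absurd ?_ h
    obtain ⟨hA, h1, h2⟩ := hdiag c hc
    rw [h1] at hA
    have h3 := hA.diagLen_diag.1
    refine ⟨h2, ?_, ?_⟩
    · rw [hA.arm_eq le_rfl]
      exact arm_eq_zero h3.le
    · rw [hA.leg_eq le_rfl]
      exact leg_eq_zero h3.le

theorem sum_trichotomy {M : Type*} [AddCommMonoid M] (s : Finset (ℕ × ℕ)) (f : ℕ × ℕ → M) :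
    ∑ c ∈ s, f c = ∑ c ∈ s.filter (fun c => c.1 < c.2), f c +
      ∑ c ∈ s.filter (fun c => c.2 < c.1), f c + ∑ c ∈ s.filter (fun c => c.1 = c.2), f c := by
  rw [← Finset.sum_filter_add_sum_filter_not s (fun c => c.1 < c.2),
    ← Finset.sum_filter_add_sum_filter_not (s.filter fun c => ¬ c.1 < c.2) (fun c => c.2 < c.1),
    Finset.filter_filter, Finset.filter_filter, add_assoc]
  congr 3 <;> ext c <;> simp only [Finset.mem_filter] <;> constructor <;> intro h <;>
    refine ⟨h.1, ?_⟩ <;> have := h.2 <;> omega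

/-- The sum over all corners. -/
theorem sum_corners (μ : YoungDiagram) :
    ∑ c ∈ maxElems μ.cells, diagramDet (eraseCell μ c) = μ.card * diagramDet μ := by
  rw [sum_trichotomy, sum_corners_above, sum_corners_below, sum_corners_diag,
    frobDet_down _ _ _ (fun i j => arm_strictAnti) (fun i j => leg_strictAnti),
    card_eq_sum_frobenius, diagramDet]
  push_cast
  rfl

/-- A row i that cannot be extended is blocked by row i - 1, whose arm is then exactly one longer;
the raised sequence repeats that value and contributes 0. -/
theorem sum_addable_above (ν : YoungDiagram) :
    ∑ c ∈ (addableCells ν).filter (fun c => c.1 < c.2), diagramDet (insertCell ν c) =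
      ∑ i ∈ Finset.range (diagLen ν),
        frobDet (diagLen ν) (Function.update (arm ν) i (arm ν i + 1)) (leg ν) := by
  refine Finset.sum_of_injOn Prod.fst ?_ ?_ ?_ ?_
  · rintro ⟨i, j⟩ h ⟨i', j'⟩ h' (rfl : i = i')
    rw [Finset.mem_coe, Finset.mem_filter] at h h'
    have h1 := (addsCell_insertCell h.1).rowLen_self
    have h2 := (addsCell_insertCell h'.1).rowLen_self
    rw [Prod.mk.injEq]
    omega
  · rintro ⟨i, j⟩ h
    rw [Finset.mem_coe, Finset.mem_filter] at h
    simpa using ((addsCell_insertCell h.1).arm_eq_update h.2).1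
  · intro i hi hne
    rw [Finset.mem_range] at hi
    have hr := rowLen_eq_arm hi
    have h0 : i ≠ 0 ∧ (i - 1, i + arm ν i + 1) ∉ ν := by
      by_contra hn
      refine hne ⟨(i, i + arm ν i + 1), ?_, rfl⟩
      rw [Finset.mem_coe, Finset.mem_filter]
      refine ⟨mem_addableCells_of ?_ ?_ (Or.inr ?_), by simp only; omega⟩
      · rw [YoungDiagram.mem_iff_lt_rowLen]; omega
      · tauto
      · rw [YoungDiagram.mem_iff_lt_rowLen]; omega
    have h1 := rowLen_eq_arm (μ := ν) (i := i - 1) (by omega)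
    have h2 := h0.2
    rw [YoungDiagram.mem_iff_lt_rowLen] at h2
    have h3 := arm_strictAnti (μ := ν) (i := i - 1) (j := i) (by omega) hi
    refine frobDet_eq_zero (i := i) (k := i - 1) hi (by omega) (by omega) ?_
    rw [Function.update_self, Function.update_of_ne (by omega)]
    omega
  · rintro ⟨i, j⟩ h
    rw [Finset.mem_filter] at h
    obtain ⟨h1, h2⟩ := h
    have hA := addsCell_insertCell h1
    rw [diagramDet, hA.diagLen_eq h2.ne, hA.leg_eq h2.le, (hA.arm_eq_update h2).2.2]

theorem sum_addable_below (ν : YoungDiagram) :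
    ∑ c ∈ (addableCells ν).filter (fun c => c.2 < c.1), diagramDet (insertCell ν c) =
      ∑ i ∈ Finset.range (diagLen ν),
        frobDet (diagLen ν) (arm ν) (Function.update (leg ν) i (leg ν i + 1)) := by
  have h := sum_addable_above ν.transpose
  rw [arm_transpose, leg_transpose, diagLen_transpose] at h
  simp only [frobDet_comm _ _ (arm ν)] at h
  rw [← h]
  have hmem : ∀ (ν : YoungDiagram) (c : ℕ × ℕ), c ∈ addableCells ν →
      c.swap ∈ addableCells ν.transpose := by
    rintro ν ⟨i, j⟩ hc
    exact (addsCell_insertCell hc).transpose.mem_addableCells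
  refine Finset.sum_bij' (fun c _ => c.swap) (fun c _ => c.swap) ?_ ?_ ?_ ?_ ?_
  · intro c hc
    rw [Finset.mem_filter] at hc ⊢
    exact ⟨hmem _ _ hc.1, hc.2⟩
  · intro c hc
    rw [Finset.mem_filter] at hc ⊢
    have := hmem _ _ hc.1
    rw [YoungDiagram.transpose_transpose] at this
    exact ⟨this, hc.2⟩
  · simp
  · simp
  · rintro ⟨i, j⟩ hc
    rw [Finset.mem_filter] at hc
    rw [← diagramDet_transpose]
    congr 1
    exact (addsCell_insertCell hc.1).transpose.right_unique (addsCell_insertCell (hmem _ _ hc.1))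

/-- If the next diagonal cell is not addable, the last arm or the last leg is already 0. The
appended zero pair then duplicates a row or a column, so the right-hand side is 0 as well. -/
theorem sum_addable_diag (ν : YoungDiagram) :
    ∑ c ∈ (addableCells ν).filter (fun c => c.1 = c.2), diagramDet (insertCell ν c) =
      frobDet (diagLen ν + 1) (arm ν) (leg ν) := by
  have hdiag : ∀ c ∈ (addableCells ν).filter (fun c => c.1 = c.2),
      c = (diagLen ν, diagLen ν) := by
    rintro ⟨i, j⟩ hc
    rw [Finset.mem_filter] at hc
    obtain ⟨h1, rfl : i = j⟩ := hc
    rw [(addsCell_insertCell h1).diagLen_diag.1]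
  by_cases h : (diagLen ν, diagLen ν) ∈ addableCells ν
  · have hs : (addableCells ν).filter (fun c => c.1 = c.2) = {(diagLen ν, diagLen ν)} := by
      ext c
      rw [Finset.mem_singleton]
      refine ⟨hdiag c, ?_⟩
      rintro rfl
      exact Finset.mem_filter.2 ⟨h, rfl⟩
    have hA := addsCell_insertCell h
    rw [hs, Finset.sum_singleton, diagramDet, hA.diagLen_diag.2, hA.arm_eq le_rfl,
      hA.leg_eq le_rfl]
  · have hs : (addableCells ν).filter (fun c => c.1 = c.2) = ∅ := by
      refine Finset.eq_empty_of_forall_notMem fun c hc => h ?_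
      rw [← hdiag c hc]
      exact (Finset.mem_filter.1 hc).1
    rw [hs, Finset.sum_empty]
    set d := diagLen ν with hd
    have h1 : (d, d) ∉ ν := fun h' => lt_irrefl _ (lt_diagLen.2 h')
    have h2 : ¬ ((d = 0 ∨ (d - 1, d) ∈ ν) ∧ (d = 0 ∨ (d, d - 1) ∈ ν)) := fun h' =>
      h (mem_addableCells_of h1 h'.1 h'.2)
    have h3 : d ≠ 0 := fun h' => h2 ⟨Or.inl h', Or.inl h'⟩
    have ha := arm_eq_zero hd.ge
    have hl := leg_eq_zero hd.ge
    rw [mem_iff_arm (by omega), mem_iff_leg (by omega)] at h2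
    by_cases h4 : arm ν (d - 1) = 0
    · exact (frobDet_eq_zero (i := d) (k := d - 1) (by omega) (by omega) (by omega)
        (by rw [ha, h4])).symm
    · rw [frobDet_comm]
      refine (frobDet_eq_zero (i := d) (k := d - 1) (by omega) (by omega) (by omega) ?_).symm
      omega

/-- The sum over all addable cells. -/
theorem sum_addable (ν : YoungDiagram) :
    ∑ c ∈ addableCells ν, diagramDet (insertCell ν c) = diagramDet ν := by
  rw [sum_trichotomy, sum_addable_above, sum_addable_below, sum_addable_diag]
  exact frobDet_up _ _ _ (arm_eq_zero le_rfl) (leg_eq_zero le_rfl)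

/-- The determinantal formula for the number of standard Young tableaux. -/
theorem dimYoung_div_factorial (μ : YoungDiagram) :
    (dimYoung μ : ℝ) / (μ.card ! : ℝ) = diagramDet μ := by
  obtain ⟨n, hn⟩ : ∃ n, μ.card = n := ⟨_, rfl⟩
  induction n generalizing μ with
  | zero =>
    have h0 : μ.cells = ∅ := Finset.card_eq_zero.1 hn
    have : μ = ⊥ := by
      ext x
      rw [h0]
      simp
    rw [dimYoung_eq_card_linExt, hn, h0, card_linExt_empty, this, diagramDet_bot]
    simp
  | succ n ih =>
    have hne : μ.cells.Nonempty := Finset.card_pos.1 (by change 0 < μ.card; omega)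
    have h1 : (dimYoung μ : ℝ) =
        ∑ c ∈ maxElems μ.cells, (dimYoung (eraseCell μ c) : ℝ) := by
      rw [dimYoung_eq_card_linExt, card_linExt hne]
      push_cast
      refine Finset.sum_congr rfl fun c hc => ?_
      rw [dimYoung_eq_card_linExt, cells_eraseCell hc]
    have h2 : ∀ c ∈ maxElems μ.cells,
        (dimYoung (eraseCell μ c) : ℝ) = n ! * diagramDet (eraseCell μ c) := by
      intro c hc
      have hc' : (eraseCell μ c).card = n := by
        have := (addsCell_eraseCell hc).card_eq (i := c.1) (j := c.2)
        omega
      rw [← ih _ hc', hc']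
      field_simp
    rw [h1, Finset.sum_congr rfl h2, ← Finset.mul_sum, sum_corners, hn, Nat.factorial_succ]
    push_cast
    have : (n ! : ℝ) ≠ 0 := by positivity
    field_simp

end DimensionFormula

/-! ### Total mass of the poissonized Plancherel measure -/

section TotalMass

theorem finite_youngDiagram_card (n : ℕ) : {μ : YoungDiagram | μ.card = n}.Finite := by
  have hinj : Function.Injective YoungDiagram.cells := fun μ ν h => YoungDiagram.ext h
  refine Set.Finite.of_finite_image (f := YoungDiagram.cells) ?_ hinj.injOn
  refine ((Finset.range n ×ˢ Finset.range n).powerset.finite_toSet).subset ?_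
  rintro _ ⟨μ, hμ, rfl⟩
  rw [Finset.mem_coe, Finset.mem_powerset]
  rintro ⟨i, j⟩ hij
  rw [YoungDiagram.mem_cells] at hij
  have hrow : j < (μ.row i).card := by
    rw [← YoungDiagram.rowLen_eq_card]
    exact YoungDiagram.mem_iff_lt_rowLen.1 hij
  have hcol : i < (μ.col j).card := by
    rw [← YoungDiagram.colLen_eq_card]
    exact YoungDiagram.mem_iff_lt_colLen.1 hij
  have h1 : (μ.row i).card ≤ n := hμ ▸ Finset.card_le_card (Finset.filter_subset _ _)
  have h2 : (μ.col j).card ≤ n := hμ ▸ Finset.card_le_card (Finset.filter_subset _ _)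
  simp only [Finset.mem_product, Finset.mem_range]
  omega

/-- The Young diagrams with `n` cells. -/
def diagramsOfCard (n : ℕ) : Finset YoungDiagram := (finite_youngDiagram_card n).toFinset

theorem mem_diagramsOfCard {n : ℕ} {μ : YoungDiagram} : μ ∈ diagramsOfCard n ↔ μ.card = n := by
  simp [diagramsOfCard]

/-- `∑ (dim μ / n!)² = 1 / n!`, the sum being over the diagrams with `n` cells. -/
theorem sum_diagramDet_sq (n : ℕ) :
    ∑ μ ∈ diagramsOfCard n, diagramDet μ ^ 2 = 1 / (n ! : ℝ) := by
  induction n with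
  | zero =>
    have : diagramsOfCard 0 = {⊥} := by
      ext μ
      rw [mem_diagramsOfCard, Finset.mem_singleton]
      constructor
      · intro h
        ext x
        rw [Finset.card_eq_zero.1 h]
        simp
      · rintro rfl
        rfl
    rw [this]
    simp [diagramDet_bot]
  | succ n ih =>
    -- Both sides sum the product of the two determinants over pairs of diagrams differing by one
    -- cell: grouped by the larger diagram through `sum_corners`, by the smaller one through
    -- `sum_addable`.
    have h : ∑ μ ∈ diagramsOfCard (n + 1), ((n : ℝ) + 1) * diagramDet μ ^ 2 =
        ∑ ν ∈ diagramsOfCard n, diagramDet ν ^ 2 := by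
      have h1 : ∀ μ ∈ diagramsOfCard (n + 1), ((n : ℝ) + 1) * diagramDet μ ^ 2 =
          ∑ c ∈ maxElems μ.cells, diagramDet μ * diagramDet (eraseCell μ c) := by
        intro μ hμ
        rw [← Finset.mul_sum, sum_corners, mem_diagramsOfCard.1 hμ]
        push_cast
        ring
      have h2 : ∀ ν ∈ diagramsOfCard n, diagramDet ν ^ 2 =
          ∑ c ∈ addableCells ν, diagramDet (insertCell ν c) * diagramDet ν := by
        intro ν _
        rw [← Finset.sum_mul, sum_addable]
        ring
      rw [Finset.sum_congr rfl h1, Finset.sum_congr rfl h2, Finset.sum_sigma', Finset.sum_sigma']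
      refine Finset.sum_bij' (fun x _ => ⟨eraseCell x.1 x.2, x.2⟩)
        (fun x _ => ⟨insertCell x.1 x.2, x.2⟩) ?_ ?_ ?_ ?_ ?_
      · rintro ⟨μ, c⟩ hx
        simp only [Finset.mem_sigma, mem_diagramsOfCard] at hx ⊢
        have hA := addsCell_eraseCell hx.2
        have := hA.card_eq (i := c.1) (j := c.2)
        exact ⟨by omega, hA.mem_addableCells⟩
      · rintro ⟨μ, c⟩ hx
        simp only [Finset.mem_sigma, mem_diagramsOfCard] at hx ⊢
        have hA := addsCell_insertCell hx.2
        have := hA.card_eq (i := c.1) (j := c.2)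
        exact ⟨by omega, hA.mem_maxElems⟩
      · rintro ⟨μ, c⟩ hx
        simp only [Finset.mem_sigma] at hx
        have hA := addsCell_eraseCell hx.2
        simp only [(addsCell_insertCell hA.mem_addableCells).right_unique hA]
      · rintro ⟨μ, c⟩ hx
        simp only [Finset.mem_sigma] at hx
        have hA := addsCell_insertCell hx.2
        simp only [(addsCell_eraseCell hA.mem_maxElems).left_unique hA]
      · rintro ⟨μ, c⟩ hx
        simp only [Finset.mem_sigma] at hx
        have hA := addsCell_eraseCell hx.2
        simp only [(addsCell_insertCell hA.mem_addableCells).right_unique hA]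
    rw [← Finset.mul_sum, ih] at h
    rw [Nat.factorial_succ]
    push_cast
    have h3 : (n ! : ℝ) ≠ 0 := by positivity
    have h4 : (n : ℝ) + 1 ≠ 0 := by positivity
    field_simp at h ⊢
    linarith

theorem plancherelWeight_eq (θ : ℝ) (μ : YoungDiagram) :
    plancherelWeight θ μ = Real.exp (-θ) * θ ^ μ.card * diagramDet μ ^ 2 := by
  rw [plancherelWeight, dimYoung_div_factorial]

theorem plancherelWeight_nonneg {θ : ℝ} (hθ : 0 ≤ θ) (μ : YoungDiagram) :
    0 ≤ plancherelWeight θ μ := by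
  unfold plancherelWeight
  positivity

/-- The diagrams with n cells carry the Poisson weight e^{-θ} θⁿ/n!; nonnegativity allows the
regrouping by size. -/
theorem hasSum_plancherelWeight {θ : ℝ} (hθ : 0 ≤ θ) : HasSum (plancherelWeight θ) 1 := by
  let e := Equiv.sigmaFiberEquiv YoungDiagram.card
  rw [← e.hasSum_iff]
  have hfib : ∀ n, HasSum (fun μ : {μ : YoungDiagram // μ.card = n} =>
      (plancherelWeight θ ∘ e) ⟨n, μ⟩) (Real.exp (-θ) * (θ ^ n / n !)) := by
    intro n
    have h1 : HasSum (fun μ : (diagramsOfCard n : Set YoungDiagram) => plancherelWeight θ μ)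
        (∑ μ ∈ diagramsOfCard n, plancherelWeight θ μ) :=
      (diagramsOfCard n).hasSum _
    have h2 : ∑ μ ∈ diagramsOfCard n, plancherelWeight θ μ = Real.exp (-θ) * (θ ^ n / n !) := by
      rw [← mul_one_div, ← sum_diagramDet_sq, Finset.mul_sum, Finset.mul_sum]
      refine Finset.sum_congr rfl fun μ hμ => ?_
      rw [plancherelWeight_eq, mem_diagramsOfCard.1 hμ]
      ring
    rw [h2] at h1
    let e' : {μ : YoungDiagram // μ.card = n} ≃ (diagramsOfCard n : Set YoungDiagram) :=
      Equiv.subtypeEquivRight fun μ => by simp [mem_diagramsOfCard]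
    exact (e'.hasSum_iff).2 h1
  have hexp : HasSum (fun n : ℕ => Real.exp (-θ) * (θ ^ n / n !)) 1 := by
    have h := (NormedSpace.expSeries_div_hasSum_exp (𝔸 := ℝ) θ).mul_left (Real.exp (-θ))
    rwa [← Real.exp_eq_exp_ℝ, ← Real.exp_add, neg_add_cancel, Real.exp_zero] at h
  have hsum : Summable (plancherelWeight θ ∘ e) := by
    refine (summable_sigma_of_nonneg (f := plancherelWeight θ ∘ e)
      (fun x => plancherelWeight_nonneg hθ _)).2 ⟨fun n => (hfib n).summable, ?_⟩
    refine hexp.summable.congr fun n => (hfib n).tsum_eq.symm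
  have := hsum.hasSum.sigma hfib
  have h1 := hexp.unique this
  exact h1.symm ▸ hsum.hasSum

theorem isProbabilityMeasure_poissonizedPlancherel {θ : ℝ} (hθ : 0 ≤ θ) :
    IsProbabilityMeasure (poissonizedPlancherel θ) := by
  refine ⟨?_⟩
  have h := hasSum_plancherelWeight hθ
  simp only [poissonizedPlancherel, Measure.sum_apply _ MeasurableSet.univ, Measure.smul_apply,
    Measure.dirac_apply_of_mem (Set.mem_univ _), smul_eq_mul, mul_one]
  rw [← ENNReal.ofReal_tsum_of_nonneg (plancherelWeight_nonneg hθ) h.summable, h.tsum_eq,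
    ENNReal.ofReal_one]

end TotalMass

/-! ### The two halves of the half-integers -/

section HalfIntegers

theorem coe_posHalf (a : ℕ) : ((posHalf a : HalfInts) : ℝ) = a + 1 / 2 := rfl

theorem coe_negHalf (b : ℕ) : ((negHalf b : HalfInts) : ℝ) = -b - 1 / 2 := rfl

theorem posHalf_pos (a : ℕ) : 0 < (posHalf a : ℝ) := by
  rw [coe_posHalf]; positivity

theorem negHalf_neg (b : ℕ) : (negHalf b : ℝ) < 0 := by
  rw [coe_negHalf]
  have : (0 : ℝ) ≤ b := Nat.cast_nonneg b
  linarith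

theorem posHalf_injective : Function.Injective posHalf := fun a b h => by
  have := congrArg (fun x : HalfInts => (x : ℝ)) h
  simpa [coe_posHalf] using this

theorem negHalf_injective : Function.Injective negHalf := fun a b h => by
  have := congrArg (fun x : HalfInts => (x : ℝ)) h
  simpa [coe_negHalf] using this

theorem posHalf_ne_negHalf (a b : ℕ) : posHalf a ≠ negHalf b := fun h => by
  have h1 := posHalf_pos a
  have h2 := negHalf_neg b
  rw [h] at h1
  linarith

theorem halfInts_cases (x : HalfInts) : (∃ a, x = posHalf a) ∨ ∃ b, x = negHalf b := by
  obtain ⟨x, n, rfl⟩ := x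
  rcases n with a | b
  · exact Or.inl ⟨a, Subtype.ext (by simp [posHalf])⟩
  · refine Or.inr ⟨b, Subtype.ext ?_⟩
    simp only [negHalf, Int.cast_negSucc]
    push_cast
    ring

/-- Positive and negative half-integers. -/
def halfEquiv : ℕ ⊕ ℕ ≃ HalfInts :=
  Equiv.ofBijective (Sum.elim posHalf negHalf) <| by
    constructor
    · exact Function.Injective.sumElim posHalf_injective negHalf_injective posHalf_ne_negHalf
    · intro x
      rcases halfInts_cases x with ⟨a, rfl⟩ | ⟨b, rfl⟩
      · exact ⟨Sum.inl a, rfl⟩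
      · exact ⟨Sum.inr b, rfl⟩

instance countable_halfInts : Countable HalfInts := halfEquiv.symm.injective.countable

end HalfIntegers

/-! ### Diagrams as balanced finite configurations -/

section FrobeniusConfiguration

theorem posHalf_mem_frobeniusConfig {μ : YoungDiagram} {a : ℕ} :
    posHalf a ∈ frobeniusConfig μ ↔ ∃ i < diagLen μ, arm μ i = a := by
  simp only [frobeniusConfig, Finset.mem_union, Finset.mem_image, diagIndices_eq, Finset.mem_range]
  constructor
  · rintro (⟨i, hi, h⟩ | ⟨i, hi, h⟩)
    · exact ⟨i, hi, posHalf_injective h⟩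
    · exact absurd h.symm (posHalf_ne_negHalf _ _)
  · rintro ⟨i, hi, rfl⟩
    exact Or.inl ⟨i, hi, rfl⟩

theorem negHalf_mem_frobeniusConfig {μ : YoungDiagram} {b : ℕ} :
    negHalf b ∈ frobeniusConfig μ ↔ ∃ i < diagLen μ, leg μ i = b := by
  simp only [frobeniusConfig, Finset.mem_union, Finset.mem_image, diagIndices_eq, Finset.mem_range]
  constructor
  · rintro (⟨i, hi, h⟩ | ⟨i, hi, h⟩)
    · exact absurd h (posHalf_ne_negHalf _ _)
    · exact ⟨i, hi, negHalf_injective h⟩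
  · rintro ⟨i, hi, rfl⟩
    exact Or.inr ⟨i, hi, rfl⟩

theorem strictAnti_eq_of_range {d d' : ℕ} {p p' : ℕ → ℕ}
    (hp : ∀ i j, i < j → j < d → p j < p i) (hp' : ∀ i j, i < j → j < d' → p' j < p' i)
    (h : ∀ a, (∃ i < d, p i = a) ↔ ∃ i < d', p' i = a) : d = d' ∧ ∀ i < d, p i = p' i := by
  have hanti : StrictAnti fun i : Fin d => p i := fun i j hij => hp i j hij j.2
  have hanti' : StrictAnti fun i : Fin d' => p' i := fun i j hij => hp' i j hij j.2
  have hr : Set.range (fun i : Fin d => p i) = Set.range fun i : Fin d' => p' i := by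
    ext a
    have := h a
    simpa [Fin.exists_iff] using this
  have hdd : d = d' := by
    have h1 := Nat.card_range_of_injective hanti.injective
    have h2 := Nat.card_range_of_injective hanti'.injective
    rw [hr, h2] at h1
    simpa using h1.symm
  subst hdd
  refine ⟨rfl, fun i hi => ?_⟩
  exact congrFun ((StrictAnti.range_inj hanti hanti').1 hr) ⟨i, hi⟩

theorem frobeniusConfig_injective : Function.Injective frobeniusConfig := by
  intro μ ν h
  obtain ⟨hd, hp⟩ := strictAnti_eq_of_range (d := diagLen μ) (d' := diagLen ν) (p := arm μ)
    (p' := arm ν) (fun i j => arm_strictAnti) (fun i j => arm_strictAnti) fun a => by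
      rw [← posHalf_mem_frobeniusConfig, ← posHalf_mem_frobeniusConfig, h]
  obtain ⟨-, hq⟩ := strictAnti_eq_of_range (d := diagLen μ) (d' := diagLen ν) (p := leg μ)
    (p' := leg ν) (fun i j => leg_strictAnti) (fun i j => leg_strictAnti) fun a => by
      rw [← negHalf_mem_frobeniusConfig, ← negHalf_mem_frobeniusConfig, h]
  exact youngDiagram_ext_frobenius hd hp hq

theorem exists_strictAnti_enumeration (P : Finset ℕ) :
    ∃ p : ℕ → ℕ, (∀ i j, i < j → j < P.card → p j < p i) ∧ ∀ a, (∃ i < P.card, p i = a) ↔ a ∈ P := by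
  -- Reversing the increasing enumeration makes it decreasing; values past `P.card` are never used.
  refine ⟨fun i => if h : i < P.card then P.orderEmbOfFin rfl (Fin.rev ⟨i, h⟩) else 0, ?_, ?_⟩
  · intro i j hij hj
    simp only [hj, hij.trans hj, dite_true]
    refine (P.orderEmbOfFin rfl).strictMono ?_
    rw [Fin.rev_lt_rev]
    exact hij
  · intro a
    have hr := P.range_orderEmbOfFin rfl
    rw [Set.ext_iff] at hr
    rw [← Finset.mem_coe, ← hr a]
    constructor
    · rintro ⟨i, hi, h⟩
      simp only [hi, dite_true] at h
      exact ⟨_, h⟩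
    · rintro ⟨k, hk⟩
      refine ⟨Fin.rev k, (Fin.rev k).2, ?_⟩
      simp only [Fin.is_lt, dite_true, Fin.eta, Fin.rev_rev, hk]

theorem exists_frobeniusConfig {P Q : Finset ℕ} (h : P.card = Q.card) :
    ∃ μ : YoungDiagram, (∀ a, posHalf a ∈ frobeniusConfig μ ↔ a ∈ P) ∧
      ∀ b, negHalf b ∈ frobeniusConfig μ ↔ b ∈ Q := by
  obtain ⟨p, hp, hpP⟩ := exists_strictAnti_enumeration P
  obtain ⟨q, hq, hqQ⟩ := exists_strictAnti_enumeration Q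
  rw [← h] at hq hqQ
  obtain ⟨μ, h1, h2, h3⟩ := exists_youngDiagram_of_frobenius hp hq
  refine ⟨μ, fun a => ?_, fun b => ?_⟩
  · rw [posHalf_mem_frobeniusConfig, ← hpP, h1]
    exact exists_congr fun i => and_congr_right fun hi => by rw [h2 i hi]
  · rw [negHalf_mem_frobeniusConfig, ← hqQ, h1]
    exact exists_congr fun i => and_congr_right fun hi => by rw [h3 i hi]

end FrobeniusConfiguration

/-! ### Minors of the L-kernel -/

section KernelL

/-- `θ^{(a + 1/2)/2} / a!`. -/
def halfWeight (θ : ℝ) (a : ℕ) : ℝ := θ ^ (((a : ℝ) + 1 / 2) / 2) / (a ! : ℝ)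

theorem floor_half (a : ℕ) : ⌊(a : ℝ) + 1 / 2 - 1 / 2⌋₊ = a := by
  rw [add_sub_cancel_right, Nat.floor_natCast]

theorem abs_posHalf (a : ℕ) : |(posHalf a : ℝ)| = a + 1 / 2 := by
  rw [abs_of_pos (posHalf_pos a), coe_posHalf]

theorem abs_negHalf (a : ℕ) : |(negHalf a : ℝ)| = a + 1 / 2 := by
  rw [abs_of_neg (negHalf_neg a), coe_negHalf]
  ring

theorem kernelL_pos_pos (θ : ℝ) (a b : ℕ) : kernelL θ (posHalf a) (posHalf b) = 0 := by
  rw [kernelL, if_pos (mul_pos (posHalf_pos a) (posHalf_pos b))]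

theorem kernelL_neg_neg (θ : ℝ) (a b : ℕ) : kernelL θ (negHalf a) (negHalf b) = 0 := by
  rw [kernelL, if_pos (mul_pos_of_neg_of_neg (negHalf_neg a) (negHalf_neg b))]

theorem kernelL_pos_neg {θ : ℝ} (hθ : 0 < θ) (a b : ℕ) :
    kernelL θ (posHalf a) (negHalf b) =
      halfWeight θ a * halfWeight θ b / ((a : ℝ) + b + 1) := by
  rw [kernelL, if_neg (not_lt.2 (mul_neg_of_pos_of_neg (posHalf_pos a) (negHalf_neg b)).le),
    abs_posHalf, abs_negHalf, floor_half, floor_half, coe_posHalf, coe_negHalf, add_div,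
    Real.rpow_add hθ, halfWeight, halfWeight]
  have h1 : (a : ℝ) + 1 / 2 - (-b - 1 / 2) = a + b + 1 := by ring
  rw [h1]
  field_simp

theorem kernelL_antisymm (θ : ℝ) (x y : HalfInts) : kernelL θ y x = -kernelL θ x y := by
  unfold kernelL
  rw [mul_comm (y : ℝ) x]
  split_ifs
  · simp
  · rw [add_comm |(y : ℝ)|, mul_comm (⌊|(y : ℝ)| - 1 / 2⌋₊ ! : ℝ), ← neg_sub (x : ℝ) y,
      one_div_neg_eq_neg_one_div, mul_neg]

theorem kernelL_neg_pos {θ : ℝ} (hθ : 0 < θ) (a b : ℕ) :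
    kernelL θ (negHalf b) (posHalf a) =
      -(halfWeight θ a * halfWeight θ b / ((a : ℝ) + b + 1)) := by
  rw [kernelL_antisymm, kernelL_pos_neg hθ]

-- Multiplication by the symplectic matrix, which is a product of unipotent block matrices and so
-- has determinant 1, makes the matrix block diagonal with blocks C and Cᵀ. This is the source of
-- the square in the Plancherel weight.
open Matrix in
theorem det_fromBlocks_neg_transpose {d : ℕ} (C : Matrix (Fin d) (Fin d) ℝ) :
    (fromBlocks 0 C (-Cᵀ) 0).det = C.det ^ 2 := by
  have h1 : fromBlocks 0 C (-Cᵀ) 0 * Matrix.J (Fin d) ℝ = fromBlocks C 0 0 Cᵀ := by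
    rw [Matrix.J, fromBlocks_multiply]
    simp
  have h2 : (Matrix.J (Fin d) ℝ).det = 1 := by
    have h3 : Matrix.J (Fin d) ℝ =
        fromBlocks 1 (-1) 0 1 * fromBlocks 1 0 1 1 * fromBlocks 1 (-1) 0 1 := by
      rw [Matrix.J, fromBlocks_multiply, fromBlocks_multiply]
      simp
    rw [h3, det_mul, det_mul, det_fromBlocks_zero₂₁, det_fromBlocks_zero₁₂]
    simp
  have h3 := congrArg Matrix.det h1
  rw [det_mul, h2, mul_one, det_fromBlocks_zero₂₁, det_transpose] at h3
  rw [h3, sq]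

-- With positive points listed before negative ones, L has only off-diagonal blocks C and -Cᵀ. The
-- block C is the Frobenius matrix with rows and columns scaled by half-powers of θ, and after
-- squaring these scalings multiply to θ to the power ∑ (p_i + q_i + 1) = |μ|.
open Matrix in
theorem det_kernelL_frobeniusConfig {θ : ℝ} (hθ : 0 < θ) {n : ℕ} {y : Fin n → HalfInts}
    (hy : Function.Injective y) {μ : YoungDiagram}
    (h : (frobeniusConfig μ : Set HalfInts) = Set.range y) :
    (Matrix.of fun i j => kernelL θ (y i) (y j)).det = θ ^ μ.card * diagramDet μ ^ 2 := by
  set d := diagLen μ with hd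
  let f : Fin d ⊕ Fin d → HalfInts :=
    Sum.elim (fun i => posHalf (arm μ i)) fun i => negHalf (leg μ i)
  have hinj : ∀ r : ℕ → ℕ, (∀ i j, i < j → j < d → r j < r i) →
      Function.Injective fun i : Fin d => r i := fun r hr =>
    StrictAnti.injective fun i j hij => hr i j hij j.2
  have hf : Function.Injective f :=
    Function.Injective.sumElim
      (posHalf_injective.comp (hinj (arm μ) fun i j => arm_strictAnti))
      (negHalf_injective.comp (hinj (leg μ) fun i j => leg_strictAnti))
      fun _ _ => posHalf_ne_negHalf _ _
  have hrange : Set.range f = Set.range y := by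
    rw [← h]
    ext x
    rw [Finset.mem_coe]
    rcases halfInts_cases x with ⟨a, rfl⟩ | ⟨b, rfl⟩
    · rw [posHalf_mem_frobeniusConfig]
      constructor
      · rintro ⟨i | i, hi⟩
        · exact ⟨i, i.2, posHalf_injective hi⟩
        · exact absurd hi.symm (posHalf_ne_negHalf _ _)
      · rintro ⟨i, hi, rfl⟩
        exact ⟨Sum.inl ⟨i, hi⟩, rfl⟩
    · rw [negHalf_mem_frobeniusConfig]
      constructor
      · rintro ⟨i | i, hi⟩
        · exact absurd hi (posHalf_ne_negHalf _ _)
        · exact ⟨i, i.2, negHalf_injective hi⟩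
      · rintro ⟨i, hi, rfl⟩
        exact ⟨Sum.inr ⟨i, hi⟩, rfl⟩
  let e : Fin d ⊕ Fin d ≃ Fin n :=
    ((Equiv.ofInjective f hf).trans (Equiv.setCongr hrange)).trans (Equiv.ofInjective y hy).symm
  have he : ∀ k, y (e k) = f k := fun k => by
    simp only [e, Equiv.trans_apply]
    rw [Equiv.apply_ofInjective_symm hy]
    rfl
  let C : Matrix (Fin d) (Fin d) ℝ := Matrix.of fun i j =>
    θ ^ (((arm μ i : ℝ) + 1 / 2) / 2) * (θ ^ (((leg μ j : ℝ) + 1 / 2) / 2) *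
      frobMat d (arm μ) (leg μ) i j)
  have hC : ∀ i j : Fin d, kernelL θ (posHalf (arm μ i)) (negHalf (leg μ j)) = C i j := by
    intro i j
    rw [kernelL_pos_neg hθ]
    simp only [C, halfWeight, frobMat, frobEntry, Matrix.of_apply]
    field_simp
  have hblock : (Matrix.of fun i j => kernelL θ (y i) (y j)).submatrix e e =
      fromBlocks 0 C (-Cᵀ) 0 := by
    ext (i | i) (j | j) <;> simp only [submatrix_apply, of_apply, he, f, Sum.elim_inl,
      Sum.elim_inr, fromBlocks_apply₁₁, fromBlocks_apply₁₂, fromBlocks_apply₂₁, fromBlocks_apply₂₂]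
    · exact kernelL_pos_pos _ _ _
    · exact hC i j
    · rw [kernelL_antisymm, hC]
      rfl
    · exact kernelL_neg_neg _ _ _
  rw [← det_submatrix_equiv_self e, hblock, det_fromBlocks_neg_transpose]
  have hdet : C.det = (∏ i : Fin d, θ ^ (((arm μ i : ℝ) + 1 / 2) / 2)) *
      ((∏ i : Fin d, θ ^ (((leg μ i : ℝ) + 1 / 2) / 2)) * diagramDet μ) := by
    rw [diagramDet, ← hd, frobDet, ← det_mul_row, ← det_mul_column]
    rfl
  rw [hdet, ← mul_assoc, mul_pow, mul_pow, ← Finset.prod_pow, ← Finset.prod_pow,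
    ← Finset.prod_mul_distrib, card_eq_sum_frobenius, ← hd, Finset.sum_range, ← Finset.prod_pow_eq_pow_sum]
  congr 1
  refine Finset.prod_congr rfl fun i _ => ?_
  rw [← Real.rpow_natCast (_ ^ _) 2, ← Real.rpow_natCast (_ ^ _) 2, ← Real.rpow_mul hθ.le,
    ← Real.rpow_mul hθ.le, ← Real.rpow_add hθ, ← Real.rpow_natCast]
  congr 1
  push_cast
  ring

/-- A nonzero term of the Leibniz expansion comes from a permutation that reverses the sign of every
point, which needs as many positive as negative points. -/
theorem det_kernelL_eq_zero (θ : ℝ) {n : ℕ} (y : Fin n → HalfInts)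
    (h : (Finset.univ.filter fun i => 0 < (y i : ℝ)).card ≠
      (Finset.univ.filter fun i => ¬ 0 < (y i : ℝ)).card) :
    (Matrix.of fun i j => kernelL θ (y i) (y j)).det = 0 := by
  rw [Matrix.det_apply']
  refine Finset.sum_eq_zero fun σ _ => mul_eq_zero_of_right _ ?_
  by_contra hne
  rw [← ne_eq, Finset.prod_ne_zero_iff] at hne
  have hsign : ∀ i, 0 < (y (σ i) : ℝ) ↔ ¬ 0 < (y i : ℝ) := by
    intro i
    have h1 := hne i (Finset.mem_univ i)
    rw [Matrix.of_apply] at h1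
    rcases halfInts_cases (y i) with ⟨a, ha⟩ | ⟨a, ha⟩ <;>
      rcases halfInts_cases (y (σ i)) with ⟨b, hb⟩ | ⟨b, hb⟩ <;> rw [ha, hb] at h1 ⊢
    · exact absurd (kernelL_pos_pos θ b a) h1
    · simp [posHalf_pos, (negHalf_neg b).le]
    · simp [posHalf_pos, (negHalf_neg a).le]
    · exact absurd (kernelL_neg_neg θ b a) h1
  refine h (Finset.card_bij (fun i _ => σ.symm i) ?_ (fun _ _ _ _ h => σ.symm.injective h) ?_)
  · intro i hi
    rw [Finset.mem_filter] at hi ⊢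
    refine ⟨Finset.mem_univ _, ?_⟩
    rw [← hsign, Equiv.apply_symm_apply]
    exact hi.2
  · intro i hi
    rw [Finset.mem_filter] at hi
    refine ⟨σ i, ?_, σ.symm_apply_apply i⟩
    rw [Finset.mem_filter, hsign]
    exact ⟨Finset.mem_univ _, hi.2⟩

end KernelL

/-! ### The law of the point process on finite configurations -/

section ProcessLaw

theorem poissonizedPlancherel_singleton (θ : ℝ) (μ : YoungDiagram) :
    poissonizedPlancherel θ {μ} = ENNReal.ofReal (plancherelWeight θ μ) := by
  rw [poissonizedPlancherel, Measure.sum_apply _ (MeasurableSet.of_discrete), tsum_eq_single μ]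
  · simp
  · intro ν hν
    simp [hν]

theorem measurable_frobeniusConfig :
    Measurable fun μ : YoungDiagram => (frobeniusConfig μ : Set HalfInts) :=
  Measurable.of_discrete

theorem measurableSet_singleton_config (S : Set HalfInts) : MeasurableSet ({S} : Set (Set HalfInts)) :=
  measurableSet_singleton S

/-- The law of the point process, on finite configurations, is given by the L-kernel. -/
theorem plancherelProcess_range {θ : ℝ} (hθ : 0 < θ) {n : ℕ} (y : Fin n → HalfInts)
    (hy : Function.Injective y) :
    (plancherelProcess θ).real {Set.range y} =
      Real.exp (-θ) * Matrix.det (Matrix.of fun i j => kernelL θ (y i) (y j)) := by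
  classical
  rw [Measure.real, plancherelProcess,
    Measure.map_apply measurable_frobeniusConfig (measurableSet_singleton_config _)]
  by_cases h : ∃ μ : YoungDiagram, (frobeniusConfig μ : Set HalfInts) = Set.range y
  · obtain ⟨μ, hμ⟩ := h
    have hpre : (fun μ : YoungDiagram => (frobeniusConfig μ : Set HalfInts)) ⁻¹' {Set.range y} =
        {μ} := by
      ext ν
      rw [Set.mem_preimage, Set.mem_singleton_iff, Set.mem_singleton_iff, ← hμ, Finset.coe_inj]
      exact frobeniusConfig_injective.eq_iff
    rw [hpre, poissonizedPlancherel_singleton, ENNReal.toReal_ofReal (plancherelWeight_nonneg hθ.le μ),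
      plancherelWeight_eq, det_kernelL_frobeniusConfig hθ hy hμ, mul_assoc]
  · have hpre : (fun μ : YoungDiagram => (frobeniusConfig μ : Set HalfInts)) ⁻¹' {Set.range y} =
        ∅ := by
      ext ν
      rw [Set.mem_preimage, Set.mem_singleton_iff]
      exact iff_of_false (fun h' => h ⟨ν, h'⟩) (Set.notMem_empty ν)
    -- A configuration that comes from no diagram must be unbalanced, since every balanced one is a
    -- pair of sets of Frobenius coordinates.
    rw [hpre, measure_empty, ENNReal.toReal_zero, det_kernelL_eq_zero, mul_zero]
    intro hcard
    apply h
    let Y : Finset HalfInts := Finset.univ.image y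
    let P : Finset ℕ := Y.preimage posHalf posHalf_injective.injOn
    let Q : Finset ℕ := Y.preimage negHalf negHalf_injective.injOn
    have hP : P.card = (Finset.univ.filter fun i => 0 < (y i : ℝ)).card := by
      rw [← Finset.card_image_of_injective P posHalf_injective, ← Finset.card_image_of_injective _ hy]
      congr 1
      ext x
      simp only [P, Y, Finset.mem_image, Finset.mem_preimage, Finset.mem_filter, Finset.mem_univ,
        true_and]
      constructor
      · rintro ⟨a, ⟨i, hi⟩, rfl⟩
        exact ⟨i, by rw [hi]; exact posHalf_pos a, hi⟩
      · rintro ⟨i, hi, rfl⟩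
        rcases halfInts_cases (y i) with ⟨a, ha⟩ | ⟨a, ha⟩
        · exact ⟨a, ⟨i, ha⟩, ha.symm⟩
        · rw [ha] at hi
          exact absurd hi (not_lt.2 (negHalf_neg a).le)
    have hQ : Q.card = (Finset.univ.filter fun i => ¬ 0 < (y i : ℝ)).card := by
      rw [← Finset.card_image_of_injective Q negHalf_injective, ← Finset.card_image_of_injective _ hy]
      congr 1
      ext x
      simp only [Q, Y, Finset.mem_image, Finset.mem_preimage, Finset.mem_filter, Finset.mem_univ,
        true_and]
      constructor
      · rintro ⟨a, ⟨i, hi⟩, rfl⟩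
        exact ⟨i, by rw [hi]; exact not_lt.2 (negHalf_neg a).le, hi⟩
      · rintro ⟨i, hi, rfl⟩
        rcases halfInts_cases (y i) with ⟨a, ha⟩ | ⟨a, ha⟩
        · rw [ha] at hi
          exact absurd (posHalf_pos a) hi
        · exact ⟨a, ⟨i, ha⟩, ha.symm⟩
    obtain ⟨μ, h1, h2⟩ := exists_frobeniusConfig (hP.trans (hcard.trans hQ.symm))
    refine ⟨μ, Set.ext fun x => ?_⟩
    rw [Finset.mem_coe]
    rcases halfInts_cases x with ⟨a, rfl⟩ | ⟨a, rfl⟩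
    · rw [h1]
      simp [P, Y]
    · rw [h2]
      simp [Q, Y]

end ProcessLaw

/-! ### Real antisymmetric matrices and sums of principal minors -/

section FiniteMatrices

open Matrix

variable {n : Type*} [Fintype n]

/-- The cross term Re⟨v, Av⟩ vanishes, so |v + Av|² = |v|² + |Av|². -/
theorem sum_normSq_le_of_antisymm {A : Matrix n n ℝ} (hA : Aᵀ = -A) (v : n → ℂ) :
    ∑ i, ‖v i‖ ^ 2 ≤ ∑ i, ‖v i + ∑ j, (A i j : ℂ) * v j‖ ^ 2 := by
  have hcross : ∑ i, (v i * starRingEnd ℂ (∑ j, (A i j : ℂ) * v j)).re = 0 := by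
    have h1 : ∑ i, (v i * starRingEnd ℂ (∑ j, (A i j : ℂ) * v j)).re =
        ∑ i, ∑ j, A i j * (v i * starRingEnd ℂ (v j)).re := by
      refine Finset.sum_congr rfl fun i _ => ?_
      rw [map_sum, Finset.mul_sum, Complex.re_sum]
      refine Finset.sum_congr rfl fun j _ => ?_
      rw [map_mul, Complex.conj_ofReal, mul_left_comm, Complex.re_ofReal_mul]
    have h2 : ∑ i, ∑ j, A i j * (v i * starRingEnd ℂ (v j)).re =
        -∑ i, ∑ j, A i j * (v i * starRingEnd ℂ (v j)).re := by
      conv_lhs => rw [Finset.sum_comm]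
      rw [← Finset.sum_neg_distrib]
      refine Finset.sum_congr rfl fun i _ => ?_
      rw [← Finset.sum_neg_distrib]
      refine Finset.sum_congr rfl fun j _ => ?_
      have h3 : A j i = -A i j := congrFun (congrFun hA i) j
      have h4 : (v j * starRingEnd ℂ (v i)).re = (v i * starRingEnd ℂ (v j)).re := by
        simp [Complex.mul_re]
        ring
      rw [h3, h4, neg_mul]
    rw [h1]
    linarith
  have h5 : ∀ i, ‖v i + ∑ j, (A i j : ℂ) * v j‖ ^ 2 =
      ‖v i‖ ^ 2 + ‖∑ j, (A i j : ℂ) * v j‖ ^ 2 +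
        2 * (v i * starRingEnd ℂ (∑ j, (A i j : ℂ) * v j)).re := by
    intro i
    rw [← Complex.normSq_eq_norm_sq, ← Complex.normSq_eq_norm_sq, ← Complex.normSq_eq_norm_sq,
      Complex.normSq_add]
  rw [Finset.sum_congr rfl fun i _ => h5 i, Finset.sum_add_distrib, Finset.sum_add_distrib,
    ← Finset.mul_sum, hcross, mul_zero, add_zero]
  exact le_add_of_nonneg_right (Finset.sum_nonneg fun i _ => by positivity)

/-- The constant 1 does not depend on the size of the matrix; this uniformity carries the passage
from finite windows to ℤ'. -/
theorem norm_le_sum_of_antisymm {A : Matrix n n ℝ} (hA : Aᵀ = -A) (v : n → ℂ) (i : n) :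
    ‖v i‖ ≤ ∑ k, ‖v k + ∑ j, (A k j : ℂ) * v j‖ := by
  refine le_of_sq_le_sq ?_ (Finset.sum_nonneg fun _ _ => norm_nonneg _)
  calc ‖v i‖ ^ 2 ≤ ∑ i, ‖v i‖ ^ 2 :=
        Finset.single_le_sum (f := fun i => ‖v i‖ ^ 2) (fun _ _ => by positivity)
          (Finset.mem_univ i)
    _ ≤ _ := sum_normSq_le_of_antisymm hA v
    _ ≤ _ := Finset.sum_sq_le_sq_sum_of_nonneg fun _ _ => norm_nonneg _

variable [DecidableEq n]

/-- The sum of the principal minors of `A` containing `X`. -/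
theorem sum_principal_minors {R : Type*} [CommRing R] (A : Matrix n n R) (X : Finset n) :
    ∑ S ∈ Finset.univ.filter (X ⊆ ·),
      (A.submatrix (Subtype.val : S → n) (Subtype.val : S → n)).det =
    (A + Matrix.diagonal fun i => if i ∈ X then 0 else 1).det := by
  set D : Matrix n n R := Matrix.diagonal fun i => if i ∈ X then 0 else 1 with hD
  -- Expand the determinant in the rows A_i + D_i, with S the set of rows taken from A. A row of D
  -- is zero on X, which kills every S not containing X, and a unit vector off X, which reduces to
  -- the minor on S.
  have h := (detRowAlternating (n := n) (R := R)).toMultilinearMap.map_add_univ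
    (fun i => A i) (fun i => D i)
  have h1 : (A + D).det = ∑ S : Finset n, (Matrix.of (S.piecewise A.row D.row)).det := h
  rw [h1, Finset.sum_filter]
  refine Finset.sum_congr rfl fun S _ => ?_
  split_ifs with hS
  · rw [← det_piecewise_one_eq_submatrix_det]
    congr 2
    funext i
    by_cases hi : i ∈ S
    · simp [hi]
    · have hiX : i ∉ X := fun h' => hi (hS h')
      simp only [Finset.piecewise, hi, if_false]
      funext j
      simp [hD, Matrix.row, Matrix.diagonal_apply, Matrix.one_apply, hiX]
  · obtain ⟨i, hiX, hiS⟩ := Finset.not_subset.1 hS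
    refine (det_eq_zero_of_row_eq_zero i fun j => ?_).symm
    simp [Finset.piecewise, hiS, hD, Matrix.row, Matrix.diagonal_apply, hiX]

/-- For `K = A (1 + A)⁻¹ = 1 - (1 + A)⁻¹`, the sum of the principal minors of `A` containing `X` is
`det (1 + A)` times the minor of `K` indexed by `X`. -/
theorem sum_principal_minors_eq {A : Matrix n n ℝ} (hA : IsUnit (1 + A).det) (X : Finset n) :
    ∑ S ∈ Finset.univ.filter (X ⊆ ·),
      (A.submatrix (Subtype.val : S → n) (Subtype.val : S → n)).det =
    (1 + A).det * ((1 - (1 + A)⁻¹).submatrix (Subtype.val : X → n) (Subtype.val : X → n)).det := by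
  rw [sum_principal_minors, ← det_piecewise_one_eq_submatrix_det, mul_comm, ← det_mul]
  congr 1
  -- The left factor on the right has the rows of 1 - (1 + A)⁻¹ on X and identity rows elsewhere, so
  -- its determinant is the wanted minor.
  have h1 : A + Matrix.diagonal (fun i => if i ∈ X then 0 else 1) =
      (1 - Matrix.diagonal (fun i => if i ∈ X then 1 else 0) * (1 + A)⁻¹) * (1 + A) := by
    rw [Matrix.sub_mul, Matrix.mul_assoc, Matrix.nonsing_inv_mul _ hA, Matrix.mul_one,
      Matrix.one_mul, add_comm 1 A, add_sub_assoc]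
    congr 1
    rw [← Matrix.diagonal_one, Matrix.diagonal_sub]
    congr 1
    funext i
    split_ifs <;> simp
  rw [h1]
  congr 1
  ext i j
  rw [Matrix.sub_apply, Matrix.diagonal_mul, Matrix.of_apply]
  by_cases hi : i ∈ X <;> simp [hi, Finset.piecewise, Matrix.row]

theorem isUnit_det_one_add_of_antisymm {A : Matrix n n ℝ} (hA : Aᵀ = -A) :
    IsUnit (1 + A).det := by
  rw [isUnit_iff_ne_zero]
  intro h
  obtain ⟨v, hv, hAv⟩ := Matrix.exists_mulVec_eq_zero_iff.2 h
  apply hv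
  funext i
  have h1 := norm_le_sum_of_antisymm hA (fun i => (v i : ℂ)) i
  have h2 : ∀ k, (v k : ℂ) + ∑ j, (A k j : ℂ) * v j = 0 := by
    intro k
    have := congrFun hAv k
    rw [Matrix.add_mulVec, Matrix.one_mulVec, Pi.add_apply] at this
    simp only [Matrix.mulVec, dotProduct, Pi.zero_apply] at this
    exact_mod_cast this
  simp only [h2, norm_zero, Finset.sum_const_zero] at h1
  simpa using h1

end FiniteMatrices

/-! ### Correlation functions as limits over finite windows -/

section Determinantal

open Matrix

/-- The finite section of the L-kernel on `Λ`. -/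
def finiteL (θ : ℝ) (Λ : Finset HalfInts) : Matrix Λ Λ ℝ :=
  Matrix.of fun x y => kernelL θ x y

theorem finiteL_transpose (θ : ℝ) (Λ : Finset HalfInts) : (finiteL θ Λ)ᵀ = -finiteL θ Λ := by
  ext x y
  exact kernelL_antisymm θ x y

open Classical in
/-- The matrix `L (1 + L)⁻¹` of a finite section. -/
def finiteK (θ : ℝ) (Λ : Finset HalfInts) : Matrix Λ Λ ℝ := 1 - (1 + finiteL θ Λ)⁻¹

open Classical in
/-- The entries of the matrix `L (1 + L)⁻¹` of a finite section. -/
def finiteKernel (θ : ℝ) (Λ : Finset HalfInts) (x y : HalfInts) : ℝ :=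
  if h : x ∈ Λ ∧ y ∈ Λ then finiteK θ Λ ⟨x, h.1⟩ ⟨y, h.2⟩ else 0

theorem finiteK_equation (θ : ℝ) (Λ : Finset HalfInts) (x y : Λ) :
    finiteK θ Λ x y + ∑ z, finiteL θ Λ x z * finiteK θ Λ z y = finiteL θ Λ x y := by
  classical
  have hu := isUnit_det_one_add_of_antisymm (finiteL_transpose θ Λ)
  have h : finiteK θ Λ + finiteL θ Λ * finiteK θ Λ = finiteL θ Λ := by
    have h1 : finiteK θ Λ + finiteL θ Λ * finiteK θ Λ = (1 + finiteL θ Λ) * finiteK θ Λ := by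
      rw [Matrix.add_mul, Matrix.one_mul]
    rw [h1]
    unfold finiteK
    convert (show (1 + finiteL θ Λ) * (1 - (1 + finiteL θ Λ)⁻¹) = finiteL θ Λ by
      rw [Matrix.mul_sub, Matrix.mul_nonsing_inv _ hu, Matrix.mul_one, add_sub_cancel_left])
  exact congrFun (congrFun h x) y

/-- Subtracting the equations for K_Λ and K shows that (1 + L_Λ) applied to the column of K_Λ - K is
the part of LK coming from z outside Λ. By `norm_le_sum_of_antisymm` the error is at most the sum
over z ∉ Λ and all x of |L(x,z)| |K(z,y)|, the tail of a convergent series. -/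
theorem finiteKernel_tendsto {θ : ℝ} {K : HalfInts → HalfInts → ℂ}
    (hL : Summable fun q : HalfInts × HalfInts => |kernelL θ q.1 q.2|)
    (hK : ∀ y, Summable fun x => ‖K x y‖)
    (heq : ∀ x y, K x y + ∑' z, (kernelL θ x z : ℂ) * K z y = kernelL θ x y) (x y : HalfInts) :
    Tendsto (fun Λ => (finiteKernel θ Λ x y : ℂ)) atTop (𝓝 (K x y)) := by
  classical
  have hLrow : ∀ x, Summable fun z => |kernelL θ x z| := fun x => hL.prod_factor x
  have hLcol : ∀ z, Summable fun x => |kernelL θ x z| := fun z =>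
    (hLrow z).congr fun x => by rw [kernelL_antisymm, abs_neg]
  have hLbd : ∀ x z, |kernelL θ x z| ≤ ∑' q : HalfInts × HalfInts, |kernelL θ q.1 q.2| :=
    fun x z => hL.le_tsum (x, z) fun _ _ => abs_nonneg _
  have hLK : ∀ x, Summable fun z => (kernelL θ x z : ℂ) * K z y := fun x => by
    refine Summable.of_norm_bounded ((hK y).mul_left (∑' q : HalfInts × HalfInts, |kernelL θ q.1 q.2|))
      fun z => ?_
    rw [norm_mul, Complex.norm_real, Real.norm_eq_abs]
    exact mul_le_mul_of_nonneg_right (hLbd x z) (norm_nonneg _)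
  have hLK2 : Summable fun q : HalfInts × HalfInts => |kernelL θ q.1 q.2| * ‖K q.2 y‖ := by
    refine Summable.of_nonneg_of_le (fun q => by positivity)
      (fun q => mul_le_mul_of_nonneg_left ?_ (abs_nonneg _))
      (hL.mul_right (∑' z, ‖K z y‖))
    exact (hK y).le_tsum q.2 fun _ _ => norm_nonneg _
  have hc : Summable fun z => ∑' x, |kernelL θ x z| * ‖K z y‖ := by
    have := ((Equiv.prodComm HalfInts HalfInts).summable_iff.2 hLK2).prod
    exact this
  have hcol : ∀ z, Summable fun x => |kernelL θ x z| * ‖K z y‖ := fun z => (hLcol z).mul_right _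
  rw [tendsto_iff_norm_sub_tendsto_zero]
  refine squeeze_zero' (Eventually.of_forall fun _ => norm_nonneg _) ?_
    (tendsto_tsum_compl_atTop_zero fun z => ∑' x, |kernelL θ x z| * ‖K z y‖)
  filter_upwards [eventually_ge_atTop ({x, y} : Finset HalfInts)] with Λ hΛ
  have hx : x ∈ Λ := hΛ (by simp)
  have hy : y ∈ Λ := hΛ (by simp)
  let v : Λ → ℂ := fun z => (finiteK θ Λ z ⟨y, hy⟩ : ℂ) - K z y
  have hv : (finiteKernel θ Λ x y : ℂ) - K x y = v ⟨x, hx⟩ := by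
    simp [v, finiteKernel, hx, hy]
  have hres : ∀ k : Λ, v k + ∑ j, (finiteL θ Λ k j : ℂ) * v j =
      ∑' z : {z // z ∉ Λ}, (kernelL θ k z : ℂ) * K z y := by
    intro k
    have h1 := finiteK_equation θ Λ k ⟨y, hy⟩
    have h1' : (finiteK θ Λ k ⟨y, hy⟩ : ℂ) +
        ∑ z, (finiteL θ Λ k z : ℂ) * (finiteK θ Λ z ⟨y, hy⟩ : ℂ) = kernelL θ k y := by
      rw [show kernelL θ k y = finiteL θ Λ k ⟨y, hy⟩ from rfl, ← h1]
      push_cast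
      rfl
    have h2 := heq k y
    have h3 := (hLK k).sum_add_tsum_subtype_compl Λ
    have h4 : ∑ z ∈ Λ, (kernelL θ k z : ℂ) * K z y =
        ∑ j : Λ, (finiteL θ Λ k j : ℂ) * K j y :=
      (Finset.sum_coe_sort Λ fun z => (kernelL θ k z : ℂ) * K z y).symm
    simp only [v, mul_sub, Finset.sum_sub_distrib]
    rw [h4] at h3
    linear_combination h1' - h2 - h3
  rw [hv]
  refine (norm_le_sum_of_antisymm (finiteL_transpose θ Λ) v ⟨x, hx⟩).trans ?_
  simp only [hres]
  have hsub : ∀ x, Summable fun z : {z // z ∉ Λ} => |kernelL θ x z| * ‖K z y‖ := fun x =>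
    (hLK2.prod_factor x).subtype _
  calc ∑ k : Λ, ‖∑' z : {z // z ∉ Λ}, (kernelL θ k z : ℂ) * K z y‖
      ≤ ∑ k : Λ, ∑' z : {z // z ∉ Λ}, |kernelL θ k z| * ‖K z y‖ := by
        refine Finset.sum_le_sum fun k _ => ?_
        refine tsum_of_norm_bounded (hsub k).hasSum fun z => ?_
        rw [norm_mul, Complex.norm_real, Real.norm_eq_abs]
    _ = ∑' z : {z // z ∉ Λ}, ∑ k : Λ, |kernelL θ k z| * ‖K z y‖ :=
        (Summable.tsum_finsetSum (s := Finset.univ)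
          (f := fun (k : Λ) (z : {z // z ∉ Λ}) => |kernelL θ k z| * ‖K z y‖)
          fun k _ => hsub k).symm
    _ ≤ ∑' z : {z // z ∉ Λ}, ∑' x, |kernelL θ x z| * ‖K z y‖ := by
        refine Summable.tsum_le_tsum (fun z => ?_) (summable_sum fun k _ => hsub k)
          (hc.subtype _)
        rw [Finset.sum_coe_sort Λ fun k => |kernelL θ k z| * ‖K z y‖]
        exact (hcol z).sum_le_tsum Λ fun _ _ => by positivity

theorem plancherelProcess_image {θ : ℝ} (hθ : 0 < θ) {Λ : Finset HalfInts} (S : Finset Λ) :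
    (plancherelProcess θ).real {(Subtype.val '' (S : Set Λ) : Set HalfInts)} = Real.exp (-θ) *
      ((finiteL θ Λ).submatrix (Subtype.val : S → Λ) (Subtype.val : S → Λ)).det := by
  let y : Fin S.card → HalfInts := fun i => ((S.equivFin.symm i : Λ) : HalfInts)
  have hy : Function.Injective y := fun i j h =>
    S.equivFin.symm.injective (Subtype.ext (Subtype.ext h))
  have hr : Set.range y = Subtype.val '' (S : Set Λ) := by
    ext x
    constructor
    · rintro ⟨i, rfl⟩
      exact ⟨_, (S.equivFin.symm i).2, rfl⟩
    · rintro ⟨z, hz, rfl⟩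
      exact ⟨S.equivFin ⟨z, hz⟩, by simp [y]⟩
  rw [← hr, plancherelProcess_range hθ y hy, ← det_submatrix_equiv_self S.equivFin.symm]
  rfl

/-- The event is a finite disjoint union of single configurations, so its probability is e^{-θ}
times a sum of principal minors of L_Λ. -/
theorem plancherelProcess_between {θ : ℝ} (hθ : 0 < θ) {n : ℕ} {x : Fin n → HalfInts}
    (hx : Function.Injective x) {Λ : Finset HalfInts} (hΛ : ∀ i, x i ∈ Λ) :
    (plancherelProcess θ).real {A | (∀ i, x i ∈ A) ∧ A ⊆ Λ} =
      Real.exp (-θ) * (1 + finiteL θ Λ).det *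
        (Matrix.of fun i j => finiteKernel θ Λ (x i) (x j)).det := by
  classical
  have hp : IsProbabilityMeasure (plancherelProcess θ) :=
    have := isProbabilityMeasure_poissonizedPlancherel hθ.le
    Measure.isProbabilityMeasure_map measurable_frobeniusConfig.aemeasurable
  let x' : Fin n → Λ := fun i => ⟨x i, hΛ i⟩
  have hx' : Function.Injective x' := fun i j h => hx (congrArg Subtype.val h)
  let X : Finset Λ := Finset.univ.image x'
  have hset : {A : Set HalfInts | (∀ i, x i ∈ A) ∧ A ⊆ Λ} =
      ⋃ S ∈ Finset.univ.filter (X ⊆ ·), {(Subtype.val '' (S : Set Λ) : Set HalfInts)} := by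
    ext A
    simp only [Set.mem_ofPred_eq, Set.mem_iUnion, Set.mem_singleton_iff, Finset.mem_filter,
      Finset.mem_univ, true_and, exists_prop]
    constructor
    · rintro ⟨h1, h2⟩
      refine ⟨Finset.univ.filter fun z : Λ => (z : HalfInts) ∈ A, ?_, ?_⟩
      · intro z hz
        simp only [X, Finset.mem_image, Finset.mem_univ, true_and] at hz
        obtain ⟨i, rfl⟩ := hz
        simpa using h1 i
      · ext z
        simp only [Finset.coe_filter, Finset.mem_univ, true_and, Set.mem_image, Set.mem_ofPred_eq]
        exact ⟨fun hz => ⟨⟨z, h2 hz⟩, hz, rfl⟩, by rintro ⟨w, hw, rfl⟩; exact hw⟩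
    · rintro ⟨S, hS, rfl⟩
      refine ⟨fun i => ⟨x' i, hS (Finset.mem_image_of_mem _ (Finset.mem_univ i)), rfl⟩, ?_⟩
      rintro _ ⟨z, -, rfl⟩
      exact z.2
  have hinj : Function.Injective fun S : Finset Λ => (Subtype.val '' (S : Set Λ) : Set HalfInts) :=
    fun S T h => Finset.coe_injective (Subtype.val_injective.image_injective h)
  have hdisj : Set.PairwiseDisjoint (↑(Finset.univ.filter (X ⊆ ·)) : Set (Finset Λ))
      fun S : Finset Λ => ({(Subtype.val '' (S : Set Λ) : Set HalfInts)} : Set (Set HalfInts)) := by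
    intro S _ T _ hST
    exact Set.disjoint_singleton.2 fun h => hST (hinj h)
  rw [hset, measureReal_biUnion_finset hdisj fun S _ => measurableSet_singleton_config _,
    Finset.sum_congr rfl fun S _ => plancherelProcess_image hθ S, ← Finset.mul_sum,
    sum_principal_minors_eq (isUnit_det_one_add_of_antisymm (finiteL_transpose θ Λ)) X, mul_assoc]
  congr 2
  let e : Fin n ≃ X := (Equiv.ofInjective x' hx').trans (Equiv.setCongr (by simp [X]))
  rw [← det_submatrix_equiv_self e]
  congr 1
  ext i j
  simp only [submatrix_apply, of_apply, finiteKernel, hΛ, and_self, dite_true]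
  rfl

/-- No mass is lost when Λ exhausts ℤ'. The event is measurable because there are only countably
many finite configurations. -/
theorem finiteConfigs_measure (θ : ℝ) :
    ∀ᵐ (A : Set HalfInts) ∂(plancherelProcess θ), ∃ Λ : Finset HalfInts, A ⊆ Λ := by
  have hS : MeasurableSet {A : Set HalfInts | ∃ Λ : Finset HalfInts, A ⊆ Λ} := by
    have : {A : Set HalfInts | ∃ Λ : Finset HalfInts, A ⊆ Λ} =
        Set.range fun Λ : Finset HalfInts => (Λ : Set HalfInts) := by
      ext A
      constructor
      · rintro ⟨Λ, h⟩
        exact ⟨(Λ.finite_toSet.subset h).toFinset, by simp⟩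
      · rintro ⟨Λ, rfl⟩
        exact ⟨Λ, le_rfl⟩
    rw [this]
    exact (Set.countable_range _).measurableSet
  rw [plancherelProcess, ae_map_iff measurable_frobeniusConfig.aemeasurable hS]
  exact Eventually.of_forall fun μ => ⟨frobeniusConfig μ, le_rfl⟩

/-- The process is determinantal, with the kernel determined by `K + L K = L`. -/
theorem isDeterminantal_of_equation {θ : ℝ} (hθ : 0 < θ) {K : HalfInts → HalfInts → ℂ}
    (hL : Summable fun q : HalfInts × HalfInts => |kernelL θ q.1 q.2|)
    (hK : ∀ y, Summable fun x => ‖K x y‖)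
    (heq : ∀ x y, K x y + ∑' z, (kernelL θ x z : ℂ) * K z y = kernelL θ x y) :
    IsDeterminantal (plancherelProcess θ) K := by
  have hp : IsProbabilityMeasure (plancherelProcess θ) :=
    have := isProbabilityMeasure_poissonizedPlancherel hθ.le
    Measure.isProbabilityMeasure_map measurable_frobeniusConfig.aemeasurable
  refine ⟨hp, fun n x hx => ?_⟩
  have hlim : ∀ {m : ℕ} (w : Fin m → HalfInts),
      Tendsto (fun Λ : Finset HalfInts =>
        (plancherelProcess θ).real {A | (∀ i, w i ∈ A) ∧ A ⊆ Λ}) atTop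
        (𝓝 ((plancherelProcess θ).real {A | ∀ i, w i ∈ A})) := by
    intro m w
    have hmono : Monotone fun Λ : Finset HalfInts =>
        {A : Set HalfInts | (∀ i, w i ∈ A) ∧ A ⊆ Λ} := fun Λ Λ' h A hA =>
      ⟨hA.1, hA.2.trans (Finset.coe_subset.2 h)⟩
    have h1 := tendsto_measure_iUnion_atTop (μ := plancherelProcess θ) hmono
    have h2 : plancherelProcess θ (⋃ Λ : Finset HalfInts,
        {A : Set HalfInts | (∀ i, w i ∈ A) ∧ A ⊆ Λ}) =
        plancherelProcess θ {A | ∀ i, w i ∈ A} := by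
      refine measure_congr ?_
      filter_upwards [finiteConfigs_measure θ] with A hA
      refine propext ⟨fun h => ?_, fun h => ?_⟩
      · obtain ⟨Λ, hΛ⟩ := Set.mem_iUnion.1 h
        exact hΛ.1
      · obtain ⟨Λ, hΛ⟩ := hA
        exact Set.mem_iUnion.2 ⟨Λ, h, hΛ⟩
    rw [h2] at h1
    exact (ENNReal.tendsto_toReal (measure_ne_top _ _)).comp h1
  have hdet : Tendsto (fun Λ : Finset HalfInts =>
      (Matrix.of fun i j => (finiteKernel θ Λ (x i) (x j) : ℂ)).det) atTop
      (𝓝 (Matrix.of fun i j => K (x i) (x j)).det) := by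
    have h1 : Tendsto (fun Λ : Finset HalfInts =>
        (Matrix.of fun i j => (finiteKernel θ Λ (x i) (x j) : ℂ))) atTop
        (𝓝 (Matrix.of fun i j => K (x i) (x j))) :=
      tendsto_pi_nhds.2 fun i => tendsto_pi_nhds.2 fun j =>
        finiteKernel_tendsto hL hK heq (x i) (x j)
    exact ((continuous_id.matrix_det).tendsto _).comp h1
  -- For the empty tuple the limit is the total mass, so e^{-θ} det(1 + L_Λ) → 1 without any
  -- separate evaluation of an infinite determinant.
  have h0 := hlim (Fin.elim0 : Fin 0 → HalfInts)
  have h1 := hlim x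
  have h0' : Tendsto (fun Λ : Finset HalfInts => ((Real.exp (-θ) * (1 + finiteL θ Λ).det : ℝ) : ℂ))
      atTop (𝓝 1) := by
    rw [← Complex.ofReal_one]
    refine (Complex.continuous_ofReal.tendsto _).comp ?_
    have h2 : (plancherelProcess θ).real
        {A : Set HalfInts | ∀ i : Fin 0, (Fin.elim0 i : HalfInts) ∈ A} = 1 := by
      simp
    rw [h2] at h0
    refine h0.congr fun Λ => ?_
    rw [plancherelProcess_between hθ (Function.injective_of_subsingleton _) fun i => i.elim0]
    simp
  have h1' : Tendsto (fun Λ : Finset HalfInts =>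
      (((plancherelProcess θ).real {A | (∀ i, x i ∈ A) ∧ A ⊆ Λ} : ℝ) : ℂ)) atTop
      (𝓝 (((plancherelProcess θ).real {A | ∀ i, x i ∈ A} : ℝ) : ℂ)) :=
    (Complex.continuous_ofReal.tendsto _).comp h1
  refine tendsto_nhds_unique h1' ?_
  have h3 := h0'.mul hdet
  rw [one_mul] at h3
  refine h3.congr' ?_
  classical
  filter_upwards [eventually_ge_atTop (Finset.univ.image x)] with Λ hΛ
  have h4 : (Matrix.of fun i j => (finiteKernel θ Λ (x i) (x j) : ℂ)).det =
      (((Matrix.of fun i j => finiteKernel θ Λ (x i) (x j)).det : ℝ) : ℂ) :=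
    (RingHom.map_det Complex.ofRealHom _).symm
  rw [plancherelProcess_between hθ hx fun i =>
    hΛ (Finset.mem_image_of_mem x (Finset.mem_univ i)), h4, ← Complex.ofReal_mul]

end Determinantal

/-! ### Bessel functions: analyticity, bounds and residues -/

section BesselFunctions

/-- The entire function `∑ₖ (-θ)^k / (k! Γ(ν + k + 1)) = θ^{-ν/2} J_ν(2√θ)`. -/
def besselC (θ : ℝ) (ν : ℂ) : ℂ :=
  ∑' k : ℕ, (-(θ : ℂ)) ^ k / (k ! : ℂ) * (Complex.Gamma (ν + k + 1))⁻¹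

/-- For each k compactness of the disc gives a bound. Once k ≥ N ≥ R, raising k by one divides 1/Γ
by a number of modulus at least 1, so the bound for k = N persists. -/
theorem exists_bound_inv_Gamma (R : ℝ) :
    ∃ C : ℝ, ∀ (k : ℕ) (ν : ℂ), ‖ν‖ ≤ R → ‖(Complex.Gamma (ν + k + 1))⁻¹‖ ≤ C := by
  have hk : ∀ k : ℕ, ∃ C : ℝ, 0 ≤ C ∧
      ∀ ν : ℂ, ‖ν‖ ≤ R → ‖(Complex.Gamma (ν + k + 1))⁻¹‖ ≤ C := by
    intro k
    have hcont : Continuous fun ν : ℂ => (Complex.Gamma (ν + k + 1))⁻¹ :=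
      Complex.differentiable_one_div_Gamma.continuous.comp (by fun_prop)
    obtain ⟨C, hC⟩ := (isCompact_closedBall (0 : ℂ) R).exists_bound_of_continuousOn
      hcont.continuousOn
    exact ⟨max C 0, le_max_right _ _, fun ν hν =>
      (hC ν (by simpa using hν)).trans (le_max_left _ _)⟩
  choose C hC0 hC using hk
  obtain ⟨N, hN⟩ := exists_nat_ge R
  have hbig : ∀ (j : ℕ) (ν : ℂ), ‖ν‖ ≤ R →
      ‖(Complex.Gamma (ν + ((N + j : ℕ) : ℂ) + 1))⁻¹‖ ≤ C N := by
    intro j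
    induction j with
    | zero => exact fun ν hν => hC N ν hν
    | succ j ih =>
      intro ν hν
      set s : ℂ := ν + ((N + j : ℕ) : ℂ) + 1 with hs
      have hnorm : 1 ≤ ‖s‖ := by
        have h1 : ‖((N + j : ℕ) : ℂ) + 1‖ = N + j + 1 := by
          rw [← Nat.cast_succ, Complex.norm_natCast]
          push_cast
          ring
        have h2 : ‖((N + j : ℕ) : ℂ) + 1‖ ≤ ‖s‖ + ‖ν‖ := by
          have : ((N + j : ℕ) : ℂ) + 1 = s - ν := by rw [hs]; ring
          rw [this]
          exact norm_sub_le _ _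
        have h3 : (0 : ℝ) ≤ j := Nat.cast_nonneg j
        linarith
      have hs0 : s ≠ 0 := by
        intro h
        rw [h, norm_zero] at hnorm
        linarith
      have h4 : ν + ((N + (j + 1) : ℕ) : ℂ) + 1 = s + 1 := by
        rw [hs]
        push_cast
        ring
      rw [h4, Complex.Gamma_add_one s hs0, mul_inv, norm_mul, norm_inv]
      calc ‖s‖⁻¹ * ‖(Complex.Gamma s)⁻¹‖ ≤ 1 * C N :=
            mul_le_mul (inv_le_one_of_one_le₀ hnorm) (ih ν hν) (norm_nonneg _) zero_le_one
        _ = C N := one_mul _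
  refine ⟨∑ k ∈ Finset.range (N + 1), C k, fun k ν hν => ?_⟩
  rcases lt_or_ge k N with h | h
  · exact (hC k ν hν).trans (Finset.single_le_sum (fun i _ => hC0 i)
      (Finset.mem_range.2 (by omega)))
  · obtain ⟨j, rfl⟩ := Nat.exists_eq_add_of_le h
    exact (hbig j ν hν).trans (Finset.single_le_sum (fun i _ => hC0 i)
      (Finset.mem_range.2 (by omega)))

theorem norm_besselC_coeff (θ : ℝ) (k : ℕ) :
    ‖(-(θ : ℂ)) ^ k / (k ! : ℂ)‖ = |θ| ^ k / k ! := by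
  rw [norm_div, norm_pow, norm_neg, Complex.norm_real, Real.norm_eq_abs, Complex.norm_natCast]

theorem summable_besselC_bound (θ C : ℝ) : Summable fun k : ℕ => |θ| ^ k / k ! * C :=
  (Real.summable_pow_div_factorial |θ|).mul_right C

theorem norm_besselC_term_le {θ C : ℝ} {ν : ℂ} {k : ℕ}
    (h : ‖(Complex.Gamma (ν + k + 1))⁻¹‖ ≤ C) :
    ‖(-(θ : ℂ)) ^ k / (k ! : ℂ) * (Complex.Gamma (ν + k + 1))⁻¹‖ ≤ |θ| ^ k / k ! * C := by
  rw [norm_mul, norm_besselC_coeff]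
  exact mul_le_mul_of_nonneg_left h (by positivity)

theorem summable_besselC (θ : ℝ) (ν : ℂ) :
    Summable fun k : ℕ => (-(θ : ℂ)) ^ k / (k ! : ℂ) * (Complex.Gamma (ν + k + 1))⁻¹ := by
  obtain ⟨C, hC⟩ := exists_bound_inv_Gamma ‖ν‖
  exact Summable.of_norm_bounded (summable_besselC_bound θ C)
    fun k => norm_besselC_term_le (hC k ν le_rfl)

theorem differentiable_besselC (θ : ℝ) : Differentiable ℂ (besselC θ) := by
  intro ν
  obtain ⟨C, hC⟩ := exists_bound_inv_Gamma (‖ν‖ + 1)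
  have hd : DifferentiableOn ℂ (besselC θ) (Metric.ball 0 (‖ν‖ + 1)) := by
    refine Complex.differentiableOn_tsum_of_summable_norm (summable_besselC_bound θ C)
      (fun k => ?_) Metric.isOpen_ball fun k w hw => ?_
    · refine Differentiable.differentiableOn ?_
      refine (differentiable_const _).mul ?_
      exact Complex.differentiable_one_div_Gamma.comp
        (f := fun ν : ℂ => ν + k + 1) (by fun_prop)
    · exact norm_besselC_term_le (hC k w (by simpa using (Metric.mem_ball.1 hw).le))
  refine hd.differentiableAt (Metric.isOpen_ball.mem_nhds ?_)
  simp

/-- Every Γ(n+k+1) is at least n!. The factorial decay makes the columns of the kernel summable. -/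
theorem norm_besselC_natCast_le (θ : ℝ) (n : ℕ) :
    ‖besselC θ n‖ ≤ Real.exp |θ| / n ! := by
  have hsum : HasSum (fun k : ℕ => |θ| ^ k / k ! * (1 / n ! : ℝ)) (Real.exp |θ| / n !) := by
    rw [Real.exp_eq_exp_ℝ, div_eq_mul_one_div (NormedSpace.exp |θ|)]
    exact (NormedSpace.expSeries_div_hasSum_exp (𝔸 := ℝ) |θ|).mul_right _
  refine tsum_of_norm_bounded hsum fun k => norm_besselC_term_le ?_
  have h : (n : ℂ) + k + 1 = ((n + k : ℕ) : ℂ) + 1 := by push_cast; ring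
  rw [h, Complex.Gamma_nat_eq_factorial, norm_inv, Complex.norm_natCast, one_div]
  refine inv_anti₀ (by positivity) ?_
  exact_mod_cast Nat.factorial_le (Nat.le_add_right n k)

/-- `J_{-n} = (-1)^n J_n`. -/
theorem besselC_neg_natCast (θ : ℝ) (n : ℕ) :
    besselC θ (-n) = (-(θ : ℂ)) ^ n * besselC θ n := by
  unfold besselC
  -- The first n terms sit at poles of Γ, where 1/Γ is 0, so the series starts at k = n.
  rw [← (summable_besselC θ (-n)).sum_add_tsum_nat_add n, Finset.sum_eq_zero, zero_add,
    ← tsum_mul_left]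
  · refine tsum_congr fun k => ?_
    have h1 : -(n : ℂ) + ((k + n : ℕ) : ℂ) + 1 = (k : ℂ) + 1 := by push_cast; ring
    have h2 : (n : ℂ) + (k : ℂ) + 1 = ((k + n : ℕ) : ℂ) + 1 := by push_cast; ring
    rw [h1, h2, Complex.Gamma_nat_eq_factorial, Complex.Gamma_nat_eq_factorial, pow_add]
    ring
  · intro k hk
    rw [Finset.mem_range] at hk
    obtain ⟨m, rfl⟩ := Nat.exists_eq_add_of_lt hk
    have h1 : -((k + m + 1 : ℕ) : ℂ) + k + 1 = -(m : ℂ) := by push_cast; ring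
    rw [h1, Complex.Gamma_neg_nat_eq_zero, inv_zero, mul_zero]

/-- All dependence on a complex power is pulled out of the series, leaving a factor that is entire
in ν. -/
theorem besselJ_eq {η θ : ℝ} (hη : 0 < η) (h : η ^ 2 = θ) (ν : ℂ) :
    besselJ ν (2 * (η : ℂ)) = (η : ℂ) ^ ν * besselC θ ν := by
  unfold besselJ besselC
  rw [← tsum_mul_left]
  refine tsum_congr fun k => ?_
  have hη' : (η : ℂ) ≠ 0 := Complex.ofReal_ne_zero.2 hη.ne'
  have h1 : (2 * (η : ℂ) / 2) ^ (ν + 2 * (k : ℂ)) = (η : ℂ) ^ ν * (θ : ℂ) ^ k := by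
    rw [mul_div_cancel_left₀ _ two_ne_zero, Complex.cpow_add _ _ hη', Complex.cpow_mul_nat]
    congr 2
    rw [← h]
    push_cast
    exact_mod_cast Complex.cpow_natCast (η : ℂ) 2
  rw [h1, neg_pow (θ : ℂ) k]
  field_simp

section Entries

variable {η θ : ℝ} (hη : 0 < η) (h : η ^ 2 = θ) (ζ : ℂ)

include hη in
theorem sqrt_eq_cpow : ((Real.sqrt η : ℝ) : ℂ) = (η : ℂ) ^ (1 / 2 : ℂ) := by
  rw [Real.sqrt_eq_rpow, Complex.ofReal_cpow hη.le]
  simp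

include hη in
theorem sqrt_mul_cpow (ν : ℂ) :
    ((Real.sqrt η : ℝ) : ℂ) * (η : ℂ) ^ ν = (η : ℂ) ^ (1 / 2 + ν) := by
  rw [sqrt_eq_cpow hη, Complex.cpow_add _ _ (Complex.ofReal_ne_zero.2 hη.ne')]

include hη h

theorem besselP_zero_zero : besselP η ζ 0 0 = (η : ℂ) ^ ζ * besselC θ (ζ - 1 / 2) := by
  simp only [besselP, Matrix.smul_apply, Matrix.of_apply, Matrix.cons_val', Matrix.cons_val_zero,
    Matrix.cons_val_fin_one, smul_eq_mul]
  rw [besselJ_eq hη h, ← mul_assoc, sqrt_mul_cpow hη]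
  congr 2
  ring

theorem besselP_zero_one : besselP η ζ 0 1 = (η : ℂ) ^ (1 - ζ) * besselC θ (1 / 2 - ζ) := by
  simp only [besselP, Matrix.smul_apply, Matrix.of_apply, Matrix.cons_val', Matrix.cons_val_zero,
    Matrix.cons_val_one, Matrix.cons_val_fin_one, smul_eq_mul]
  rw [besselJ_eq hη h, ← mul_assoc, sqrt_mul_cpow hη, neg_add_eq_sub]
  congr 2
  ring

theorem besselP_one_zero : besselP η ζ 1 0 = -((η : ℂ) ^ (1 + ζ) * besselC θ (ζ + 1 / 2)) := by
  simp only [besselP, Matrix.smul_apply, Matrix.of_apply, Matrix.cons_val', Matrix.cons_val_zero,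
    Matrix.cons_val_one, Matrix.cons_val_fin_one, smul_eq_mul]
  rw [besselJ_eq hη h, mul_neg, ← mul_assoc, sqrt_mul_cpow hη]
  congr 3
  ring

theorem besselP_one_one : besselP η ζ 1 1 = (η : ℂ) ^ (-ζ) * besselC θ (-ζ - 1 / 2) := by
  simp only [besselP, Matrix.smul_apply, Matrix.of_apply, Matrix.cons_val',
    Matrix.cons_val_one, Matrix.cons_val_fin_one, smul_eq_mul]
  rw [besselJ_eq hη h, ← mul_assoc, sqrt_mul_cpow hη]
  congr 2
  ring

omit ζ in
theorem differentiable_besselP (i j : Fin 2) : Differentiable ℂ fun ζ => besselP η ζ i j := by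
  have hη' : (η : ℂ) ≠ 0 := Complex.ofReal_ne_zero.2 hη.ne'
  have hc : ∀ g : ℂ → ℂ, Differentiable ℂ g → Differentiable ℂ fun ζ => (η : ℂ) ^ g ζ :=
    fun g hg => hg.const_cpow (Or.inl hη')
  have hC : ∀ g : ℂ → ℂ, Differentiable ℂ g → Differentiable ℂ fun ζ => besselC θ (g ζ) :=
    fun g hg => (differentiable_besselC θ).comp hg
  fin_cases i <;> fin_cases j
  · simp only [Fin.zero_eta, besselP_zero_zero hη h]
    exact (hc _ (by fun_prop)).mul (hC _ (by fun_prop))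
  · simp only [Fin.zero_eta, Fin.mk_one, besselP_zero_one hη h]
    exact (hc _ (by fun_prop)).mul (hC _ (by fun_prop))
  · simp only [Fin.zero_eta, Fin.mk_one, besselP_one_zero hη h]
    exact ((hc _ (by fun_prop)).mul (hC _ (by fun_prop))).neg
  · simp only [Fin.mk_one, besselP_one_one hη h]
    exact (hc _ (by fun_prop)).mul (hC _ (by fun_prop))

end Entries

/-- `Γ(s) θ^{(1-s)/2} J_{s-1}(2√θ)`. -/
def besselH0 (θ : ℝ) (s : ℂ) : ℂ := Complex.Gamma s * besselC θ (s - 1)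

/-- `Γ(s) θ^{-s/2} J_s(2√θ)`. -/
def besselH1 (θ : ℝ) (s : ℂ) : ℂ := Complex.Gamma s * besselC θ s

/-- The exponential factors η^{±ζ} cancel. Each entry becomes Γ(s) times an entire function of s =
±ζ + 1/2, up to a constant, from which poles and growth can be read off. -/
theorem besselM_eq {η θ : ℝ} (hη : 0 < η) (h : η ^ 2 = θ) (ζ : ℂ) :
    besselM η ζ = !![besselH0 θ (ζ + 1 / 2), η * besselH1 θ (-ζ + 1 / 2);
      -(η * besselH1 θ (ζ + 1 / 2)), besselH0 θ (-ζ + 1 / 2)] := by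
  have hη' : (η : ℂ) ≠ 0 := Complex.ofReal_ne_zero.2 hη.ne'
  have e1 : (η : ℂ) ^ ζ * (η : ℂ) ^ (-ζ) = 1 := by
    rw [← Complex.cpow_add _ _ hη', add_neg_cancel, Complex.cpow_zero]
  have e2 : (η : ℂ) ^ (1 - ζ) * (η : ℂ) ^ ζ = η := by
    rw [← Complex.cpow_add _ _ hη', sub_add_cancel, Complex.cpow_one]
  have e3 : (η : ℂ) ^ (1 + ζ) * (η : ℂ) ^ (-ζ) = η := by
    rw [← Complex.cpow_add _ _ hη', add_neg_cancel_right, Complex.cpow_one]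
  ext i j
  fin_cases i <;> fin_cases j <;>
    simp only [besselM, Matrix.mul_apply, Fin.sum_univ_two, Fin.zero_eta, Fin.mk_one,
      Matrix.of_apply, Matrix.cons_val', Matrix.cons_val_zero, Matrix.cons_val_one,
      Matrix.cons_val_fin_one, mul_zero, add_zero, zero_add]
  · rw [besselP_zero_zero hη h, besselH0, show ζ + 1 / 2 - 1 = ζ - 1 / 2 by ring]
    linear_combination (Complex.Gamma (ζ + 1 / 2) * besselC θ (ζ - 1 / 2)) * e1
  · rw [besselP_zero_one hη h, besselH1, show 1 / 2 - ζ = -ζ + 1 / 2 by ring]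
    linear_combination (Complex.Gamma (-ζ + 1 / 2) * besselC θ (-ζ + 1 / 2)) * e2
  · rw [besselP_one_zero hη h, besselH1]
    linear_combination -(Complex.Gamma (ζ + 1 / 2) * besselC θ (ζ + 1 / 2)) * e3
  · rw [besselP_one_one hη h, besselH0, show -ζ + 1 / 2 - 1 = -ζ - 1 / 2 by ring]
    linear_combination (Complex.Gamma (-ζ + 1 / 2) * besselC θ (-ζ - 1 / 2)) * e1

theorem differentiableAt_besselH0 (θ : ℝ) {s : ℂ} (hs : ∀ n : ℕ, s ≠ -n) :
    DifferentiableAt ℂ (besselH0 θ) s :=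
  (Complex.differentiableAt_Gamma s hs).mul
    ((differentiable_besselC θ).comp (differentiable_id.sub_const 1)).differentiableAt

theorem differentiableAt_besselH1 (θ : ℝ) {s : ℂ} (hs : ∀ n : ℕ, s ≠ -n) :
    DifferentiableAt ℂ (besselH1 θ) s :=
  (Complex.differentiableAt_Gamma s hs).mul (differentiable_besselC θ).differentiableAt

/-- The quotient is 1/(s(s+1)⋯(s+k)). The factor s is kept for the decay at infinity and each of the
other k factors is bounded below by ε. -/
theorem norm_Gamma_div_Gamma_le {ε : ℝ} (hε : 0 < ε) {s : ℂ} (hs : ∀ n : ℕ, ε ≤ ‖s + n‖) (k : ℕ) :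
    ‖Complex.Gamma s * (Complex.Gamma (s + k + 1))⁻¹‖ ≤ (1 / ε) ^ k / ‖s‖ := by
  have hne : ∀ n : ℕ, s + n ≠ 0 := fun n h0 => by
    have := hs n
    rw [h0, norm_zero] at this
    linarith
  have hG : Complex.Gamma s ≠ 0 := Complex.Gamma_ne_zero fun n h0 => hne n (by rw [h0]; ring)
  induction k with
  | zero =>
    have h0 : s ≠ 0 := by simpa using hne 0
    rw [Nat.cast_zero, add_zero, Complex.Gamma_add_one s h0, mul_inv, mul_comm (s⁻¹),
      mul_inv_cancel_left₀ hG, norm_inv, pow_zero, one_div]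
  | succ k ih =>
    have h1 : s + ((k + 1 : ℕ) : ℂ) + 1 = (s + k + 1) + 1 := by push_cast; ring
    have h2 : s + k + 1 = s + ((k + 1 : ℕ) : ℂ) := by push_cast; ring
    have h3 : s + (k : ℂ) + 1 ≠ 0 := h2 ▸ hne (k + 1)
    rw [h1, Complex.Gamma_add_one _ h3, mul_inv, mul_comm (s + (k : ℂ) + 1)⁻¹, ← mul_assoc,
      norm_mul, norm_inv, h2]
    rw [h2] at ih
    calc _ ≤ (1 / ε) ^ k / ‖s‖ * ε⁻¹ :=
          mul_le_mul ih (inv_anti₀ hε (hs _)) (by positivity) (by positivity)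
      _ = (1 / ε) ^ (k + 1) / ‖s‖ := by rw [pow_succ]; ring

theorem norm_besselH1_le {θ ε : ℝ} (hε : 0 < ε) {s : ℂ} (hs : ∀ n : ℕ, ε ≤ ‖s + n‖) :
    ‖besselH1 θ s‖ ≤ Real.exp (|θ| / ε) / ‖s‖ := by
  have hsum : HasSum (fun k : ℕ => (|θ| / ε) ^ k / k ! * (1 / ‖s‖)) (Real.exp (|θ| / ε) / ‖s‖) := by
    rw [Real.exp_eq_exp_ℝ, div_eq_mul_one_div (NormedSpace.exp _)]
    exact (NormedSpace.expSeries_div_hasSum_exp (𝔸 := ℝ) _).mul_right _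
  rw [besselH1, besselC, ← tsum_mul_left]
  refine tsum_of_norm_bounded hsum fun k => ?_
  rw [mul_left_comm, norm_mul, norm_besselC_coeff]
  calc _ ≤ |θ| ^ k / k ! * ((1 / ε) ^ k / ‖s‖) :=
        mul_le_mul_of_nonneg_left (norm_Gamma_div_Gamma_le hε hs k) (by positivity)
    _ = _ := by
      rw [div_pow, div_pow, one_pow]
      ring

/-- The term k = 0 is Γ(s)/Γ(s) = 1. After a shift of index the remaining terms have the form
treated by `norm_Gamma_div_Gamma_le`, and each carries 1/s. -/
theorem norm_besselH0_sub_one_le {θ ε : ℝ} (hε : 0 < ε) {s : ℂ} (hs : ∀ n : ℕ, ε ≤ ‖s + n‖) :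
    ‖besselH0 θ s - 1‖ ≤ |θ| * Real.exp (|θ| / ε) / ‖s‖ := by
  have hG : Complex.Gamma s ≠ 0 := Complex.Gamma_ne_zero fun n h0 => by
    have := hs n
    rw [h0, neg_add_cancel, norm_zero] at this
    linarith
  have hsum : HasSum (fun k : ℕ => (|θ| / ε) ^ k / k ! * (|θ| / ‖s‖))
      (|θ| * Real.exp (|θ| / ε) / ‖s‖) := by
    rw [Real.exp_eq_exp_ℝ, mul_comm |θ|, mul_div_assoc]
    exact (NormedSpace.expSeries_div_hasSum_exp (𝔸 := ℝ) _).mul_right _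
  have h0 : besselH0 θ s - 1 = ∑' k : ℕ, Complex.Gamma s * ((-(θ : ℂ)) ^ (k + 1) / ((k + 1)! : ℂ) *
      (Complex.Gamma (s + k + 1))⁻¹) := by
    rw [besselH0, besselC, (summable_besselC θ (s - 1)).tsum_eq_zero_add, mul_add, ← tsum_mul_left]
    have h1 : Complex.Gamma s * ((-(θ : ℂ)) ^ 0 / (0 ! : ℂ) *
        (Complex.Gamma (s - 1 + ((0 : ℕ) : ℂ) + 1))⁻¹) = 1 := by
      simp [hG]
    rw [h1, add_sub_cancel_left]
    refine tsum_congr fun k => ?_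
    have h2 : s - 1 + ((k + 1 : ℕ) : ℂ) + 1 = s + k + 1 := by push_cast; ring
    rw [h2]
  rw [h0]
  refine tsum_of_norm_bounded hsum fun k => ?_
  rw [mul_left_comm, norm_mul, norm_besselC_coeff]
  have hfac : |θ| ^ (k + 1) / ((k + 1)! : ℝ) ≤ |θ| ^ (k + 1) / k ! := by
    refine div_le_div_of_nonneg_left (by positivity) (by positivity) ?_
    exact_mod_cast Nat.factorial_le (Nat.le_succ k)
  calc _ ≤ |θ| ^ (k + 1) / k ! * ((1 / ε) ^ k / ‖s‖) :=
        mul_le_mul hfac (norm_Gamma_div_Gamma_le hε hs k) (norm_nonneg _) (by positivity)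
    _ = _ := by
      rw [div_pow, div_pow, one_pow, pow_succ]
      ring

/-- The residue of `Γ` at `-n` is `(-1)^n / n!`. -/
theorem tendsto_mul_Gamma (n : ℕ) :
    Tendsto (fun s : ℂ => (s + n) * Complex.Gamma s) (𝓝[≠] (-n : ℂ)) (𝓝 ((-1) ^ n / (n ! : ℂ))) := by
  induction n with
  | zero => simpa using Complex.tendsto_self_mul_Gamma_nhds_zero
  | succ n ih =>
    have hshift : Tendsto (fun s : ℂ => s + 1) (𝓝[≠] (-((n + 1 : ℕ) : ℂ))) (𝓝[≠] (-n : ℂ)) := by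
      refine tendsto_nhdsWithin_of_tendsto_nhds_of_eventually_within _ ?_ ?_
      · have h1 : (-n : ℂ) = -((n + 1 : ℕ) : ℂ) + 1 := by push_cast; ring
        rw [h1]
        exact (continuous_id.add continuous_const).continuousAt.tendsto.mono_left nhdsWithin_le_nhds
      · filter_upwards [self_mem_nhdsWithin] with s hs h1
        apply hs
        rw [Set.mem_singleton_iff] at h1 ⊢
        push_cast
        linear_combination h1
    have hne : (-((n + 1 : ℕ) : ℂ)) ≠ 0 := neg_ne_zero.2 (Nat.cast_ne_zero.2 (Nat.succ_ne_zero n))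
    have hinv : Tendsto (fun s : ℂ => s⁻¹) (𝓝[≠] (-((n + 1 : ℕ) : ℂ)))
        (𝓝 (-((n + 1 : ℕ) : ℂ))⁻¹) :=
      (tendsto_inv₀ hne).mono_left nhdsWithin_le_nhds
    have h2 := (ih.comp hshift).mul hinv
    have h3 : (-1 : ℂ) ^ n / (n ! : ℂ) * (-((n + 1 : ℕ) : ℂ))⁻¹ =
        (-1) ^ (n + 1) / ((n + 1)! : ℂ) := by
      rw [Nat.factorial_succ, pow_succ]
      push_cast
      have h4 : (n : ℂ) + 1 ≠ 0 := by exact_mod_cast Nat.succ_ne_zero n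
      have h5 : (n ! : ℂ) ≠ 0 := Nat.cast_ne_zero.2 (Nat.factorial_ne_zero n)
      rw [inv_neg]
      field_simp
    rw [h3] at h2
    refine h2.congr' ?_
    have h0 : ∀ᶠ s in 𝓝[≠] (-((n + 1 : ℕ) : ℂ)), s ≠ 0 :=
      nhdsWithin_le_nhds (isOpen_ne.mem_nhds hne)
    filter_upwards [h0] with s hs
    simp only [Function.comp]
    rw [Complex.Gamma_add_one s hs]
    push_cast
    field_simp
    ring

/-- The Γ-residue carries (-1)^n and the reflection of the index -(n+1) carries (-1)^(n+1), so one
minus sign survives. For `besselH1` the index is -n and the signs cancel. -/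
theorem tendsto_mul_besselH0 (θ : ℝ) (n : ℕ) :
    Tendsto (fun s : ℂ => (s + n) * besselH0 θ s) (𝓝[≠] (-n : ℂ))
      (𝓝 (-((θ : ℂ) ^ (n + 1) / (n ! : ℂ) * besselC θ (n + 1 : ℕ)))) := by
  have h1 : Tendsto (fun s : ℂ => besselC θ (s - 1)) (𝓝[≠] (-n : ℂ))
      (𝓝 (besselC θ (-(n : ℂ) - 1))) :=
    (((differentiable_besselC θ).continuous.comp
      (continuous_id.sub continuous_const)).tendsto _).mono_left nhdsWithin_le_nhds
  have h2 := (tendsto_mul_Gamma n).mul h1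
  have h3 : (-(n : ℂ) - 1) = -((n + 1 : ℕ) : ℂ) := by push_cast; ring
  rw [h3, besselC_neg_natCast] at h2
  have h4 : (-1 : ℂ) ^ n / (n ! : ℂ) * ((-(θ : ℂ)) ^ (n + 1) * besselC θ ((n + 1 : ℕ) : ℂ)) =
      -((θ : ℂ) ^ (n + 1) / (n ! : ℂ) * besselC θ (n + 1 : ℕ)) := by
    have h5 : (-1 : ℂ) ^ n * (-1) ^ n = 1 := by rw [← mul_pow]; simp
    rw [neg_pow (θ : ℂ), pow_succ (-1 : ℂ)]
    linear_combination (-((θ : ℂ) ^ (n + 1) / (n ! : ℂ) * besselC θ (n + 1 : ℕ))) * h5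
  rw [h4] at h2
  refine h2.congr fun s => ?_
  rw [besselH0, mul_assoc]

theorem tendsto_mul_besselH1 (θ : ℝ) (n : ℕ) :
    Tendsto (fun s : ℂ => (s + n) * besselH1 θ s) (𝓝[≠] (-n : ℂ))
      (𝓝 ((θ : ℂ) ^ n / (n ! : ℂ) * besselC θ n)) := by
  have h1 : Tendsto (fun s : ℂ => besselC θ s) (𝓝[≠] (-n : ℂ)) (𝓝 (besselC θ (-(n : ℂ)))) :=
    ((differentiable_besselC θ).continuous.tendsto _).mono_left nhdsWithin_le_nhds
  have h2 := (tendsto_mul_Gamma n).mul h1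
  rw [besselC_neg_natCast] at h2
  have h4 : (-1 : ℂ) ^ n / (n ! : ℂ) * ((-(θ : ℂ)) ^ n * besselC θ n) =
      (θ : ℂ) ^ n / (n ! : ℂ) * besselC θ n := by
    have h5 : (-1 : ℂ) ^ n * (-1) ^ n = 1 := by rw [← mul_pow]; simp
    rw [neg_pow (θ : ℂ)]
    linear_combination ((θ : ℂ) ^ n / (n ! : ℂ) * besselC θ n) * h5
  rw [h4] at h2
  refine h2.congr fun s => ?_
  rw [besselH1, mul_assoc]

theorem besselH0_natCast_succ (θ : ℝ) (n : ℕ) :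
    besselH0 θ (n + 1) = (n ! : ℂ) * besselC θ n := by
  rw [besselH0, Complex.Gamma_nat_eq_factorial, add_sub_cancel_right]

theorem besselH1_natCast_succ (θ : ℝ) (n : ℕ) :
    besselH1 θ (n + 1) = (n ! : ℂ) * besselC θ (n + 1 : ℕ) := by
  rw [besselH1, Complex.Gamma_nat_eq_factorial]
  push_cast
  rfl

end BesselFunctions

/-! ### Separation of the half-integers in the plane -/

section HalfIntegersComplex

theorem mem_halfIntsC {z : ℂ} : z ∈ halfIntsC ↔ ∃ x : HalfInts, ((x : ℝ) : ℂ) = z := by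
  constructor
  · rintro ⟨x, hx, rfl⟩
    exact ⟨⟨x, hx⟩, rfl⟩
  · rintro ⟨x, rfl⟩
    exact ⟨x, x.2, rfl⟩

theorem one_le_dist_halfInts {x y : HalfInts} (h : x ≠ y) : 1 ≤ |(x : ℝ) - y| := by
  obtain ⟨x, m, rfl⟩ := x
  obtain ⟨y, n, rfl⟩ := y
  have hmn : m - n ≠ 0 := fun h' => h (Subtype.ext (by rw [sub_eq_zero.1 h']))
  have h1 : (m : ℝ) + 1 / 2 - ((n : ℝ) + 1 / 2) = ((m - n : ℤ) : ℝ) := by push_cast; ring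
  simp only [h1]
  exact_mod_cast Int.one_le_abs hmn

theorem one_le_dist_halfIntsC {x y : ℂ} (hx : x ∈ halfIntsC) (hy : y ∈ halfIntsC) (h : x ≠ y) :
    1 ≤ dist x y := by
  obtain ⟨x, rfl⟩ := mem_halfIntsC.1 hx
  obtain ⟨y, rfl⟩ := mem_halfIntsC.1 hy
  rw [Complex.dist_eq, ← Complex.ofReal_sub, Complex.norm_real, Real.norm_eq_abs]
  exact one_le_dist_halfInts fun h' => h (by rw [h'])

theorem isClosed_of_subset_halfIntsC {X : Set ℂ} (hX : X ⊆ halfIntsC) : IsClosed X := by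
  refine Metric.isClosed_of_pairwise_le_dist zero_lt_one fun x hx y hy hxy => ?_
  exact one_le_dist_halfIntsC (hX hx) (hX hy) hxy

/-- Circles of integer radius stay away from all poles; they serve as the boundaries in the maximum
principle. -/
theorem half_le_dist_of_norm_natCast {z : ℂ} {N : ℕ} (hz : ‖z‖ = N) {x : ℂ} (hx : x ∈ halfIntsC) :
    1 / 2 ≤ dist z x := by
  obtain ⟨⟨x, n, rfl⟩, rfl⟩ := mem_halfIntsC.1 hx
  have h1 : |(N : ℝ) - abs ((n : ℝ) + 1 / 2)| ≤ dist z (((n : ℝ) + 1 / 2 : ℝ) : ℂ) := by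
    rw [Complex.dist_eq, ← hz, ← Real.norm_eq_abs ((n : ℝ) + 1 / 2), ← Complex.norm_real]
    exact abs_norm_sub_norm_le _ _
  refine le_trans ?_ h1
  have key : ∀ k : ℤ, (1 : ℝ) / 2 ≤ |(k : ℝ) + 1 / 2| := by
    intro k
    rcases le_or_gt 0 k with hk | hk
    · have : (0 : ℝ) ≤ k := by exact_mod_cast hk
      exact (by linarith : (1 : ℝ) / 2 ≤ k + 1 / 2).trans (le_abs_self _)
    · have : (k : ℝ) ≤ -1 := by exact_mod_cast Int.le_sub_one_of_lt hk
      exact (by linarith : (1 : ℝ) / 2 ≤ -(k + 1 / 2)).trans (neg_le_abs _)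
  rcases abs_cases ((n : ℝ) + 1 / 2) with ⟨h2, -⟩ | ⟨h2, -⟩
  · rw [h2, abs_sub_comm]
    refine (key (n - N)).trans_eq (congrArg abs ?_)
    push_cast
    ring
  · rw [h2]
    refine (key (N + n)).trans_eq (congrArg abs ?_)
    push_cast
    ring

end HalfIntegersComplex

/-! ### A Liouville theorem away from the half-integers -/

section Liouville

/-- The filter of points tending to infinity at distance at least `ε` from `X`. -/
def awayFilter (X : Set ℂ) (ε : ℝ) : Filter ℂ :=
  Bornology.cobounded ℂ ⊓ 𝓟 {ζ | ∀ x ∈ X, ε ≤ dist ζ x}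

theorem eventually_awayFilter {X : Set ℂ} {ε : ℝ} {p : ℂ → Prop} :
    (∀ᶠ ζ in awayFilter X ε, p ζ) ↔
      ∃ R : ℝ, ∀ ζ, R ≤ ‖ζ‖ → (∀ x ∈ X, ε ≤ dist ζ x) → p ζ := by
  rw [awayFilter, eventually_inf_principal, (hasBasis_cobounded_norm (E := ℂ)).eventually_iff]
  simp

theorem tendsto_norm_awayFilter (X : Set ℂ) (ε : ℝ) :
    Tendsto (fun ζ : ℂ => ‖ζ‖) (awayFilter X ε) atTop :=
  tendsto_norm_cobounded_atTop.mono_left inf_le_left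

theorem awayFilter_mono {X Y : Set ℂ} (h : X ⊆ Y) (ε : ℝ) : awayFilter Y ε ≤ awayFilter X ε :=
  inf_le_inf_left _ (principal_mono.2 fun _ hζ x hx => hζ x (h hx))

/-- A function that is analytic off a set of half-integers, has no poles there and tends to `c` away
from this set is constant. -/
theorem eq_const_of_tendsto_awayFilter {X : Set ℂ} (hX : X ⊆ halfIntsC) {f : ℂ → ℂ} {c : ℂ}
    (hd : DifferentiableOn ℂ f Xᶜ)
    (hrem : ∀ x ∈ X, Tendsto (fun ζ => (ζ - x) * f ζ) (𝓝[≠] x) (𝓝 0))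
    (hlim : Tendsto f (awayFilter X (1 / 2)) (𝓝 c)) {ζ : ℂ} (hζ : ζ ∉ X) : f ζ = c := by
  classical
  -- The singularities are removable by Riemann's criterion, and g is the entire extension.
  let g : ℂ → ℂ := fun z => if z ∈ X then limUnder (𝓝[≠] z) f else f z
  have hgf : ∀ z, z ∉ X → g z = f z := fun z hz => if_neg hz
  have hclosed := isClosed_of_subset_halfIntsC hX
  have hg : Differentiable ℂ g := by
    intro z
    by_cases hz : z ∈ X
    · have hball : ∀ w ∈ Metric.ball z 1, w ∈ X → w = z := by
        intro w hw hwX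
        by_contra hne
        exact absurd (one_le_dist_halfIntsC (hX hwX) (hX hz) hne) (not_le.2 (Metric.mem_ball.1 hw))
      have hB : Metric.ball z 1 ∈ 𝓝 z := Metric.ball_mem_nhds z one_pos
      have hdiff : DifferentiableOn ℂ f (Metric.ball z 1 \ {z}) :=
        hd.mono fun w hw hwX => hw.2 (hball w hw.1 hwX)
      have hO : (fun w => f w - f z) =o[𝓝[≠] z] fun w => (w - z)⁻¹ := by
        refine Asymptotics.isLittleO_of_tendsto' ?_ ?_
        · filter_upwards [self_mem_nhdsWithin] with w hw h0
          exact absurd (sub_eq_zero.1 (inv_eq_zero.1 h0)) hw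
        · have h1 : Tendsto (fun w => (w - z) * f z) (𝓝[≠] z) (𝓝 0) := by
            have : Tendsto (fun w => (w - z) * f z) (𝓝 z) (𝓝 ((z - z) * f z)) :=
              ((continuous_id.sub continuous_const).mul continuous_const).tendsto z
            rw [sub_self, zero_mul] at this
            exact this.mono_left nhdsWithin_le_nhds
          have h2 := (hrem z hz).sub h1
          rw [sub_zero] at h2
          refine h2.congr fun w => ?_
          rw [div_inv_eq_mul]
          ring
      have h3 := Complex.differentiableOn_update_limUnder_of_isLittleO hB hdiff hO
      refine (h3.differentiableAt hB).congr_of_eventuallyEq ?_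
      filter_upwards [hB] with w hw
      by_cases hwz : w = z
      · subst hwz
        simp [g, hz]
      · rw [Function.update_of_ne hwz, hgf w fun h => hwz (hball w hw h)]
    · have hU : Xᶜ ∈ 𝓝 z := hclosed.isOpen_compl.mem_nhds hz
      refine (hd.differentiableAt hU).congr_of_eventuallyEq ?_
      filter_upwards [hU] with w hw
      exact hgf w hw
  rw [← hgf ζ hζ, ← sub_eq_zero, ← norm_le_zero_iff]
  refine le_of_forall_pos_le_add fun δ hδ => ?_
  rw [zero_add]
  have h1 : ∀ᶠ z in awayFilter X (1 / 2), ‖f z - c‖ < δ := by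
    have := Metric.tendsto_nhds.1 hlim δ hδ
    simpa [dist_eq_norm] using this
  obtain ⟨R, hR⟩ := eventually_awayFilter.1 h1
  -- On the circle of integer radius N the function is δ-close to c, and the maximum principle
  -- carries this inside to ζ.
  obtain ⟨N, hN⟩ := exists_nat_gt (max R (max ‖ζ‖ 0))
  have hN0 : (0 : ℝ) < N := lt_of_le_of_lt ((le_max_right _ _).trans (le_max_right _ _)) hN
  have hNR : R ≤ N := ((le_max_left _ _).trans hN.le)
  have hNζ : ‖ζ‖ < N := lt_of_le_of_lt ((le_max_left _ _).trans (le_max_right _ _)) hN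
  refine Complex.norm_le_of_forall_mem_frontier_norm_le (U := Metric.ball 0 N)
    (f := fun z => g z - c) Metric.isBounded_ball (hg.sub_const c).diffContOnCl ?_
    (subset_closure (by simpa using hNζ))
  intro z hz
  rw [frontier_ball _ hN0.ne', mem_sphere_zero_iff_norm] at hz
  have haway : ∀ x ∈ X, 1 / 2 ≤ dist z x := fun x hx => half_le_dist_of_norm_natCast hz (hX hx)
  have hzX : z ∉ X := fun h => by
    have := haway z h
    rw [dist_self] at this
    norm_num at this
  rw [hgf z hzX]
  exact (hR z (hz ▸ hNR) haway).le

end Liouville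

/-! ### Uniqueness for the discrete Riemann–Hilbert problem -/

section Uniqueness

/-- A limit at a half-integer of the form occurring for the weight matrices. -/
theorem tendsto_residue_entries {m : ℂ → Matrix (Fin 2) (Fin 2) ℂ} {w R : Matrix (Fin 2) (Fin 2) ℂ}
    {x : ℂ} (h1 : Tendsto (fun ζ => (ζ - x) • m ζ) (𝓝[≠] x) (𝓝 R))
    (h2 : Tendsto (fun ζ => m ζ * w) (𝓝[≠] x) (𝓝 R)) (i : Fin 2) (j : Fin 2) :
    Tendsto (fun ζ => (ζ - x) * m ζ i j) (𝓝[≠] x) (𝓝 (R i j)) ∧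
      Tendsto (fun ζ => m ζ i 0 * w 0 j + m ζ i 1 * w 1 j) (𝓝[≠] x) (𝓝 (R i j)) := by
  have h1' := tendsto_pi_nhds.1 (tendsto_pi_nhds.1 h1 i) j
  have h2' := tendsto_pi_nhds.1 (tendsto_pi_nhds.1 h2 i) j
  refine ⟨h1', h2'.congr fun ζ => ?_⟩
  rw [Matrix.mul_apply, Fin.sum_univ_two]

/-- The matrix `w(x)` is strictly triangular with a nonzero entry. -/
theorem jumpW_cases {θ : ℝ} (hθ : 0 < θ) (x : ℂ) :
    (∃ c : ℂ, c ≠ 0 ∧ jumpW θ x = !![0, c; 0, 0]) ∨ ∃ c : ℂ, c ≠ 0 ∧ jumpW θ x = !![0, 0; c, 0] := by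
  unfold jumpW
  split_ifs
  · exact Or.inl ⟨_, neg_ne_zero.2 (Complex.ofReal_ne_zero.2 (by positivity)), rfl⟩
  · exact Or.inr ⟨_, neg_ne_zero.2 (Complex.ofReal_ne_zero.2 (by positivity)), rfl⟩

/-- At x the singular column, multiplied by ζ - x, and c times the other column have the same limit,
for m and for n. The expression times c therefore tends to a difference of two equal products, and c
≠ 0 is divided out. -/
theorem tendsto_mul_bilinear {θ : ℝ} (hθ : 0 < θ) {m n : ℂ → Matrix (Fin 2) (Fin 2) ℂ}
    (hm : SolvesDRHP halfIntsC (jumpW θ) m) (hn : SolvesDRHP halfIntsC (jumpW θ) n) (i j : Fin 2)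
    {x : ℂ} (hx : x ∈ halfIntsC) :
    Tendsto (fun ζ => (ζ - x) * (n ζ i 0 * m ζ j 1 - n ζ i 1 * m ζ j 0)) (𝓝[≠] x) (𝓝 0) := by
  obtain ⟨R, hR1, hR2⟩ := hm.2 x hx
  obtain ⟨S, hS1, hS2⟩ := hn.2 x hx
  rcases jumpW_cases hθ x with ⟨c, hc, hw⟩ | ⟨c, hc, hw⟩
  · rw [hw] at hR2 hS2
    have a1 := (tendsto_residue_entries hR1 hR2 j 1).1
    have a2 := (tendsto_residue_entries hR1 hR2 j 1).2
    have b1 := (tendsto_residue_entries hS1 hS2 i 1).1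
    have b2 := (tendsto_residue_entries hS1 hS2 i 1).2
    have h := ((b2.mul a1).sub (b1.mul a2)).mul_const (c⁻¹)
    rw [mul_comm (S i 1), sub_self, zero_mul] at h
    refine h.congr fun ζ => ?_
    simp
    field_simp
  · rw [hw] at hR2 hS2
    have a1 := (tendsto_residue_entries hR1 hR2 j 0).1
    have a2 := (tendsto_residue_entries hR1 hR2 j 0).2
    have b1 := (tendsto_residue_entries hS1 hS2 i 0).1
    have b2 := (tendsto_residue_entries hS1 hS2 i 0).2
    have h := ((b1.mul a2).sub (b2.mul a1)).mul_const (c⁻¹)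
    rw [mul_comm (S i 0), sub_self, zero_mul] at h
    refine h.congr fun ζ => ?_
    simp
    field_simp

/-- Liouville applied to the entries of n J mᵀ, which have no poles and tend to those of J. Taking n
= m gives det m = 1; for general n the four relations then determine n. -/
theorem bilinear_eq {θ : ℝ} (hθ : 0 < θ) {m n : ℂ → Matrix (Fin 2) (Fin 2) ℂ}
    (hm : SolvesNormalizedDRHP halfIntsC (jumpW θ) m)
    (hn : SolvesNormalizedDRHP halfIntsC (jumpW θ) n) (i j : Fin 2) {ζ : ℂ} (hζ : ζ ∉ halfIntsC) :
    n ζ i 0 * m ζ j 1 - n ζ i 1 * m ζ j 0 =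
      (1 : Matrix (Fin 2) (Fin 2) ℂ) i 0 * (1 : Matrix (Fin 2) (Fin 2) ℂ) j 1 -
        (1 : Matrix (Fin 2) (Fin 2) ℂ) i 1 * (1 : Matrix (Fin 2) (Fin 2) ℂ) j 0 := by
  have hm' := fun i j => tendsto_pi_nhds.1 (tendsto_pi_nhds.1 (hm.2 (1 / 2) (by norm_num)) i) j
  have hn' := fun i j => tendsto_pi_nhds.1 (tendsto_pi_nhds.1 (hn.2 (1 / 2) (by norm_num)) i) j
  exact eq_const_of_tendsto_awayFilter (f := fun ζ => n ζ i 0 * m ζ j 1 - n ζ i 1 * m ζ j 0)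
    le_rfl (((hn.1.1 i 0).mul (hm.1.1 j 1)).sub ((hn.1.1 i 1).mul (hm.1.1 j 0)))
    (fun x hx => tendsto_mul_bilinear hθ hm.1 hn.1 i j hx)
    (((hn' i 0).mul (hm' j 1)).sub ((hn' i 1).mul (hm' j 0))) hζ

theorem det_eq_one_of_solves {θ : ℝ} (hθ : 0 < θ) {m : ℂ → Matrix (Fin 2) (Fin 2) ℂ}
    (hm : SolvesNormalizedDRHP halfIntsC (jumpW θ) m) {ζ : ℂ} (hζ : ζ ∉ halfIntsC) :
    m ζ 0 0 * m ζ 1 1 - m ζ 0 1 * m ζ 1 0 = 1 := by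
  have := bilinear_eq hθ hm hm 0 1 hζ
  simpa using this

/-- Uniqueness for the normalized discrete Riemann–Hilbert problem. -/
theorem eqOn_of_solvesNormalizedDRHP {θ : ℝ} (hθ : 0 < θ) {m n : ℂ → Matrix (Fin 2) (Fin 2) ℂ}
    (hm : SolvesNormalizedDRHP halfIntsC (jumpW θ) m)
    (hn : SolvesNormalizedDRHP halfIntsC (jumpW θ) n) : Set.EqOn n m halfIntsCᶜ := by
  intro ζ hζ
  have hdet := det_eq_one_of_solves hθ hm hζ
  have h00 := bilinear_eq hθ hm hn 0 0 hζ
  have h01 := bilinear_eq hθ hm hn 0 1 hζ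
  have h10 := bilinear_eq hθ hm hn 1 0 hζ
  have h11 := bilinear_eq hθ hm hn 1 1 hζ
  simp only [Matrix.one_apply_eq, ne_eq, zero_ne_one, one_ne_zero, not_false_eq_true,
    Matrix.one_apply_ne, mul_zero, mul_one, sub_zero, sub_self, zero_sub] at h00 h01 h10 h11
  ext i j
  fin_cases i <;> fin_cases j <;> simp only [Fin.zero_eta, Fin.mk_one]
  · linear_combination (m ζ 0 0) * h01 - (m ζ 1 0) * h00 - (n ζ 0 0) * hdet
  · linear_combination (m ζ 0 1) * h01 - (m ζ 1 1) * h00 - (n ζ 0 1) * hdet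
  · linear_combination (m ζ 0 0) * h11 - (m ζ 1 0) * h10 - (n ζ 1 0) * hdet
  · linear_combination (m ζ 0 1) * h11 - (m ζ 1 1) * h10 - (n ζ 1 1) * hdet

end Uniqueness

/-! ### The Bessel matrix solves the Riemann–Hilbert problem -/

section Existence

theorem ofReal_posHalf (a : ℕ) : (((posHalf a : HalfInts) : ℝ) : ℂ) = a + 1 / 2 := by
  rw [coe_posHalf]
  push_cast
  ring

theorem ofReal_negHalf (b : ℕ) : (((negHalf b : HalfInts) : ℝ) : ℂ) = -b - 1 / 2 := by
  rw [coe_negHalf]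
  push_cast
  ring

/-- The positive half-integers in the complex plane. -/
def posHalfC : Set ℂ := Set.range fun a : ℕ => (((posHalf a : HalfInts) : ℝ) : ℂ)

/-- The negative half-integers in the complex plane. -/
def negHalfC : Set ℂ := Set.range fun b : ℕ => (((negHalf b : HalfInts) : ℝ) : ℂ)

theorem posHalfC_subset : posHalfC ⊆ halfIntsC := by
  rintro _ ⟨a, rfl⟩
  exact mem_halfIntsC.2 ⟨_, rfl⟩

theorem negHalfC_subset : negHalfC ⊆ halfIntsC := by
  rintro _ ⟨a, rfl⟩
  exact mem_halfIntsC.2 ⟨_, rfl⟩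

theorem add_half_ne_of_notMem {ζ : ℂ} (h : ζ ∉ negHalfC) (n : ℕ) : ζ + 1 / 2 ≠ -n := fun h' =>
  h ⟨n, (ofReal_negHalf n).trans (by linear_combination -h')⟩

theorem neg_add_half_ne_of_notMem {ζ : ℂ} (h : ζ ∉ posHalfC) (n : ℕ) : -ζ + 1 / 2 ≠ -n := fun h' =>
  h ⟨n, (ofReal_posHalf n).trans (by linear_combination h')⟩

theorem tendsto_inv_norm_shift {l : Filter ℂ} (hl : Tendsto (fun ζ : ℂ => ‖ζ‖) l atTop) (C : ℝ)
    {g : ℂ → ℂ} (hg : ∀ ζ, ‖ζ‖ - 1 / 2 ≤ ‖g ζ‖) : Tendsto (fun ζ => C / ‖g ζ‖) l (𝓝 0) := by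
  have h : Tendsto (fun ζ => ‖g ζ‖) l atTop :=
    tendsto_atTop_mono hg (tendsto_atTop_add_const_right l (-(1 / 2)) hl)
  exact h.const_div_atTop C

theorem norm_sub_half_le_add (ζ : ℂ) : ‖ζ‖ - 1 / 2 ≤ ‖ζ + 1 / 2‖ := by
  have h1 := norm_sub_le (ζ + 1 / 2) (1 / 2)
  rw [add_sub_cancel_right] at h1
  have h2 : ‖(1 / 2 : ℂ)‖ = 1 / 2 := by simp
  linarith

theorem norm_sub_half_le_neg_add (ζ : ℂ) : ‖ζ‖ - 1 / 2 ≤ ‖-ζ + 1 / 2‖ := by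
  simpa using norm_sub_half_le_add (-ζ)

theorem away_neg {ζ : ℂ} {ε : ℝ} (h : ∀ x ∈ negHalfC, ε ≤ dist ζ x) (n : ℕ) :
    ε ≤ ‖ζ + 1 / 2 + n‖ := by
  have := h (((negHalf n : HalfInts) : ℝ) : ℂ) ⟨n, rfl⟩
  rw [dist_eq_norm, ofReal_negHalf] at this
  exact this.trans_eq (congrArg norm (by ring))

theorem away_pos {ζ : ℂ} {ε : ℝ} (h : ∀ x ∈ posHalfC, ε ≤ dist ζ x) (n : ℕ) :
    ε ≤ ‖-ζ + 1 / 2 + n‖ := by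
  have := h (((posHalf n : HalfInts) : ℝ) : ℂ) ⟨n, rfl⟩
  rw [dist_eq_norm, ofReal_posHalf, ← norm_neg] at this
  exact this.trans_eq (congrArg norm (by ring))

theorem eventually_away (X : Set ℂ) (ε : ℝ) :
    ∀ᶠ ζ in awayFilter X ε, ∀ x ∈ X, ε ≤ dist ζ x :=
  eventually_awayFilter.2 ⟨0, fun _ _ h => h⟩

variable (θ : ℝ) {ε : ℝ} (hε : 0 < ε)
include hε

theorem tendsto_besselH0_neg :
    Tendsto (fun ζ => besselH0 θ (ζ + 1 / 2)) (awayFilter negHalfC ε) (𝓝 1) := by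
  rw [tendsto_iff_norm_sub_tendsto_zero]
  refine squeeze_zero' (Eventually.of_forall fun _ => norm_nonneg _) ?_
    (tendsto_inv_norm_shift (tendsto_norm_awayFilter _ ε) (|θ| * Real.exp (|θ| / ε))
      norm_sub_half_le_add)
  filter_upwards [eventually_away negHalfC ε] with ζ h
  exact norm_besselH0_sub_one_le hε (away_neg h)

theorem tendsto_besselH1_neg :
    Tendsto (fun ζ => besselH1 θ (ζ + 1 / 2)) (awayFilter negHalfC ε) (𝓝 0) := by
  rw [tendsto_zero_iff_norm_tendsto_zero]
  refine squeeze_zero' (Eventually.of_forall fun _ => norm_nonneg _) ?_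
    (tendsto_inv_norm_shift (tendsto_norm_awayFilter _ ε) (Real.exp (|θ| / ε))
      norm_sub_half_le_add)
  filter_upwards [eventually_away negHalfC ε] with ζ h
  exact norm_besselH1_le hε (away_neg h)

theorem tendsto_besselH0_pos :
    Tendsto (fun ζ => besselH0 θ (-ζ + 1 / 2)) (awayFilter posHalfC ε) (𝓝 1) := by
  rw [tendsto_iff_norm_sub_tendsto_zero]
  refine squeeze_zero' (Eventually.of_forall fun _ => norm_nonneg _) ?_
    (tendsto_inv_norm_shift (tendsto_norm_awayFilter _ ε) (|θ| * Real.exp (|θ| / ε))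
      norm_sub_half_le_neg_add)
  filter_upwards [eventually_away posHalfC ε] with ζ h
  exact norm_besselH0_sub_one_le hε (away_pos h)

theorem tendsto_besselH1_pos :
    Tendsto (fun ζ => besselH1 θ (-ζ + 1 / 2)) (awayFilter posHalfC ε) (𝓝 0) := by
  rw [tendsto_zero_iff_norm_tendsto_zero]
  refine squeeze_zero' (Eventually.of_forall fun _ => norm_nonneg _) ?_
    (tendsto_inv_norm_shift (tendsto_norm_awayFilter _ ε) (Real.exp (|θ| / ε))
      norm_sub_half_le_neg_add)
  filter_upwards [eventually_away posHalfC ε] with ζ h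
  exact norm_besselH1_le hε (away_pos h)

omit hε

theorem tendsto_add_half (b : ℕ) : Tendsto (fun ζ : ℂ => ζ + 1 / 2)
    (𝓝[≠] (((negHalf b : HalfInts) : ℝ) : ℂ)) (𝓝[≠] (-b : ℂ)) := by
  refine tendsto_nhdsWithin_of_tendsto_nhds_of_eventually_within _ ?_ ?_
  · have h1 : (-b : ℂ) = (((negHalf b : HalfInts) : ℝ) : ℂ) + 1 / 2 := by
      rw [ofReal_negHalf]; ring
    rw [h1]
    exact (continuous_id.add continuous_const).continuousAt.tendsto.mono_left nhdsWithin_le_nhds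
  · filter_upwards [self_mem_nhdsWithin] with s hs h1
    apply hs
    rw [Set.mem_singleton_iff] at h1 ⊢
    rw [ofReal_negHalf]
    linear_combination h1

theorem tendsto_neg_add_half (a : ℕ) : Tendsto (fun ζ : ℂ => -ζ + 1 / 2)
    (𝓝[≠] (((posHalf a : HalfInts) : ℝ) : ℂ)) (𝓝[≠] (-a : ℂ)) := by
  refine tendsto_nhdsWithin_of_tendsto_nhds_of_eventually_within _ ?_ ?_
  · have h1 : (-a : ℂ) = -(((posHalf a : HalfInts) : ℝ) : ℂ) + 1 / 2 := by
      rw [ofReal_posHalf]; ring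
    rw [h1]
    exact (continuous_id.neg.add continuous_const).continuousAt.tendsto.mono_left nhdsWithin_le_nhds
  · filter_upwards [self_mem_nhdsWithin] with s hs h1
    apply hs
    rw [Set.mem_singleton_iff] at h1 ⊢
    rw [ofReal_posHalf]
    linear_combination -h1

/-- A function with a pole at `-b`, pulled back to the half-integer `-b - 1/2`. -/
theorem tendsto_pole_neg {H : ℂ → ℂ} {r : ℂ} {b : ℕ}
    (h : Tendsto (fun s : ℂ => (s + b) * H s) (𝓝[≠] (-b : ℂ)) (𝓝 r)) :
    Tendsto (fun ζ => (ζ - (((negHalf b : HalfInts) : ℝ) : ℂ)) * H (ζ + 1 / 2))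
      (𝓝[≠] (((negHalf b : HalfInts) : ℝ) : ℂ)) (𝓝 r) := by
  refine (h.comp (tendsto_add_half b)).congr fun ζ => ?_
  simp only [Function.comp]
  rw [ofReal_negHalf]
  ring

/-- A function with a pole at `-a`, pulled back to the half-integer `a + 1/2`. -/
theorem tendsto_pole_pos {H : ℂ → ℂ} {r : ℂ} {a : ℕ}
    (h : Tendsto (fun s : ℂ => (s + a) * H s) (𝓝[≠] (-a : ℂ)) (𝓝 r)) :
    Tendsto (fun ζ => (ζ - (((posHalf a : HalfInts) : ℝ) : ℂ)) * H (-ζ + 1 / 2))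
      (𝓝[≠] (((posHalf a : HalfInts) : ℝ) : ℂ)) (𝓝 (-r)) := by
  refine (h.comp (tendsto_neg_add_half a)).neg.congr fun ζ => ?_
  simp only [Function.comp]
  rw [ofReal_posHalf]
  ring

theorem ne_neg_natCast_succ (a n : ℕ) : (a : ℂ) + 1 ≠ -n := by
  intro h
  have : ((a + 1 + n : ℕ) : ℂ) = 0 := by push_cast; linear_combination h
  exact absurd (Nat.cast_eq_zero.1 this) (by omega)

/-- The value at a regular half-integer. -/
theorem tendsto_regular_pos {H : ℂ → ℂ} (hH : ∀ s : ℂ, (∀ n : ℕ, s ≠ -n) → DifferentiableAt ℂ H s)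
    (a : ℕ) : Tendsto (fun ζ => H (ζ + 1 / 2)) (𝓝[≠] (((posHalf a : HalfInts) : ℝ) : ℂ))
      (𝓝 (H (a + 1))) := by
  have h1 : (((posHalf a : HalfInts) : ℝ) : ℂ) + 1 / 2 = a + 1 := by rw [ofReal_posHalf]; ring
  have h2 := (hH (a + 1) (ne_neg_natCast_succ a)).continuousAt
  rw [← h1] at h2 ⊢
  exact (ContinuousAt.comp (f := fun ζ : ℂ => ζ + 1 / 2) h2 (by fun_prop)).tendsto.mono_left
    nhdsWithin_le_nhds

theorem tendsto_regular_neg {H : ℂ → ℂ} (hH : ∀ s : ℂ, (∀ n : ℕ, s ≠ -n) → DifferentiableAt ℂ H s)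
    (b : ℕ) : Tendsto (fun ζ => H (-ζ + 1 / 2)) (𝓝[≠] (((negHalf b : HalfInts) : ℝ) : ℂ))
      (𝓝 (H (b + 1))) := by
  have h1 : -(((negHalf b : HalfInts) : ℝ) : ℂ) + 1 / 2 = b + 1 := by rw [ofReal_negHalf]; ring
  have h2 := (hH (b + 1) (ne_neg_natCast_succ b)).continuousAt
  rw [← h1] at h2 ⊢
  exact (ContinuousAt.comp (f := fun ζ : ℂ => -ζ + 1 / 2) h2 (by fun_prop)).tendsto.mono_left
    nhdsWithin_le_nhds

theorem jumpW_posHalf {η θ : ℝ} (hη : 0 < η) (h : η ^ 2 = θ) (a : ℕ) :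
    jumpW θ (((posHalf a : HalfInts) : ℝ) : ℂ) =
      !![0, -((η : ℂ) * (θ : ℂ) ^ a / (a ! : ℂ) ^ 2); 0, 0] := by
  have hθ : 0 < θ := h ▸ by positivity
  have h1 : θ ^ ((a : ℝ) + 1 / 2) = η * θ ^ a := by
    rw [Real.rpow_add hθ, Real.rpow_natCast, ← Real.sqrt_eq_rpow, ← h, Real.sqrt_sq hη.le, mul_comm]
  rw [jumpW, Complex.ofReal_re, if_pos (posHalf_pos a), coe_posHalf, floor_half, h1]
  push_cast
  rfl

theorem jumpW_negHalf {η θ : ℝ} (hη : 0 < η) (h : η ^ 2 = θ) (b : ℕ) :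
    jumpW θ (((negHalf b : HalfInts) : ℝ) : ℂ) =
      !![0, 0; -((η : ℂ) * (θ : ℂ) ^ b / (b ! : ℂ) ^ 2), 0] := by
  have hθ : 0 < θ := h ▸ by positivity
  have h1 : θ ^ ((b : ℝ) + 1 / 2) = η * θ ^ b := by
    rw [Real.rpow_add hθ, Real.rpow_natCast, ← Real.sqrt_eq_rpow, ← h, Real.sqrt_sq hη.le, mul_comm]
  rw [jumpW, Complex.ofReal_re, if_neg (not_lt.2 (negHalf_neg b).le), coe_negHalf,
    show -(-(b : ℝ) - 1 / 2) = b + 1 / 2 by ring, floor_half, h1]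
  push_cast
  rfl

theorem tendsto_matrix_fin_two {l : Filter ℂ} {m : ℂ → Matrix (Fin 2) (Fin 2) ℂ}
    {a b c d : ℂ} (h00 : Tendsto (fun ζ => m ζ 0 0) l (𝓝 a))
    (h01 : Tendsto (fun ζ => m ζ 0 1) l (𝓝 b)) (h10 : Tendsto (fun ζ => m ζ 1 0) l (𝓝 c))
    (h11 : Tendsto (fun ζ => m ζ 1 1) l (𝓝 d)) : Tendsto m l (𝓝 !![a, b; c, d]) := by
  refine tendsto_pi_nhds.2 fun i => tendsto_pi_nhds.2 fun j => ?_
  fin_cases i <;> fin_cases j <;> assumption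

/-- The matrix built from Bessel functions solves the normalized problem. -/
theorem solvesNormalizedDRHP_besselM {η θ : ℝ} (hη : 0 < η) (h : η ^ 2 = θ) :
    SolvesNormalizedDRHP halfIntsC (jumpW θ) (besselM η) := by
  have hM : besselM η = fun ζ => !![besselH0 θ (ζ + 1 / 2), η * besselH1 θ (-ζ + 1 / 2);
      -(η * besselH1 θ (ζ + 1 / 2)), besselH0 θ (-ζ + 1 / 2)] := funext (besselM_eq hη h)
  have hη2 : (η : ℂ) ^ 2 = θ := by rw [← h]; push_cast; rfl
  have hd0 := fun s hs => differentiableAt_besselH0 θ (s := s) hs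
  have hd1 := fun s hs => differentiableAt_besselH1 θ (s := s) hs
  have hfac : ∀ n : ℕ, (n ! : ℂ) ≠ 0 := fun n => Nat.cast_ne_zero.2 (Nat.factorial_ne_zero n)
  refine ⟨⟨?_, ?_⟩, ?_⟩
  · intro i j ζ hζ
    refine DifferentiableAt.differentiableWithinAt ?_
    have hn := add_half_ne_of_notMem fun h' => hζ (negHalfC_subset h')
    have hp := neg_add_half_ne_of_notMem fun h' => hζ (posHalfC_subset h')
    have e1 : DifferentiableAt ℂ (fun ζ : ℂ => ζ + 1 / 2) ζ := by fun_prop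
    have e2 : DifferentiableAt ℂ (fun ζ : ℂ => -ζ + 1 / 2) ζ := by fun_prop
    rw [hM]
    fin_cases i <;> fin_cases j
    · exact DifferentiableAt.comp (f := fun ζ : ℂ => ζ + 1 / 2) ζ (hd0 _ hn) e1
    · exact (DifferentiableAt.comp (f := fun ζ : ℂ => -ζ + 1 / 2) ζ (hd1 _ hp) e2).const_mul _
    · exact ((DifferentiableAt.comp (f := fun ζ : ℂ => ζ + 1 / 2) ζ (hd1 _ hn) e1).const_mul
        (η : ℂ)).neg
    · exact DifferentiableAt.comp (f := fun ζ : ℂ => -ζ + 1 / 2) ζ (hd0 _ hp) e2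
  · intro x hx
    obtain ⟨x, rfl⟩ := mem_halfIntsC.1 hx
    rcases halfInts_cases x with ⟨a, rfl⟩ | ⟨b, rfl⟩
    · have r0 := tendsto_regular_pos hd0 a
      have r1 := tendsto_regular_pos hd1 a
      have p0 := tendsto_pole_pos (tendsto_mul_besselH0 θ a)
      have p1 := tendsto_pole_pos (tendsto_mul_besselH1 θ a)
      rw [besselH0_natCast_succ] at r0
      rw [besselH1_natCast_succ] at r1
      have hz : Tendsto (fun ζ : ℂ => ζ - (((posHalf a : HalfInts) : ℝ) : ℂ))
          (𝓝[≠] (((posHalf a : HalfInts) : ℝ) : ℂ)) (𝓝 0) := by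
        have : Tendsto (fun ζ : ℂ => ζ - (((posHalf a : HalfInts) : ℝ) : ℂ))
            (𝓝 (((posHalf a : HalfInts) : ℝ) : ℂ))
            (𝓝 ((((posHalf a : HalfInts) : ℝ) : ℂ) - (((posHalf a : HalfInts) : ℝ) : ℂ))) :=
          (continuous_id.sub continuous_const).tendsto _
        rw [sub_self] at this
        exact this.mono_left nhdsWithin_le_nhds
      -- At a positive half-integer only the second column has a pole. By J_{-n} = (-1)^n J_n its
      -- residue involves the Bessel values of the first column, and the ratio is the entry of w.
      refine ⟨!![0, -(η * ((θ : ℂ) ^ a / (a ! : ℂ) * besselC θ a));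
        0, (θ : ℂ) ^ (a + 1) / (a ! : ℂ) * besselC θ (a + 1 : ℕ)], ?_, ?_⟩
      · refine tendsto_matrix_fin_two ?_ ?_ ?_ ?_
        · simpa [hM] using hz.mul r0
        · simpa [hM, mul_left_comm] using p1.const_mul (η : ℂ)
        · simpa [hM] using (hz.mul (r1.const_mul (η : ℂ))).neg
        · simpa [hM] using p0
      · rw [jumpW_posHalf hη h]
        refine tendsto_matrix_fin_two ?_ ?_ ?_ ?_
        · simp [hM, Matrix.mul_apply]
        · have := r0.mul_const (-((η : ℂ) * (θ : ℂ) ^ a / (a ! : ℂ) ^ 2))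
          have e : (a ! : ℂ) * besselC θ a * (-((η : ℂ) * (θ : ℂ) ^ a / (a ! : ℂ) ^ 2)) =
              -(η * ((θ : ℂ) ^ a / (a ! : ℂ) * besselC θ a)) := by
            field_simp [hfac a]
          rw [e] at this
          simpa [hM, Matrix.mul_apply] using this
        · simp [hM, Matrix.mul_apply]
        · have := (r1.const_mul (η : ℂ)).neg.mul_const (-((η : ℂ) * (θ : ℂ) ^ a / (a ! : ℂ) ^ 2))
          have e : -((η : ℂ) * ((a ! : ℂ) * besselC θ (a + 1 : ℕ))) *
              (-((η : ℂ) * (θ : ℂ) ^ a / (a ! : ℂ) ^ 2)) =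
              (θ : ℂ) ^ (a + 1) / (a ! : ℂ) * besselC θ (a + 1 : ℕ) := by
            rw [pow_succ, ← hη2]
            field_simp [hfac a]
            ring
          rw [e] at this
          simpa [hM, Matrix.mul_apply] using this
    · have r0 := tendsto_regular_neg hd0 b
      have r1 := tendsto_regular_neg hd1 b
      have p0 := tendsto_pole_neg (tendsto_mul_besselH0 θ b)
      have p1 := tendsto_pole_neg (tendsto_mul_besselH1 θ b)
      rw [besselH0_natCast_succ] at r0
      rw [besselH1_natCast_succ] at r1
      have hz : Tendsto (fun ζ : ℂ => ζ - (((negHalf b : HalfInts) : ℝ) : ℂ))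
          (𝓝[≠] (((negHalf b : HalfInts) : ℝ) : ℂ)) (𝓝 0) := by
        have : Tendsto (fun ζ : ℂ => ζ - (((negHalf b : HalfInts) : ℝ) : ℂ))
            (𝓝 (((negHalf b : HalfInts) : ℝ) : ℂ))
            (𝓝 ((((negHalf b : HalfInts) : ℝ) : ℂ) - (((negHalf b : HalfInts) : ℝ) : ℂ))) :=
          (continuous_id.sub continuous_const).tendsto _
        rw [sub_self] at this
        exact this.mono_left nhdsWithin_le_nhds
      refine ⟨!![-((θ : ℂ) ^ (b + 1) / (b ! : ℂ) * besselC θ (b + 1 : ℕ)), 0;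
        -(η * ((θ : ℂ) ^ b / (b ! : ℂ) * besselC θ b)), 0], ?_, ?_⟩
      · refine tendsto_matrix_fin_two ?_ ?_ ?_ ?_
        · simpa [hM] using p0
        · simpa [hM] using hz.mul (r1.const_mul (η : ℂ))
        · simpa [hM, mul_left_comm] using (p1.const_mul (η : ℂ)).neg
        · simpa [hM] using hz.mul r0
      · rw [jumpW_negHalf hη h]
        refine tendsto_matrix_fin_two ?_ ?_ ?_ ?_
        · have := (r1.const_mul (η : ℂ)).mul_const (-((η : ℂ) * (θ : ℂ) ^ b / (b ! : ℂ) ^ 2))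
          have e : ((η : ℂ) * ((b ! : ℂ) * besselC θ (b + 1 : ℕ))) *
              (-((η : ℂ) * (θ : ℂ) ^ b / (b ! : ℂ) ^ 2)) =
              -((θ : ℂ) ^ (b + 1) / (b ! : ℂ) * besselC θ (b + 1 : ℕ)) := by
            rw [pow_succ, ← hη2]
            field_simp [hfac b]
            ring
          rw [e] at this
          simpa [hM, Matrix.mul_apply] using this
        · simp [hM, Matrix.mul_apply]
        · have := r0.mul_const (-((η : ℂ) * (θ : ℂ) ^ b / (b ! : ℂ) ^ 2))
          have e : (b ! : ℂ) * besselC θ b * (-((η : ℂ) * (θ : ℂ) ^ b / (b ! : ℂ) ^ 2)) =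
              -(η * ((θ : ℂ) ^ b / (b ! : ℂ) * besselC θ b)) := by
            field_simp [hfac b]
          rw [e] at this
          simpa [hM, Matrix.mul_apply] using this
        · simp [hM, Matrix.mul_apply]
  · intro ε hε
    change Tendsto _ (awayFilter halfIntsC ε) _
    have hneg := awayFilter_mono negHalfC_subset ε
    have hpos := awayFilter_mono posHalfC_subset ε
    rw [Matrix.one_fin_two]
    refine tendsto_matrix_fin_two ?_ ?_ ?_ ?_
    · simpa [hM] using (tendsto_besselH0_neg θ hε).mono_left hneg
    · simpa [hM] using ((tendsto_besselH1_pos θ hε).mono_left hpos).const_mul (η : ℂ)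
    · simpa [hM] using (((tendsto_besselH1_neg θ hε).mono_left hneg).const_mul (η : ℂ)).neg
    · simpa [hM] using (tendsto_besselH0_pos θ hε).mono_left hpos

end Existence

/-! ### Expansion into principal parts -/

section MittagLeffler

variable {e : ℕ → ℂ} {r : ℕ → ℂ}

/-- Indices with zero coefficient are exempt from the separation condition, so that one pole can be
deleted by setting its coefficient to 0 when the residue there is computed. -/
theorem norm_div_sub_le {ζ : ℂ} {δ : ℝ} (hδ : 0 < δ) (h : ∀ b, r b ≠ 0 → δ ≤ dist ζ (e b)) (b : ℕ) :
    ‖r b / (ζ - e b)‖ ≤ ‖r b‖ / δ := by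
  rw [norm_div]
  by_cases hb : r b = 0
  · simp [hb]
  · exact div_le_div_of_nonneg_left (norm_nonneg _) hδ ((h b hb).trans_eq (dist_eq_norm _ _))

theorem summable_div_sub (hr : Summable fun b => ‖r b‖) {ζ : ℂ} {δ : ℝ} (hδ : 0 < δ)
    (h : ∀ b, r b ≠ 0 → δ ≤ dist ζ (e b)) : Summable fun b => r b / (ζ - e b) :=
  Summable.of_norm_bounded (hr.div_const δ) (norm_div_sub_le hδ h)

theorem differentiableAt_tsum_div_sub (hr : Summable fun b => ‖r b‖) {z : ℂ} {δ : ℝ} (hδ : 0 < δ)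
    (h : ∀ b, r b ≠ 0 → δ ≤ dist z (e b)) :
    DifferentiableAt ℂ (fun ζ => ∑' b, r b / (ζ - e b)) z := by
  have hU : ∀ ζ ∈ Metric.ball z (δ / 2), ∀ b, r b ≠ 0 → δ / 2 ≤ dist ζ (e b) := by
    intro ζ hζ b hb
    have h1 := h b hb
    have h2 := dist_triangle z ζ (e b)
    have h3 : dist z ζ < δ / 2 := by rw [dist_comm]; exact Metric.mem_ball.1 hζ
    linarith
  have hd : DifferentiableOn ℂ (fun ζ => ∑' b, r b / (ζ - e b)) (Metric.ball z (δ / 2)) := by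
    refine Complex.differentiableOn_tsum_of_summable_norm (u := fun b => ‖r b‖ / (δ / 2))
      (hr.div_const _) (fun b => ?_) Metric.isOpen_ball fun b ζ hζ =>
        norm_div_sub_le (half_pos hδ) (hU ζ hζ) b
    intro ζ hζ
    by_cases hb : r b = 0
    · simp only [hb, zero_div]
      exact differentiableWithinAt_const _
    · have hne : ζ - e b ≠ 0 := by
        intro h0
        have := hU ζ hζ b hb
        rw [dist_eq_norm, h0, norm_zero] at this
        linarith
      have h1 : DifferentiableAt ℂ (fun w : ℂ => w - e b) ζ := differentiableAt_id.sub_const _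
      exact ((differentiableAt_const (r b)).fun_div h1 hne).differentiableWithinAt
  exact hd.differentiableAt (Metric.ball_mem_nhds z (half_pos hδ))

theorem tendsto_mul_tsum_div_sub (he : Function.Injective e) (heX : Set.range e ⊆ halfIntsC)
    (hr : Summable fun b => ‖r b‖) (b : ℕ) :
    Tendsto (fun ζ => (ζ - e b) * ∑' c, r c / (ζ - e c)) (𝓝[≠] e b) (𝓝 (r b)) := by
  have hsep : ∀ c, c ≠ b → 1 ≤ dist (e b) (e c) := fun c hc =>
    one_le_dist_halfIntsC (heX ⟨b, rfl⟩) (heX ⟨c, rfl⟩) fun h => hc (he h).symm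
  let r' : ℕ → ℂ := fun c => if c = b then 0 else r c
  have hr' : Summable fun c => ‖r' c‖ := by
    refine Summable.of_nonneg_of_le (fun _ => norm_nonneg _) (fun c => ?_) hr
    simp only [r']
    split_ifs <;> simp
  have hr'b : ∀ c, r' c ≠ 0 → 1 ≤ dist (e b) (e c) := fun c hc => hsep c fun h => hc (if_pos h)
  have hS := (differentiableAt_tsum_div_sub hr' one_pos hr'b).continuousAt.tendsto
  have hz : Tendsto (fun ζ : ℂ => ζ - e b) (𝓝 (e b)) (𝓝 (e b - e b)) :=
    (continuous_id.sub continuous_const).tendsto _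
  have h := ((hz.mul hS).const_add (r b)).mono_left (nhdsWithin_le_nhds (s := {e b}ᶜ))
  rw [sub_self, zero_mul, add_zero] at h
  refine h.congr' ?_
  have hball : Metric.ball (e b) (1 / 2) ∈ 𝓝[≠] e b :=
    mem_nhdsWithin_of_mem_nhds (Metric.ball_mem_nhds _ (by norm_num))
  filter_upwards [self_mem_nhdsWithin, hball] with ζ hζ hζb
  have hne : ζ - e b ≠ 0 := sub_ne_zero.2 hζ
  have hfar : ∀ c, c ≠ b → 1 / 2 ≤ dist ζ (e c) := by
    intro c hc
    have h1 := hsep c hc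
    have h2 := dist_triangle (e b) ζ (e c)
    have h3 : dist (e b) ζ < 1 / 2 := by rw [dist_comm]; exact Metric.mem_ball.1 hζb
    linarith
  have hsum : Summable fun c => r c / (ζ - e c) := by
    have h0 : 0 < min (1 / 2) (dist ζ (e b)) := lt_min (by norm_num) (dist_pos.2 hζ)
    refine summable_div_sub hr h0 fun c _ => ?_
    by_cases hc : c = b
    · rw [hc]; exact min_le_right _ _
    · exact (min_le_left _ _).trans (hfar c hc)
  rw [hsum.tsum_eq_add_tsum_ite b, mul_add, mul_div_cancel₀ _ hne]
  congr 2
  refine tsum_congr fun c => ?_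
  simp only [r']
  split_ifs <;> simp

theorem tendsto_tsum_div_sub_away (hr : Summable fun b => ‖r b‖) :
    Tendsto (fun ζ => ∑' b, r b / (ζ - e b)) (awayFilter (Set.range e) (1 / 2)) (𝓝 0) := by
  have h0 : ∑' _ : ℕ, (0 : ℂ) = 0 := tsum_zero
  rw [← h0]
  refine tendsto_tsum_of_dominated_convergence (bound := fun b => ‖r b‖ / (1 / 2))
    (hr.div_const _) (fun b => ?_) ?_
  · have h1 : Tendsto (fun ζ : ℂ => ‖ζ‖ + -‖e b‖) (awayFilter (Set.range e) (1 / 2)) atTop :=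
      tendsto_atTop_add_const_right _ _ (tendsto_norm_awayFilter _ _)
    have h2 : Tendsto (fun ζ : ℂ => ‖ζ - e b‖) (awayFilter (Set.range e) (1 / 2)) atTop := by
      refine tendsto_atTop_mono (fun ζ => ?_) h1
      have := norm_sub_norm_le ζ (e b)
      linarith
    rw [tendsto_zero_iff_norm_tendsto_zero]
    simp only [norm_div]
    exact h2.const_div_atTop _
  · filter_upwards [eventually_away (Set.range e) (1 / 2)] with ζ hζ b
    exact norm_div_sub_le (by norm_num) (fun b _ => hζ _ ⟨b, rfl⟩) b

/-- A function analytic off a set of half-integers, with simple poles there whose residues are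
summable, and vanishing at infinity is the sum of its principal parts. -/
theorem eq_tsum_div_sub (he : Function.Injective e) (heX : Set.range e ⊆ halfIntsC)
    (hr : Summable fun b => ‖r b‖) {f : ℂ → ℂ} (hd : DifferentiableOn ℂ f (Set.range e)ᶜ)
    (hres : ∀ b, Tendsto (fun ζ => (ζ - e b) * f ζ) (𝓝[≠] e b) (𝓝 (r b)))
    (hlim : Tendsto f (awayFilter (Set.range e) (1 / 2)) (𝓝 0)) {ζ : ℂ} (hζ : ζ ∉ Set.range e) :
    f ζ = ∑' b, r b / (ζ - e b) := by
  rw [← sub_eq_zero]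
  refine eq_const_of_tendsto_awayFilter heX (f := fun ζ => f ζ - ∑' b, r b / (ζ - e b))
    (hd.sub fun z hz => ?_) ?_ ?_ hζ
  · obtain ⟨δ, hδ, hb⟩ := Metric.isOpen_iff.1 (isClosed_of_subset_halfIntsC heX).isOpen_compl z hz
    refine (differentiableAt_tsum_div_sub hr hδ fun b _ => ?_).differentiableWithinAt
    by_contra! hlt
    exact hb (Metric.mem_ball'.2 hlt) ⟨b, rfl⟩
  · rintro _ ⟨b, rfl⟩
    have h := (hres b).sub (tendsto_mul_tsum_div_sub he heX hr b)
    rw [sub_self] at h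
    exact h.congr fun ζ => (mul_sub _ _ _).symm
  · have h := hlim.sub (tendsto_tsum_div_sub_away (e := e) hr)
    rwa [sub_zero] at h

end MittagLeffler

/-! ### Values of p at half-integers -/

section HalfIntegerValues

variable {η θ : ℝ} (hη : 0 < η) (h : η ^ 2 = θ)
include hη h

theorem ofReal_halfWeight (a : ℕ) :
    (halfWeight θ a : ℂ) = (η : ℂ) ^ ((a : ℂ) + 1 / 2) / (a ! : ℂ) := by
  have h1 : θ ^ (((a : ℝ) + 1 / 2) / 2) = η ^ ((a : ℝ) + 1 / 2) := by
    rw [← h, ← Real.rpow_natCast, ← Real.rpow_mul hη.le]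
    congr 1
    push_cast
    ring
  rw [halfWeight, h1]
  push_cast
  rw [Complex.ofReal_cpow hη.le]
  push_cast
  rfl

/-- The reflection J_{-n} = (-1)^n J_n with the powers of η restored. It is used with ν = 1/2, which
accounts for the factor √η of p. -/
theorem cpow_mul_besselC_neg (n : ℕ) (ν : ℂ) :
    (η : ℂ) ^ (ν - n) * besselC θ (-n) = (-1) ^ n * ((η : ℂ) ^ (ν + n) * besselC θ n) := by
  have hη' : (η : ℂ) ≠ 0 := Complex.ofReal_ne_zero.2 hη.ne'
  have hp : (η : ℂ) ^ n ≠ 0 := pow_ne_zero _ hη'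
  have h2 : (θ : ℂ) = (η : ℂ) ^ 2 := by rw [← h]; push_cast; rfl
  rw [besselC_neg_natCast, Complex.cpow_sub _ _ hη', Complex.cpow_add _ _ hη',
    Complex.cpow_natCast, neg_pow, h2]
  field_simp
  ring

theorem besselP_posHalf_zero (a : ℕ) :
    besselP η (((posHalf a : HalfInts) : ℝ) : ℂ) 0 0 = (η : ℂ) ^ ((a : ℂ) + 1 / 2) * besselC θ a := by
  rw [ofReal_posHalf, besselP_zero_zero hη h, add_sub_cancel_right]

theorem besselP_posHalf_one (a : ℕ) :
    besselP η (((posHalf a : HalfInts) : ℝ) : ℂ) 1 0 =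
      -((η : ℂ) ^ (((a + 1 : ℕ) : ℂ) + 1 / 2) * besselC θ (a + 1 : ℕ)) := by
  have e1 : (1 : ℂ) + (a + 1 / 2) = ((a + 1 : ℕ) : ℂ) + 1 / 2 := by push_cast; ring
  have e2 : (a : ℂ) + 1 / 2 + 1 / 2 = ((a + 1 : ℕ) : ℂ) := by push_cast; ring
  rw [ofReal_posHalf, besselP_one_zero hη h, e1, e2]

theorem besselP_negHalf_zero (b : ℕ) :
    besselP η (((negHalf b : HalfInts) : ℝ) : ℂ) 0 1 =
      (η : ℂ) ^ (((b + 1 : ℕ) : ℂ) + 1 / 2) * besselC θ (b + 1 : ℕ) := by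
  have e1 : (1 : ℂ) - (-b - 1 / 2) = ((b + 1 : ℕ) : ℂ) + 1 / 2 := by push_cast; ring
  have e2 : (1 : ℂ) / 2 - (-b - 1 / 2) = ((b + 1 : ℕ) : ℂ) := by push_cast; ring
  rw [ofReal_negHalf, besselP_zero_one hη h, e1, e2]

theorem besselP_negHalf_one (b : ℕ) :
    besselP η (((negHalf b : HalfInts) : ℝ) : ℂ) 1 1 =
      (η : ℂ) ^ ((b : ℂ) + 1 / 2) * besselC θ b := by
  have e1 : -(-(b : ℂ) - 1 / 2) = b + 1 / 2 := by ring
  rw [ofReal_negHalf, besselP_one_one hη h, e1, add_sub_cancel_right]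

/-- At positive half-integers the columns of `p` are proportional. -/
theorem besselP_posHalf_col (a : ℕ) (i : Fin 2) :
    besselP η (((posHalf a : HalfInts) : ℝ) : ℂ) i 1 =
      (-1) ^ a * besselP η (((posHalf a : HalfInts) : ℝ) : ℂ) i 0 := by
  fin_cases i <;> simp only [Fin.zero_eta, Fin.mk_one]
  · have e1 : (1 : ℂ) - (a + 1 / 2) = 1 / 2 - a := by ring
    have e2 : (1 : ℂ) / 2 - (a + 1 / 2) = -a := by ring
    rw [besselP_posHalf_zero hη h, ofReal_posHalf, besselP_zero_one hη h, e1, e2,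
      cpow_mul_besselC_neg hη h, add_comm (a : ℂ)]
  · have e1 : -((a : ℂ) + 1 / 2) = 1 / 2 - ((a + 1 : ℕ) : ℂ) := by push_cast; ring
    have e2 : 1 / 2 - ((a + 1 : ℕ) : ℂ) - 1 / 2 = -((a + 1 : ℕ) : ℂ) := by ring
    rw [besselP_posHalf_one hη h, ofReal_posHalf, besselP_one_one hη h, e1, e2,
      cpow_mul_besselC_neg hη h, add_comm (((a + 1 : ℕ) : ℂ)), pow_succ]
    ring

/-- At negative half-integers the columns of `p` are proportional. -/
theorem besselP_negHalf_col (b : ℕ) (i : Fin 2) :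
    besselP η (((negHalf b : HalfInts) : ℝ) : ℂ) i 0 =
      (-1) ^ (b + 1) * besselP η (((negHalf b : HalfInts) : ℝ) : ℂ) i 1 := by
  fin_cases i <;> simp only [Fin.zero_eta, Fin.mk_one]
  · have e1 : -(b : ℂ) - 1 / 2 = 1 / 2 - ((b + 1 : ℕ) : ℂ) := by push_cast; ring
    have e2 : 1 / 2 - ((b + 1 : ℕ) : ℂ) - 1 / 2 = -((b + 1 : ℕ) : ℂ) := by ring
    rw [besselP_negHalf_zero hη h, ofReal_negHalf, besselP_zero_zero hη h, e1, e2,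
      cpow_mul_besselC_neg hη h, add_comm (((b + 1 : ℕ) : ℂ))]
  · have e1 : (1 : ℂ) + (-b - 1 / 2) = 1 / 2 - b := by ring
    have e2 : -(b : ℂ) - 1 / 2 + 1 / 2 = -b := by ring
    rw [besselP_negHalf_one hη h, ofReal_negHalf, besselP_one_zero hη h, e1, e2,
      cpow_mul_besselC_neg hη h, add_comm (b : ℂ), pow_succ]
    ring

end HalfIntegerValues

/-! ### The determinant of p -/

section Determinant

theorem complex_cos_natCast_mul_pi (n : ℕ) : Complex.cos (n * Real.pi) = (-1) ^ n := by
  exact_mod_cast congrArg Complex.ofReal (Real.cos_nat_mul_pi n)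

theorem besselM_apply_zero (η : ℝ) (ζ : ℂ) (i : Fin 2) :
    besselM η ζ i 0 = besselP η ζ i 0 * ((η : ℂ) ^ (-ζ) * Complex.Gamma (ζ + 1 / 2)) := by
  simp [besselM, Matrix.mul_apply]

theorem besselM_apply_one (η : ℝ) (ζ : ℂ) (i : Fin 2) :
    besselM η ζ i 1 = besselP η ζ i 1 * ((η : ℂ) ^ ζ * Complex.Gamma (-ζ + 1 / 2)) := by
  simp [besselM, Matrix.mul_apply]

theorem countable_halfIntsC : halfIntsC.Countable :=
  (Set.countable_coe_iff.1 countable_halfInts).image _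

variable {η θ : ℝ} (hη : 0 < η) (h : η ^ 2 = θ)
include hη h

/-- Since det m = 1, det p is the reciprocal of Γ(ζ + 1/2) Γ(1/2 - ζ), which the reflection formula
evaluates. Continuity extends the identity to the half-integers. -/
theorem det_besselP (ζ : ℂ) :
    besselP η ζ 0 0 * besselP η ζ 1 1 - besselP η ζ 0 1 * besselP η ζ 1 0 =
      Complex.sin (Real.pi * (ζ + 1 / 2)) / Real.pi := by
  have hθ : 0 < θ := h ▸ by positivity
  have hP := fun i j => (differentiable_besselP hη h i j).continuous
  refine congrFun (Continuous.ext_on (countable_halfIntsC.dense_compl ℝ)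
    (f := fun ζ => besselP η ζ 0 0 * besselP η ζ 1 1 - besselP η ζ 0 1 * besselP η ζ 1 0)
    (g := fun ζ => Complex.sin (Real.pi * (ζ + 1 / 2)) / Real.pi)
    (((hP 0 0).mul (hP 1 1)).sub ((hP 0 1).mul (hP 1 0))) (by fun_prop) fun z hz => ?_) ζ
  have hdet := det_eq_one_of_solves hθ (solvesNormalizedDRHP_besselM hη h) hz
  simp only [besselM_apply_zero, besselM_apply_one] at hdet
  have hG := Complex.Gamma_mul_Gamma_one_sub (z + 1 / 2)
  have e1 : (1 : ℂ) - (z + 1 / 2) = -z + 1 / 2 := by ring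
  rw [e1] at hG
  have hη' : (η : ℂ) ≠ 0 := Complex.ofReal_ne_zero.2 hη.ne'
  have e2 : (η : ℂ) ^ (-z) * (η : ℂ) ^ z = 1 := by
    rw [← Complex.cpow_add _ _ hη', neg_add_cancel, Complex.cpow_zero]
  have key : (besselP η z 0 0 * besselP η z 1 1 - besselP η z 0 1 * besselP η z 1 0) *
      (Real.pi / Complex.sin (Real.pi * (z + 1 / 2))) = 1 := by
    rw [← hG]
    linear_combination hdet - (besselP η z 0 0 * besselP η z 1 1 -
      besselP η z 0 1 * besselP η z 1 0) * (Complex.Gamma (z + 1 / 2) *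
        Complex.Gamma (-z + 1 / 2)) * e2
  change _ - _ = _
  have h0 := right_ne_zero_of_mul_eq_one key
  rw [eq_inv_of_mul_eq_one_left key, inv_div]

theorem hasDerivAt_besselP (i j : Fin 2) (ζ : ℂ) :
    HasDerivAt (fun ζ => besselP η ζ i j) (deriv (fun ζ => besselP η ζ i j) ζ) ζ :=
  (differentiable_besselP hη h i j ζ).hasDerivAt

/-- At half-integers the right-hand side is ±1. There the columns of p are proportional, but their
derivatives are not in the same ratio; this measures the discrepancy. -/
theorem deriv_det_besselP (ζ : ℂ) :
    deriv (fun ζ => besselP η ζ 0 0) ζ * besselP η ζ 1 1 +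
        besselP η ζ 0 0 * deriv (fun ζ => besselP η ζ 1 1) ζ -
      (deriv (fun ζ => besselP η ζ 0 1) ζ * besselP η ζ 1 0 +
        besselP η ζ 0 1 * deriv (fun ζ => besselP η ζ 1 0) ζ) =
      Complex.cos (Real.pi * (ζ + 1 / 2)) := by
  have hd := hasDerivAt_besselP hη h
  have h1 := ((hd 0 0 ζ).mul (hd 1 1 ζ)).sub ((hd 0 1 ζ).mul (hd 1 0 ζ))
  have hπ : (Real.pi : ℂ) ≠ 0 := Complex.ofReal_ne_zero.2 Real.pi_ne_zero
  have h2 : HasDerivAt (fun ζ : ℂ => Complex.sin (Real.pi * (ζ + 1 / 2)) / Real.pi)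
      (Complex.cos (Real.pi * (ζ + 1 / 2)) * (Real.pi * 1) / Real.pi) ζ :=
    ((((hasDerivAt_id ζ).add_const (1 / 2 : ℂ)).const_mul (Real.pi : ℂ)).csin).div_const _
  rw [mul_one, mul_div_assoc, div_self hπ, mul_one] at h2
  refine h1.unique (h2.congr_of_eventuallyEq (Eventually.of_forall fun z => ?_))
  exact det_besselP hη h z

end Determinant

/-! ### The kernel as an entire function of its first variable -/

section Kernel

/-- The numerator of the kernel, as a function of the first variable on a fixed column of `p`. -/
def kernelNum (η : ℝ) (y : HalfInts) (j : Fin 2) (ζ : ℂ) : ℂ :=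
  besselP η ζ 0 j * kernelG1 η y + besselP η ζ 1 j * kernelG2 η y

/-- The kernel, as an entire function of the first variable on a fixed column of `p`. -/
def kernelFun (η : ℝ) (y : HalfInts) (j : Fin 2) : ℂ → ℂ :=
  dslope (kernelNum η y j) ((y : ℝ) : ℂ)

theorem colIdx_posHalf (a : ℕ) : colIdx (posHalf a) = 0 := if_pos (posHalf_pos a)

theorem colIdx_negHalf (b : ℕ) : colIdx (negHalf b) = 1 := if_neg (negHalf_neg b).le.not_gt

theorem kernelG1_posHalf (η : ℝ) (a : ℕ) :
    kernelG1 η (posHalf a) = -besselP η (((posHalf a : HalfInts) : ℝ) : ℂ) 1 0 :=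
  if_pos (posHalf_pos a)

theorem kernelG2_posHalf (η : ℝ) (a : ℕ) :
    kernelG2 η (posHalf a) = besselP η (((posHalf a : HalfInts) : ℝ) : ℂ) 0 0 :=
  if_pos (posHalf_pos a)

theorem kernelG1_negHalf (η : ℝ) (b : ℕ) :
    kernelG1 η (negHalf b) = besselP η (((negHalf b : HalfInts) : ℝ) : ℂ) 1 1 :=
  if_neg (negHalf_neg b).le.not_gt

theorem kernelG2_negHalf (η : ℝ) (b : ℕ) :
    kernelG2 η (negHalf b) = -besselP η (((negHalf b : HalfInts) : ℝ) : ℂ) 0 1 :=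
  if_neg (negHalf_neg b).le.not_gt

/-- The numerator of the kernel vanishes on the diagonal. -/
theorem kernelF_mul_kernelG (η : ℝ) (x : HalfInts) :
    kernelF1 η x * kernelG1 η x + kernelF2 η x * kernelG2 η x = 0 := by
  rcases halfInts_cases x with ⟨a, rfl⟩ | ⟨b, rfl⟩
  · rw [kernelF1, kernelF2, colIdx_posHalf, kernelG1_posHalf, kernelG2_posHalf]
    ring
  · rw [kernelF1, kernelF2, colIdx_negHalf, kernelG1_negHalf, kernelG2_negHalf]
    ring

variable {η θ : ℝ} (hη : 0 < η) (h : η ^ 2 = θ)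
include hη h

theorem hasDerivAt_kernelNum (y : HalfInts) (j : Fin 2) (ζ : ℂ) :
    HasDerivAt (kernelNum η y j) (deriv (fun ζ => besselP η ζ 0 j) ζ * kernelG1 η y +
      deriv (fun ζ => besselP η ζ 1 j) ζ * kernelG2 η y) ζ :=
  ((hasDerivAt_besselP hη h 0 j ζ).mul_const _).add ((hasDerivAt_besselP hη h 1 j ζ).mul_const _)

theorem kernelNum_posHalf (y : HalfInts) (a : ℕ) :
    kernelNum η y 1 (((posHalf a : HalfInts) : ℝ) : ℂ) =
      (-1) ^ a * kernelNum η y 0 (((posHalf a : HalfInts) : ℝ) : ℂ) := by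
  rw [kernelNum, besselP_posHalf_col hη h, besselP_posHalf_col hη h, kernelNum]
  ring

theorem kernelNum_negHalf (y : HalfInts) (b : ℕ) :
    kernelNum η y 0 (((negHalf b : HalfInts) : ℝ) : ℂ) =
      (-1) ^ (b + 1) * kernelNum η y 1 (((negHalf b : HalfInts) : ℝ) : ℂ) := by
  rw [kernelNum, besselP_negHalf_col hη h, besselP_negHalf_col hη h, kernelNum]
  ring

/-- Both columns are needed: the residues of the kernel involve the column not selected by `colIdx`,
which vanishes at y by proportionality. -/
theorem kernelNum_self (y : HalfInts) (j : Fin 2) : kernelNum η y j ((y : ℝ) : ℂ) = 0 := by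
  have h0 := kernelF_mul_kernelG η y
  rcases halfInts_cases y with ⟨a, rfl⟩ | ⟨b, rfl⟩
  · rw [kernelF1, kernelF2, colIdx_posHalf] at h0
    fin_cases j <;> simp only [Fin.zero_eta, Fin.mk_one]
    · exact h0
    · rw [kernelNum_posHalf hη h, kernelNum, h0, mul_zero]
  · rw [kernelF1, kernelF2, colIdx_negHalf] at h0
    fin_cases j <;> simp only [Fin.zero_eta, Fin.mk_one]
    · rw [kernelNum_negHalf hη h, kernelNum, h0, mul_zero]
    · exact h0

theorem kernelFun_of_ne (y : HalfInts) (j : Fin 2) {ζ : ℂ} (hζ : ζ ≠ ((y : ℝ) : ℂ)) :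
    kernelFun η y j ζ = kernelNum η y j ζ / (ζ - ((y : ℝ) : ℂ)) := by
  rw [kernelFun, dslope_of_ne _ hζ, slope_def_field, kernelNum_self hη h, sub_zero]

theorem kernelFun_self (y : HalfInts) (j : Fin 2) :
    kernelFun η y j ((y : ℝ) : ℂ) = deriv (fun ζ => besselP η ζ 0 j) ((y : ℝ) : ℂ) * kernelG1 η y +
      deriv (fun ζ => besselP η ζ 1 j) ((y : ℝ) : ℂ) * kernelG2 η y := by
  rw [kernelFun, dslope_same, (hasDerivAt_kernelNum hη h y j _).deriv]

theorem differentiable_kernelFun (y : HalfInts) (j : Fin 2) :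
    Differentiable ℂ (kernelFun η y j) := by
  rw [← differentiableOn_univ]
  refine (Complex.differentiableOn_dslope univ_mem).2 fun ζ _ => ?_
  exact (hasDerivAt_kernelNum hη h y j ζ).differentiableAt.differentiableWithinAt

theorem discreteBesselKernel_eq (x y : HalfInts) :
    discreteBesselKernel η x y = kernelFun η y (colIdx x) ((x : ℝ) : ℂ) := by
  rw [discreteBesselKernel]
  split_ifs with hxy
  · subst hxy
    rw [kernelFun_self hη h]
    rfl
  · rw [kernelFun_of_ne hη h _ _ fun h' => hxy (Subtype.ext (Complex.ofReal_injective h'))]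
    rfl

/-- Off the diagonal this is proportionality of the columns. At ζ = y the value is a combination of
derivatives, and `deriv_det_besselP` supplies the defect 1. This delta is what produces the
right-hand side of K + LK = L. -/
theorem kernelFun_one_posHalf (a : ℕ) (y : HalfInts) :
    kernelFun η y 1 (((posHalf a : HalfInts) : ℝ) : ℂ) =
      (-1) ^ a * (discreteBesselKernel η (posHalf a) y - if posHalf a = y then 1 else 0) := by
  rw [discreteBesselKernel_eq hη h, colIdx_posHalf]
  split_ifs with hy
  · subst hy
    rw [kernelFun_self hη h, kernelFun_self hη h, kernelG1_posHalf, kernelG2_posHalf]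
    have hdet := deriv_det_besselP hη h (((posHalf a : HalfInts) : ℝ) : ℂ)
    have hcos : Complex.cos (Real.pi * ((((posHalf a : HalfInts) : ℝ) : ℂ) + 1 / 2)) =
        -(-1) ^ a := by
      have := complex_cos_natCast_mul_pi (a + 1)
      rw [pow_succ] at this
      rw [ofReal_posHalf, ← mul_neg_one, ← this]
      congr 1
      push_cast
      ring
    rw [hcos, besselP_posHalf_col hη h, besselP_posHalf_col hη h] at hdet
    linear_combination hdet
  · have hne : (((posHalf a : HalfInts) : ℝ) : ℂ) ≠ ((y : ℝ) : ℂ) := fun h' =>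
      hy (Subtype.ext (Complex.ofReal_injective h'))
    rw [kernelFun_of_ne hη h _ _ hne, kernelFun_of_ne hη h _ _ hne, kernelNum_posHalf hη h]
    ring

theorem kernelFun_zero_negHalf (b : ℕ) (y : HalfInts) :
    kernelFun η y 0 (((negHalf b : HalfInts) : ℝ) : ℂ) =
      (-1) ^ (b + 1) * (discreteBesselKernel η (negHalf b) y - if negHalf b = y then 1 else 0) := by
  rw [discreteBesselKernel_eq hη h, colIdx_negHalf]
  split_ifs with hy
  · subst hy
    rw [kernelFun_self hη h, kernelFun_self hη h, kernelG1_negHalf, kernelG2_negHalf]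
    have hdet := deriv_det_besselP hη h (((negHalf b : HalfInts) : ℝ) : ℂ)
    have hcos : Complex.cos (Real.pi * ((((negHalf b : HalfInts) : ℝ) : ℂ) + 1 / 2)) =
        (-1) ^ b := by
      rw [ofReal_negHalf, ← complex_cos_natCast_mul_pi b, ← Complex.cos_neg]
      congr 1
      ring
    rw [hcos, besselP_negHalf_col hη h, besselP_negHalf_col hη h] at hdet
    rw [pow_succ] at hdet ⊢
    linear_combination hdet
  · have hne : (((negHalf b : HalfInts) : ℝ) : ℂ) ≠ ((y : ℝ) : ℂ) := fun h' =>
      hy (Subtype.ext (Complex.ofReal_injective h'))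
    rw [kernelFun_of_ne hη h _ _ hne, kernelFun_of_ne hη h _ _ hne, kernelNum_negHalf hη h]
    ring

end Kernel

/-! ### Summability of L and of the columns of K -/

section Summability

theorem summable_halfInts {f : HalfInts → ℝ} (hp : Summable fun a => f (posHalf a))
    (hn : Summable fun b => f (negHalf b)) : Summable f :=
  halfEquiv.summable_iff.1 (HasSum.sum (f := f ∘ halfEquiv) hp.hasSum hn.hasSum).summable

theorem halfWeight_nonneg {θ : ℝ} (hθ : 0 < θ) (a : ℕ) : 0 ≤ halfWeight θ a := by
  unfold halfWeight
  positivity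

theorem summable_halfWeight {θ : ℝ} (hθ : 0 < θ) : Summable (halfWeight θ) := by
  have h1 : ∀ a : ℕ, halfWeight θ a = θ ^ (1 / 4 : ℝ) * ((θ ^ (1 / 2 : ℝ)) ^ a / a !) := by
    intro a
    rw [halfWeight, ← Real.rpow_natCast, ← Real.rpow_mul hθ.le, ← mul_div_assoc,
      ← Real.rpow_add hθ]
    congr 2
    ring
  rw [funext h1]
  exact (Real.summable_pow_div_factorial _).mul_left _

/-- The weights `h` on both halves of the half-integers. -/
def halfIntWeight (θ : ℝ) (x : HalfInts) : ℝ := halfWeight θ ⌊|(x : ℝ)| - 1 / 2⌋₊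

theorem halfIntWeight_posHalf (θ : ℝ) (a : ℕ) : halfIntWeight θ (posHalf a) = halfWeight θ a := by
  rw [halfIntWeight, abs_posHalf, floor_half]

theorem halfIntWeight_negHalf (θ : ℝ) (a : ℕ) : halfIntWeight θ (negHalf a) = halfWeight θ a := by
  rw [halfIntWeight, abs_negHalf, floor_half]

theorem abs_kernelL_le {θ : ℝ} (hθ : 0 < θ) (x y : HalfInts) :
    |kernelL θ x y| ≤ halfIntWeight θ x * halfIntWeight θ y := by
  have hw := halfWeight_nonneg hθ
  have key : ∀ a b : ℕ, |halfWeight θ a * halfWeight θ b / ((a : ℝ) + b + 1)| ≤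
      halfWeight θ a * halfWeight θ b := by
    intro a b
    rw [abs_of_nonneg (div_nonneg (mul_nonneg (hw a) (hw b)) (by positivity))]
    refine div_le_self (mul_nonneg (hw a) (hw b)) ?_
    have : (0 : ℝ) ≤ (a : ℝ) + b := by positivity
    linarith
  rcases halfInts_cases x with ⟨a, rfl⟩ | ⟨a, rfl⟩ <;> rcases halfInts_cases y with ⟨b, rfl⟩ | ⟨b, rfl⟩ <;>
    simp only [halfIntWeight_posHalf, halfIntWeight_negHalf]
  · rw [kernelL_pos_pos, abs_zero]
    exact mul_nonneg (hw a) (hw b)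
  · rw [kernelL_pos_neg hθ]
    exact key a b
  · rw [kernelL_neg_pos hθ, abs_neg, mul_comm (halfWeight θ a)]
    exact key b a
  · rw [kernelL_neg_neg, abs_zero]
    exact mul_nonneg (hw a) (hw b)

theorem summable_kernelL {θ : ℝ} (hθ : 0 < θ) :
    Summable fun q : HalfInts × HalfInts => |kernelL θ q.1 q.2| := by
  have hs : Summable (halfIntWeight θ) := by
    refine summable_halfInts ?_ ?_
    · simpa only [halfIntWeight_posHalf] using summable_halfWeight hθ
    · simpa only [halfIntWeight_negHalf] using summable_halfWeight hθ
  have h0 : 0 ≤ halfIntWeight θ := fun x => halfWeight_nonneg hθ _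
  exact Summable.of_nonneg_of_le (fun _ => abs_nonneg _) (fun q => abs_kernelL_le hθ q.1 q.2)
    (hs.mul_of_nonneg hs h0 h0)

variable {η θ : ℝ} (hη : 0 < η) (h : η ^ 2 = θ)
include hη h

theorem norm_cpow_mul_besselC_le (n : ℕ) :
    ‖(η : ℂ) ^ ((n : ℂ) + 1 / 2) * besselC θ n‖ ≤ halfWeight θ n * Real.exp |θ| := by
  have hθ : 0 < θ := h ▸ by positivity
  have h1 : halfWeight θ n = ‖(η : ℂ) ^ ((n : ℂ) + 1 / 2)‖ / n ! := by
    rw [← Complex.norm_natCast, ← norm_div, ← ofReal_halfWeight hη h, Complex.norm_real,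
      Real.norm_of_nonneg (halfWeight_nonneg hθ n)]
  rw [norm_mul, h1]
  calc _ ≤ ‖(η : ℂ) ^ ((n : ℂ) + 1 / 2)‖ * (Real.exp |θ| / n !) :=
        mul_le_mul_of_nonneg_left (norm_besselC_natCast_le θ n) (norm_nonneg _)
    _ = _ := by ring

theorem summable_norm_cpow_mul_besselC :
    Summable fun n : ℕ => ‖(η : ℂ) ^ ((n : ℂ) + 1 / 2) * besselC θ n‖ := by
  have hθ : 0 < θ := h ▸ by positivity
  exact Summable.of_nonneg_of_le (fun _ => norm_nonneg _) (norm_cpow_mul_besselC_le hη h)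
    ((summable_halfWeight hθ).mul_right _)

theorem summable_norm_kernelF1 : Summable fun x => ‖kernelF1 η x‖ := by
  have hs := summable_norm_cpow_mul_besselC hη h
  refine summable_halfInts ?_ ?_
  · simpa only [kernelF1, colIdx_posHalf, besselP_posHalf_zero hη h] using hs
  · simpa only [kernelF1, colIdx_negHalf, besselP_negHalf_zero hη h] using
      (summable_nat_add_iff 1).2 hs

theorem summable_norm_kernelF2 : Summable fun x => ‖kernelF2 η x‖ := by
  have hs := summable_norm_cpow_mul_besselC hη h
  refine summable_halfInts ?_ ?_
  · simpa only [kernelF2, colIdx_posHalf, besselP_posHalf_one hη h, norm_neg] using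
      (summable_nat_add_iff 1).2 hs
  · simpa only [kernelF2, colIdx_negHalf, besselP_negHalf_one hη h] using hs

/-- Distinct half-integers are at distance at least 1, so off the diagonal the kernel is dominated
by its numerator; the diagonal entry is a single extra term. -/
theorem summable_norm_discreteBesselKernel (y : HalfInts) :
    Summable fun x => ‖discreteBesselKernel η x y‖ := by
  classical
  have hs := (((summable_norm_kernelF1 hη h).mul_right ‖kernelG1 η y‖).add
    ((summable_norm_kernelF2 hη h).mul_right ‖kernelG2 η y‖)).add
    (hasSum_ite_eq y ‖discreteBesselKernel η y y‖).summable
  refine Summable.of_nonneg_of_le (fun _ => norm_nonneg _) (fun x => ?_) hs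
  by_cases hxy : x = y
  · subst hxy
    rw [if_pos rfl]
    have : 0 ≤ ‖kernelF1 η x‖ * ‖kernelG1 η x‖ + ‖kernelF2 η x‖ * ‖kernelG2 η x‖ := by positivity
    linarith
  · rw [if_neg hxy, add_zero, discreteBesselKernel, if_neg hxy, norm_div]
    have h1 : 1 ≤ ‖((x : ℝ) : ℂ) - ((y : ℝ) : ℂ)‖ := by
      rw [← Complex.ofReal_sub, Complex.norm_real]
      exact one_le_dist_halfInts hxy
    refine (div_le_self (norm_nonneg _) h1).trans ((norm_add_le _ _).trans_eq ?_)
    rw [norm_mul, norm_mul]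

end Summability

/-! ### The equation K + LK = L -/

section KernelEquation

theorem tendsto_div_sub_awayFilter {X : Set ℂ} {ε : ℝ} {g : ℂ → ℂ} {c : ℂ}
    (hg : Tendsto g (awayFilter X ε) (𝓝 c)) (y : ℂ) :
    Tendsto (fun ζ => g ζ / (ζ - y)) (awayFilter X ε) (𝓝 0) := by
  have h1 : Tendsto (fun ζ : ℂ => ‖ζ‖ + -‖y‖) (awayFilter X ε) atTop :=
    tendsto_atTop_add_const_right _ _ (tendsto_norm_awayFilter _ _)
  have h2 : Tendsto (fun ζ : ℂ => ‖ζ - y‖) (awayFilter X ε) atTop := by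
    refine tendsto_atTop_mono (fun ζ => ?_) h1
    have := norm_sub_norm_le ζ y
    linarith
  rw [tendsto_zero_iff_norm_tendsto_zero]
  simp only [norm_div]
  exact hg.norm.div_atTop h2

theorem eventually_ne_awayFilter (X : Set ℂ) (ε : ℝ) (y : ℂ) : ∀ᶠ ζ in awayFilter X ε, ζ ≠ y := by
  filter_upwards [(tendsto_norm_awayFilter X ε).eventually_gt_atTop ‖y‖] with ζ hζ hy
  rw [hy] at hζ
  exact lt_irrefl _ hζ

theorem differentiableAt_cpow_neg_mul_Gamma {η : ℝ} (hη : 0 < η) {ζ : ℂ} (hζ : ζ ∉ negHalfC) :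
    DifferentiableAt ℂ (fun ζ => (η : ℂ) ^ (-ζ) * Complex.Gamma (ζ + 1 / 2)) ζ := by
  have hη' : (η : ℂ) ≠ 0 := Complex.ofReal_ne_zero.2 hη.ne'
  have h1 : DifferentiableAt ℂ (fun ζ : ℂ => Complex.Gamma (ζ + 1 / 2)) ζ :=
    DifferentiableAt.comp (f := fun ζ : ℂ => ζ + 1 / 2) ζ
      (Complex.differentiableAt_Gamma _ (add_half_ne_of_notMem hζ)) (by fun_prop)
  exact (differentiableAt_id.neg.const_cpow (Or.inl hη')).mul h1

theorem differentiableAt_cpow_mul_Gamma_neg {η : ℝ} (hη : 0 < η) {ζ : ℂ} (hζ : ζ ∉ posHalfC) :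
    DifferentiableAt ℂ (fun ζ => (η : ℂ) ^ ζ * Complex.Gamma (-ζ + 1 / 2)) ζ := by
  have hη' : (η : ℂ) ≠ 0 := Complex.ofReal_ne_zero.2 hη.ne'
  have h1 : DifferentiableAt ℂ (fun ζ : ℂ => Complex.Gamma (-ζ + 1 / 2)) ζ :=
    DifferentiableAt.comp (f := fun ζ : ℂ => -ζ + 1 / 2) ζ
      (Complex.differentiableAt_Gamma _ (neg_add_half_ne_of_notMem hζ)) (by fun_prop)
  exact (differentiableAt_id.const_cpow (Or.inl hη')).mul h1

variable {η θ : ℝ} (hη : 0 < η) (h : η ^ 2 = θ)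
include hη h

/-- At ζ = a + 1/2 the diagonal factor η^{-ζ} Γ(ζ + 1/2) of m is the reciprocal of the weight
occurring in L. -/
theorem halfWeight_mul_cpow_neg (a : ℕ) :
    (halfWeight θ a : ℂ) * ((η : ℂ) ^ (-((a : ℂ) + 1 / 2)) * (a ! : ℂ)) = 1 := by
  have hη' : (η : ℂ) ≠ 0 := Complex.ofReal_ne_zero.2 hη.ne'
  have h1 : (η : ℂ) ^ ((a : ℂ) + 1 / 2) ≠ 0 := by
    rw [Ne, Complex.cpow_eq_zero_iff]
    exact fun h0 => hη' h0.1
  have h2 : (a ! : ℂ) ≠ 0 := Nat.cast_ne_zero.2 (Nat.factorial_ne_zero a)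
  rw [ofReal_halfWeight hη h, Complex.cpow_neg]
  generalize (η : ℂ) ^ ((a : ℂ) + 1 / 2) = A at h1 ⊢
  field_simp

theorem summable_kernel_sub_delta (y : HalfInts) :
    Summable fun x => ‖discreteBesselKernel η x y - if x = y then 1 else 0‖ := by
  classical
  have hs := (summable_norm_discreteBesselKernel hη h y).add (hasSum_ite_eq y (1 : ℝ)).summable
  refine Summable.of_nonneg_of_le (fun _ => norm_nonneg _) (fun x => ?_) hs
  refine (norm_sub_le _ _).trans (add_le_add le_rfl ?_)
  split_ifs <;> simp

theorem summable_weight_mul {s : ℕ → HalfInts} (hs : Function.Injective s) (y : HalfInts) :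
    Summable fun b => ‖-((halfWeight θ b : ℂ) *
      (discreteBesselKernel η (s b) y - if s b = y then 1 else 0))‖ := by
  have hθ : 0 < θ := h ▸ by positivity
  have hsum := (summable_kernel_sub_delta hη h y).comp_injective hs
  refine Summable.of_nonneg_of_le (fun _ => norm_nonneg _) (fun b => ?_)
    (hsum.mul_left (∑' b, halfWeight θ b))
  rw [norm_neg, norm_mul, Complex.norm_real, Real.norm_of_nonneg (halfWeight_nonneg hθ b)]
  exact mul_le_mul_of_nonneg_right
    ((summable_halfWeight hθ).le_tsum b fun i _ => halfWeight_nonneg hθ i) (norm_nonneg _)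

/-- The function `kernelFun η y 0` times η^{-ζ} Γ(ζ + 1/2) has poles only at the points -b - 1/2,
with residue -h(b)(K - 1)(-b - 1/2, y), where h is `halfWeight θ`. It equals (m₁₁ G₁ + m₂₁ G₂)/(ζ -
y) away from y, so it vanishes at infinity and is the sum of its principal parts. At a + 1/2 the
Γ-factor is 1/h(a), and h(a) h(b)/(a+b+1) is the entry of L. -/
theorem kernel_posHalf_eq_tsum (a : ℕ) (y : HalfInts) :
    discreteBesselKernel η (posHalf a) y = ∑' b, -((kernelL θ (posHalf a) (negHalf b) : ℂ) *
      (discreteBesselKernel η (negHalf b) y - if negHalf b = y then 1 else 0)) := by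
  have hθ : 0 < θ := h ▸ by positivity
  have hη' : (η : ℂ) ≠ 0 := Complex.ofReal_ne_zero.2 hη.ne'
  let e : ℕ → ℂ := fun b => (((negHalf b : HalfInts) : ℝ) : ℂ)
  have he : Function.Injective e := fun _ _ hb =>
    negHalf_injective (Subtype.ext (Complex.ofReal_injective hb))
  have hnot : (((posHalf a : HalfInts) : ℝ) : ℂ) ∉ Set.range e := by
    rintro ⟨b, hb⟩
    exact posHalf_ne_negHalf a b (Subtype.ext (Complex.ofReal_injective hb)).symm
  have key := eq_tsum_div_sub (f := fun ζ => kernelFun η y 0 ζ *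
      ((η : ℂ) ^ (-ζ) * Complex.Gamma (ζ + 1 / 2))) he negHalfC_subset
    (summable_weight_mul hη h negHalf_injective y) ?_ ?_ ?_ hnot
  · have e1 : -(((posHalf a : HalfInts) : ℝ) : ℂ) = -((a : ℂ) + 1 / 2) := by
      rw [ofReal_posHalf]
    have e2 : (((posHalf a : HalfInts) : ℝ) : ℂ) + 1 / 2 = a + 1 := by
      rw [ofReal_posHalf]; ring
    simp only [e2] at key
    simp only [e1] at key
    rw [Complex.Gamma_nat_eq_factorial] at key
    have h5 : discreteBesselKernel η (posHalf a) y = (halfWeight θ a : ℂ) *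
        (kernelFun η y 0 (((posHalf a : HalfInts) : ℝ) : ℂ) * ((η : ℂ) ^ (-((a : ℂ) + 1 / 2)) * (a ! : ℂ))) := by
      rw [discreteBesselKernel_eq hη h, colIdx_posHalf]
      linear_combination (-kernelFun η y 0 (((posHalf a : HalfInts) : ℝ) : ℂ)) * halfWeight_mul_cpow_neg hη h a
    rw [h5, key, ← tsum_mul_left]
    refine tsum_congr fun b => ?_
    have e3 : (a : ℂ) + 1 / 2 - (-b - 1 / 2) = a + b + 1 := by ring
    have e4 : (a : ℂ) + b + 1 ≠ 0 := by exact_mod_cast (a + b).succ_ne_zero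
    rw [kernelL_pos_neg hθ]
    simp only [e]
    rw [ofReal_posHalf, ofReal_negHalf, e3]
    push_cast
    field_simp
  · intro ζ hζ
    exact ((differentiable_kernelFun hη h y 0 ζ).mul
      (differentiableAt_cpow_neg_mul_Gamma hη hζ)).differentiableWithinAt
  · intro b
    have h1 : Tendsto (fun ζ => kernelFun η y 0 ζ * (η : ℂ) ^ (-ζ)) (𝓝[≠] e b)
        (𝓝 (kernelFun η y 0 (e b) * (η : ℂ) ^ (-(e b)))) := by
      have hc : ContinuousAt (fun ζ : ℂ => (η : ℂ) ^ (-ζ)) (e b) :=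
        (differentiableAt_id.neg.const_cpow (Or.inl hη')).continuousAt
      exact ((differentiable_kernelFun hη h y 0).continuous.continuousAt.mul
        hc).tendsto.mono_left nhdsWithin_le_nhds
    have h2 := h1.mul (tendsto_pole_neg (tendsto_mul_Gamma b))
    have e1 : -(e b) = (b : ℂ) + 1 / 2 := by
      simp only [e]
      rw [ofReal_negHalf]
      ring
    have e2 : ((-1 : ℂ) ^ b) * (-1) ^ b = 1 := by rw [← mul_pow]; simp
    have e3 : kernelFun η y 0 (e b) * (η : ℂ) ^ (-(e b)) * ((-1) ^ b / (b ! : ℂ)) =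
        -((halfWeight θ b : ℂ) *
          (discreteBesselKernel η (negHalf b) y - if negHalf b = y then 1 else 0)) := by
      rw [e1, show kernelFun η y 0 (e b) = _ from kernelFun_zero_negHalf hη h b y, ofReal_halfWeight hη h, pow_succ]
      linear_combination (-(((η : ℂ) ^ ((b : ℂ) + 1 / 2) / (b ! : ℂ)) *
        (discreteBesselKernel η (negHalf b) y - if negHalf b = y then 1 else 0))) * e2
    rw [e3] at h2
    refine h2.congr fun ζ => ?_
    ring
  · have hε : (0 : ℝ) < 1 / 2 := by norm_num
    refine (tendsto_div_sub_awayFilter ((((tendsto_besselH0_neg θ hε)).mul_const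
      (kernelG1 η y)).add (((((tendsto_besselH1_neg θ hε).const_mul (η : ℂ)).neg)).mul_const (kernelG2 η y))) ((y : ℝ) : ℂ)).congr' ?_
    filter_upwards [eventually_ne_awayFilter _ _ ((y : ℝ) : ℂ)] with ζ hζ
    have m0 := besselM_apply_zero η ζ 0
    have m1 := besselM_apply_zero η ζ 1
    rw [besselM_eq hη h] at m0 m1
    simp only [Matrix.of_apply, Matrix.cons_val', Matrix.cons_val_zero, Matrix.cons_val_one,
      Matrix.cons_val_fin_one] at m0 m1
    rw [kernelFun_of_ne hη h _ _ hζ, kernelNum, m0, m1]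
    ring

theorem kernel_negHalf_eq_tsum (b : ℕ) (y : HalfInts) :
    discreteBesselKernel η (negHalf b) y = ∑' a, -((kernelL θ (negHalf b) (posHalf a) : ℂ) *
      (discreteBesselKernel η (posHalf a) y - if posHalf a = y then 1 else 0)) := by
  have hθ : 0 < θ := h ▸ by positivity
  have hη' : (η : ℂ) ≠ 0 := Complex.ofReal_ne_zero.2 hη.ne'
  let e : ℕ → ℂ := fun a => (((posHalf a : HalfInts) : ℝ) : ℂ)
  have he : Function.Injective e := fun _ _ hb =>
    posHalf_injective (Subtype.ext (Complex.ofReal_injective hb))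
  have hnot : (((negHalf b : HalfInts) : ℝ) : ℂ) ∉ Set.range e := by
    rintro ⟨a, hb⟩
    exact posHalf_ne_negHalf a b (Subtype.ext (Complex.ofReal_injective hb))
  have key := eq_tsum_div_sub (f := fun ζ => kernelFun η y 1 ζ *
      ((η : ℂ) ^ ζ * Complex.Gamma (-ζ + 1 / 2))) he posHalfC_subset
    (summable_weight_mul hη h posHalf_injective y) ?_ ?_ ?_ hnot
  · have e1 : (((negHalf b : HalfInts) : ℝ) : ℂ) = -((b : ℂ) + 1 / 2) := by
      rw [ofReal_negHalf]; ring
    have e2 : -(((negHalf b : HalfInts) : ℝ) : ℂ) + 1 / 2 = b + 1 := by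
      rw [ofReal_negHalf]; ring
    simp only [e2] at key
    simp only [e1] at key
    rw [Complex.Gamma_nat_eq_factorial] at key
    have h5 : discreteBesselKernel η (negHalf b) y = (halfWeight θ b : ℂ) *
        (kernelFun η y 1 (-((b : ℂ) + 1 / 2)) * ((η : ℂ) ^ (-((b : ℂ) + 1 / 2)) * (b ! : ℂ))) := by
      rw [discreteBesselKernel_eq hη h, colIdx_negHalf, e1]
      linear_combination (-kernelFun η y 1 (-((b : ℂ) + 1 / 2))) * halfWeight_mul_cpow_neg hη h b
    rw [h5, key, ← tsum_mul_left]
    refine tsum_congr fun a => ?_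
    have e3 : -((b : ℂ) + 1 / 2) - (a + 1 / 2) = -(a + b + 1) := by ring
    have e4 : (a : ℂ) + b + 1 ≠ 0 := by exact_mod_cast (a + b).succ_ne_zero
    rw [kernelL_neg_pos hθ]
    simp only [e]
    rw [ofReal_posHalf, e3]
    push_cast
    field_simp
  · intro ζ hζ
    exact ((differentiable_kernelFun hη h y 1 ζ).mul
      (differentiableAt_cpow_mul_Gamma_neg hη hζ)).differentiableWithinAt
  · intro a
    have h1 : Tendsto (fun ζ => kernelFun η y 1 ζ * (η : ℂ) ^ ζ) (𝓝[≠] e a)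
        (𝓝 (kernelFun η y 1 (e a) * (η : ℂ) ^ (e a))) := by
      have hc : ContinuousAt (fun ζ : ℂ => (η : ℂ) ^ ζ) (e a) :=
        (differentiableAt_id.const_cpow (Or.inl hη')).continuousAt
      exact ((differentiable_kernelFun hη h y 1).continuous.continuousAt.mul
        hc).tendsto.mono_left nhdsWithin_le_nhds
    -- The argument of Γ is now -ζ + 1/2, which reverses the sign of the residue. This makes up for
    -- the column ratio being (-1)^a here instead of (-1)^(b+1).
    have h2 := h1.mul (tendsto_pole_pos (tendsto_mul_Gamma a))
    have e1 : (e a) = (a : ℂ) + 1 / 2 := by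
      simp only [e]
      rw [ofReal_posHalf]
    have e2 : ((-1 : ℂ) ^ a) * (-1) ^ a = 1 := by rw [← mul_pow]; simp
    have e3 : kernelFun η y 1 (e a) * (η : ℂ) ^ (e a) * (-((-1) ^ a / (a ! : ℂ))) =
        -((halfWeight θ a : ℂ) *
          (discreteBesselKernel η (posHalf a) y - if posHalf a = y then 1 else 0)) := by
      rw [show kernelFun η y 1 (e a) = _ from kernelFun_one_posHalf hη h a y, e1, ofReal_halfWeight hη h]
      linear_combination (-(((η : ℂ) ^ ((a : ℂ) + 1 / 2) / (a ! : ℂ)) *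
        (discreteBesselKernel η (posHalf a) y - if posHalf a = y then 1 else 0))) * e2
    rw [e3] at h2
    refine h2.congr fun ζ => ?_
    ring
  · have hε : (0 : ℝ) < 1 / 2 := by norm_num
    refine (tendsto_div_sub_awayFilter (((((tendsto_besselH1_pos θ hε).const_mul (η : ℂ))).mul_const
      (kernelG1 η y)).add (((tendsto_besselH0_pos θ hε)).mul_const (kernelG2 η y))) ((y : ℝ) : ℂ)).congr' ?_
    filter_upwards [eventually_ne_awayFilter _ _ ((y : ℝ) : ℂ)] with ζ hζ
    have m0 := besselM_apply_one η ζ 0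
    have m1 := besselM_apply_one η ζ 1
    rw [besselM_eq hη h] at m0 m1
    simp only [Matrix.of_apply, Matrix.cons_val', Matrix.cons_val_zero, Matrix.cons_val_one,
      Matrix.cons_val_fin_one] at m0 m1
    rw [kernelFun_of_ne hη h _ _ hζ, kernelNum, m0, m1]
    ring

/-- The equation `K + L K = L`, entrywise. -/
theorem kernel_equation (x y : HalfInts) :
    discreteBesselKernel η x y + ∑' z, (kernelL θ x z : ℂ) * discreteBesselKernel η z y =
      kernelL θ x y := by
  classical
  have hθ : 0 < θ := h ▸ by positivity
  have hLK : Summable fun z => (kernelL θ x z : ℂ) * discreteBesselKernel η z y := by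
    refine Summable.of_norm_bounded ((summable_norm_discreteBesselKernel hη h y).mul_left
      (∑' q : HalfInts × HalfInts, |kernelL θ q.1 q.2|)) fun z => ?_
    rw [norm_mul, Complex.norm_real]
    exact mul_le_mul_of_nonneg_right
      ((summable_kernelL hθ).le_tsum (x, z) fun _ _ => abs_nonneg _) (norm_nonneg _)
  have hδ : HasSum (fun z => (kernelL θ x z : ℂ) * if z = y then 1 else 0) (kernelL θ x y : ℂ) := by
    have := hasSum_ite_eq y (kernelL θ x y : ℂ)
    refine this.congr_fun fun z => ?_
    split_ifs with hz <;> simp [hz]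
  -- This is K = -L(K - 1). The sum over the opposite half is the full sum, as L vanishes between
  -- points of equal sign.
  have hsum : discreteBesselKernel η x y = ∑' z, -((kernelL θ x z : ℂ) *
      (discreteBesselKernel η z y - if z = y then 1 else 0)) := by
    rcases halfInts_cases x with ⟨a, rfl⟩ | ⟨b, rfl⟩
    · rw [kernel_posHalf_eq_tsum hη h]
      refine negHalf_injective.tsum_eq (f := fun z => -((kernelL θ (posHalf a) z : ℂ) *
        (discreteBesselKernel η z y - if z = y then 1 else 0))) fun z hz => ?_
      rcases halfInts_cases z with ⟨c, rfl⟩ | ⟨c, rfl⟩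
      · exact absurd (by simp [kernelL_pos_pos]) hz
      · exact ⟨c, rfl⟩
    · rw [kernel_negHalf_eq_tsum hη h]
      refine posHalf_injective.tsum_eq (f := fun z => -((kernelL θ (negHalf b) z : ℂ) *
        (discreteBesselKernel η z y - if z = y then 1 else 0))) fun z hz => ?_
      rcases halfInts_cases z with ⟨c, rfl⟩ | ⟨c, rfl⟩
      · exact ⟨c, rfl⟩
      · exact absurd (by simp [kernelL_neg_neg]) hz
  simp only [mul_sub] at hsum
  rw [tsum_neg, hLK.tsum_sub hδ.summable, hδ.tsum_eq] at hsum
  linear_combination hsum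

end KernelEquation

/-! ### From matrix entries to operators on ℓ² -/

section MatrixOperator

variable {X : Type*} [DecidableEq X]

/-- The operator on `ℓ²` whose matrix has the absolutely summable family of entries `c`. -/
def matrixOperator (c : X × X → ℂ) : lp (fun _ : X => ℂ) 2 →L[ℂ] lp (fun _ : X => ℂ) 2 :=
  ∑' q : X × X, c q • InnerProductSpace.rankOne ℂ (lp.single 2 q.1 (1 : ℂ) : lp (fun _ : X => ℂ) 2)
    (lp.single 2 q.2 (1 : ℂ) : lp (fun _ : X => ℂ) 2)

theorem summable_matrixOperator {c : X × X → ℂ} (hc : Summable fun q => ‖c q‖) :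
    Summable fun q : X × X => c q • InnerProductSpace.rankOne ℂ
      (lp.single 2 q.1 (1 : ℂ) : lp (fun _ : X => ℂ) 2)
      (lp.single 2 q.2 (1 : ℂ) : lp (fun _ : X => ℂ) 2) := by
  refine Summable.of_norm_bounded hc fun q => ?_
  have h1 : ∀ x : X, ‖(lp.single 2 x (1 : ℂ) : lp (fun _ : X => ℂ) 2)‖ = 1 := fun x => by
    rw [lp.norm_single (by norm_num), norm_one]
  rw [norm_smul, InnerProductSpace.norm_rankOne, h1, h1, mul_one, mul_one]

theorem matrixOperator_apply {c : X × X → ℂ} (hc : Summable fun q => ‖c q‖)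
    (v : lp (fun _ : X => ℂ) 2) (x : X) : matrixOperator c v x = ∑' z, c (x, z) * v z := by
  have h1 := ((summable_matrixOperator hc).hasSum.mapL
    (ContinuousLinearMap.apply ℂ (lp (fun _ : X => ℂ) 2) v)).mapL (lp.evalCLM ℂ (fun _ : X => ℂ) 2 x)
  have h2 := h1.tsum_eq
  change _ = matrixOperator c v x at h2
  rw [← h2]
  have h3 : ∀ q : X × X, lp.evalCLM ℂ (fun _ : X => ℂ) 2 x
      (ContinuousLinearMap.apply ℂ (lp (fun _ : X => ℂ) 2) v
        (c q • InnerProductSpace.rankOne ℂ (lp.single 2 q.1 (1 : ℂ) : lp (fun _ : X => ℂ) 2)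
          (lp.single 2 q.2 (1 : ℂ) : lp (fun _ : X => ℂ) 2))) =
      if q.1 = x then c q * v q.2 else 0 := by
    intro q
    change (c q • (inner ℂ (lp.single 2 q.2 (1 : ℂ) : lp (fun _ : X => ℂ) 2) v •
      (lp.single 2 q.1 (1 : ℂ) : lp (fun _ : X => ℂ) 2))) x = _
    rw [lp.inner_single_left]
    simp only [lp.coeFn_smul, Pi.smul_apply, lp.single_apply, smul_eq_mul]
    split_ifs with hq
    · subst hq
      simp
    · simp [Ne.symm hq]
  simp only [h3]
  have hinj : Function.Injective fun z : X => (x, z) := fun _ _ h => (Prod.mk.inj h).2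
  rw [← hinj.tsum_eq (f := fun q : X × X => if q.1 = x then c q * v q.2 else 0)]
  · simp
  · rintro ⟨a, b⟩ hq
    by_cases ha : a = x
    · exact ⟨b, by rw [ha]⟩
    · exact absurd (if_neg ha) hq

theorem hasMatrix_matrixOperator {c : X × X → ℂ} (hc : Summable fun q => ‖c q‖) :
    HasMatrix (matrixOperator c) fun x y => c (x, y) := by
  intro x y
  rw [matrixOperator_apply hc, tsum_eq_single y]
  · rw [lp.single_apply_self, mul_one]
  · intro z hz
    have h1 := lp.single_apply_ne (E := fun _ : X => ℂ) 2 y (1 : ℂ) hz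
    simp only [h1, mul_zero]

theorem star_matrixOperator {c : X × X → ℂ} (hanti : ∀ x y, star (c (y, x)) = -c (x, y)) :
    star (matrixOperator c) = -matrixOperator c := by
  rw [matrixOperator, tsum_star, ← tsum_neg, ← (Equiv.prodComm X X).tsum_eq]
  refine tsum_congr fun q => ?_
  rw [star_smul, ContinuousLinearMap.star_eq_adjoint, InnerProductSpace.adjoint_rankOne]
  simp only [Equiv.prodComm_apply, Prod.fst_swap, Prod.snd_swap]
  rw [← neg_smul, ← hanti q.1 q.2]
  rfl

/-- If `T* = -T` then `1 + T` is invertible. -/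
theorem isUnit_one_add_of_star_eq_neg {A : Type*} [CStarAlgebra A] {T : A} (hT : star T = -T) :
    IsUnit (1 + T) := by
  -- The element -iT is self-adjoint, so its spectrum is real and i is not in it; and i - (-iT) =
  -- i(1 + T).
  have hS : IsSelfAdjoint (-(Complex.I • T)) := by
    rw [isSelfAdjoint_iff, star_neg, star_smul, hT]
    simp
  have hI : Complex.I ∉ spectrum ℂ (-(Complex.I • T)) := fun h => by
    have := congrArg Complex.im (hS.mem_spectrum_eq_re h)
    simp at this
  rw [spectrum.notMem_iff, sub_neg_eq_add, Algebra.algebraMap_eq_smul_one, ← smul_add] at hI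
  exact (isUnit_smul_iff (Units.mk0 Complex.I Complex.I_ne_zero) (1 + T)).1 hI

/-- The resolvent equation for kernels gives the matrix of `T (1 + T)⁻¹`. -/
theorem exists_operator_of_equation {L : X → X → ℝ} {K : X → X → ℂ}
    (hL : Summable fun q : X × X => |L q.1 q.2|) (hanti : ∀ x y, L y x = -L x y)
    (hK : ∀ y, Summable fun x => ‖K x y‖)
    (heq : ∀ x y, K x y + ∑' z, (L x z : ℂ) * K z y = L x y) :
    ∃ T : lp (fun _ : X => ℂ) 2 →L[ℂ] lp (fun _ : X => ℂ) 2,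
      HasMatrix T (fun x y => (L x y : ℂ)) ∧ IsUnit (1 + T) ∧
        HasMatrix (T * Ring.inverse (1 + T)) K := by
  let c : X × X → ℂ := fun q => (L q.1 q.2 : ℂ)
  have hc : Summable fun q => ‖c q‖ := by
    simpa [c] using hL
  have hu : IsUnit (1 + matrixOperator c) := by
    refine isUnit_one_add_of_star_eq_neg (star_matrixOperator fun x y => ?_)
    simp [c, hanti x y]
  refine ⟨matrixOperator c, hasMatrix_matrixOperator hc, hu, fun x y => ?_⟩
  have hmem : Memℓp (fun x => K x y) 2 := by
    refine Memℓp.of_exponent_ge (q := 1) (memℓp_gen ?_) (by norm_num)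
    simpa using hK y
  let v : lp (fun _ : X => ℂ) 2 := ⟨fun x => K x y, hmem⟩
  -- The column of K is in ℓ¹ and hence in ℓ², and column y of the kernel equation says (1 + T) v =
  -- T e_y.
  have hv : (1 + matrixOperator c) v = matrixOperator c (lp.single 2 y (1 : ℂ)) := by
    ext x
    rw [hasMatrix_matrixOperator hc x y]
    change v x + matrixOperator c v x = _
    rw [matrixOperator_apply hc]
    exact heq x y
  -- Since T commutes with (1 + T)⁻¹, the column T(1 + T)⁻¹ e_y equals (1 + T)⁻¹ T e_y = v.
  have hcomm : matrixOperator c * Ring.inverse (1 + matrixOperator c) =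
      Ring.inverse (1 + matrixOperator c) * matrixOperator c := by
    have h1 : Commute (1 + matrixOperator c) (matrixOperator c) :=
      (Commute.one_left _).add_left (Commute.refl _)
    refine hu.mul_left_cancel ?_
    rw [← mul_assoc, h1.eq, mul_assoc, Ring.mul_inverse_cancel _ hu, mul_one, ← mul_assoc,
      Ring.mul_inverse_cancel _ hu, one_mul]
  rw [hcomm]
  change Ring.inverse (1 + matrixOperator c) (matrixOperator c (lp.single 2 y (1 : ℂ))) x = _
  rw [← hv]
  change (Ring.inverse (1 + matrixOperator c) * (1 + matrixOperator c)) v x = _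
  rw [Ring.inverse_mul_cancel _ hu]
  rfl

end MatrixOperator
theorem mainTheorem1 (θ : ℝ) (hθ : 0 < θ) :
    -- the poissonized Plancherel measure is a probability measure, and `L` is its L-kernel
    IsProbabilityMeasure (poissonizedPlancherel θ) ∧
    (∀ (n : ℕ) (y : Fin n → HalfInts), Function.Injective y →
      (plancherelProcess θ).real {Set.range y} =
        Real.exp (-θ) * Matrix.det (Matrix.of fun i j => kernelL θ (y i) (y j))) ∧
    -- `L` is (the matrix of) a bounded operator on `ℓ²(ℤ')`, `1 + L` is invertible, and
    -- `L (1 + L)⁻¹` has as its matrix the discrete Bessel kernel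
    Summable (fun q : HalfInts × HalfInts => |kernelL θ q.1 q.2|) ∧
    (∃ T : lp (fun _ : HalfInts => ℂ) 2 →L[ℂ] lp (fun _ : HalfInts => ℂ) 2,
      HasMatrix T (fun x y => (kernelL θ x y : ℂ)) ∧
      IsUnit (1 + T) ∧
      HasMatrix (T * Ring.inverse (1 + T)) (discreteBesselKernel (Real.sqrt θ))) ∧
    -- the discrete Bessel kernel is the correlation kernel of the process
    IsDeterminantal (plancherelProcess θ) (discreteBesselKernel (Real.sqrt θ)) ∧
    -- `p` is entire and the numerator of the kernel vanishes on the diagonal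
    (∀ i j, Differentiable ℂ (fun ζ => besselP (Real.sqrt θ) ζ i j)) ∧
    (∀ x : HalfInts, kernelF1 (Real.sqrt θ) x * kernelG1 (Real.sqrt θ) x +
      kernelF2 (Real.sqrt θ) x * kernelG2 (Real.sqrt θ) x = 0) ∧
    -- the matrix built from `p` is the unique solution of the normalized discrete
    -- Riemann–Hilbert problem
    SolvesNormalizedDRHP halfIntsC (jumpW θ) (besselM (Real.sqrt θ)) ∧
    (∀ m : ℂ → Matrix (Fin 2) (Fin 2) ℂ, SolvesNormalizedDRHP halfIntsC (jumpW θ) m →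
      Set.EqOn m (besselM (Real.sqrt θ)) halfIntsCᶜ) := by
  obtain ⟨hη, h⟩ : 0 < Real.sqrt θ ∧ Real.sqrt θ ^ 2 = θ :=
    ⟨Real.sqrt_pos.2 hθ, Real.sq_sqrt hθ.le⟩
  exact ⟨isProbabilityMeasure_poissonizedPlancherel hθ.le, fun n y hy => plancherelProcess_range hθ y hy,
    summable_kernelL hθ,
    exists_operator_of_equation (summable_kernelL hθ) (kernelL_antisymm θ)
      (summable_norm_discreteBesselKernel hη h) (kernel_equation hη h),
    isDeterminantal_of_equation hθ (summable_kernelL hθ)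
      (summable_norm_discreteBesselKernel hη h) (kernel_equation hη h),
    differentiable_besselP hη h, kernelF_mul_kernelG (Real.sqrt θ),
    solvesNormalizedDRHP_besselM hη h,
    fun m hm => eqOn_of_solvesNormalizedDRHP hθ (solvesNormalizedDRHP_besselM hη h) hm⟩
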